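/- **Definitions.** Let $\mathcal R$ be a finite set of registers and $\Omega$ an alphabet. An *assignment* is a partial function $\sigma:\mathcal R\rightharpoonup(\mathcal R\cup\Omega)^*$; it extends to strings by $\hat\sigma(\alpha_1\cdots\alpha_n)=\sigma(\alpha_1)\cdots\sigma(\alpha_n)$ with $\sigma(a)=a$ for $a\in\Omega$ (undefined if some $\sigma(\alpha_i)$ is), and $[\sigma_1\circ\sigma_2](X)=\hat\sigma_1(\sigma_2(X))$. It is *copyless* if every register occurs at most once in all strings $\sigma(Y)$ together, a *valuation* if all its values lie in $\Omega^*$, a *relabel* if all its values are single registers. $\operatorname{dom}(\sigma)$ is its domain, $\operatorname{reg}(\sigma)$ the set of registers occurring in its values, and $|\sigma|=\sum_{X\in\operatorname{dom}\sigma}|\sigma(X)|$. An *Enumerable Compact Set with Assignments* (ECSA) $\mathcal D$ consists of a finite set of nodes, partial functions $\ell,r$ (left and right child) that form an acyclic graph, and a labelling $\lambda$ of the nodes by $\cup$ or copyless assignments, such that $\cup$-nodes have both children, nodes labelled by an assignment have no right child, and they have no left child iff the label is a valuation. A node labelled by an assignment is a $\nu$-node if its label is a valuation, a $\gamma$-node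 if its label is a relabel and not a valuation, and a $\sigma$-node otherwise. The bag $[\![\mathcal D]\!](n)$ of valuations is $\{\!\{\lambda(n)\}\!\}$ at a $\nu$-node, $[\![\mathcal D]\!](\ell(n))\uplus[\![\mathcal D]\!](r(n))$ at a $\cup$-node, and $\{\!\{\nu\circ\lambda(n)\mid\nu\in[\![\mathcal D]\!](\ell(n))\}\!\}$ at a $\gamma$- or $\sigma$-node. The output depth is $\operatorname{odepth}(n)=0$ for $\nu$- and $\sigma$-nodes and $\operatorname{odepth}(\ell(n))+1$ for $\cup$- and $\gamma$-nodes; $\mathcal D$ is *$k$-bounded* if $\operatorname{odepth}(n)\le k$ for all nodes. $\mathcal D$ is *garbage-free* if $\operatorname{dom}(\nu)=\operatorname{reg}(\lambda(n))$ for every $\gamma$- or $\sigma$-node $n$ and $\nu\in[\![\mathcal D]\!](\ell(n))$. A node is a *safe output-node* if it is a $\nu$- or $\sigma$-node, or a $\gamma$-node whose left child is a $\nu$- or $\sigma$-node; a *safe union-node* if it is a $\cup$-node whose left child is a safe output-node and whose right child has output depth at most $2$; and *safe* if it is a safe output-node, a safe union-node, or a $\gamma$-node whose left child is a safe union-node.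 The computational model is the random access machine with uniform cost measure and with addition and (truncated) subtraction on natural numbers. Assignments that are arguments of operations lie in a read-only input memory and are passed by their address; an assignment is stored as a table of the addresses of its strings, a string as its length followed by its symbols. An ECSA is kept in the work memory, where every node is a record containing its label (or the address of the label) and its children; an implementation may keep further data elsewhere in the work memory. **Theorem.** Let $\mathcal R$ be a fixed finite set of registers. There are RAM programs for the initialization of an empty ECSA, for the operations $\operatorname{add}$, $\operatorname{extend}$, $\operatorname{union}$, and for enumeration, and a constant $c$, all depending only on $\mathcal R$ (not on $\Omega$), such that the following holds for every structure obtained by initializing an empty ECSA and then running these programs in any order on arguments that satisfy the prerequisites below. 1. *(Constant time and correctness.)* Initialization and every operation halt after at most $c$ steps. They keep in memory an ECSA that is garbage-free. If $\mathcal D$ is the structure before the operation and $\mathcal D'$ the one after it, the resulting node $n'$ of $\mathcal D'$ satisfies * $[\![\mathcal D']\!](n')=\{\!\{\nu\}\!\}$ for $\operatorname{add}(\nu)$, where $\nu$ is a valuation; * $[\![\mathcal D']\!](n')=\{\!\{\nu'\circ\sigma\mid\nu'\in[\![\mathcal D]\!](n)\}\!\}$ for $\operatorname{extend}(n,\sigma)$,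 where $n$ is a node of $\mathcal D$ and $\sigma$ is a copyless assignment that is not a valuation, with $\operatorname{dom}(\nu')=\operatorname{reg}(\sigma)$ for all $\nu'\in[\![\mathcal D]\!](n)$; * $[\![\mathcal D']\!](n')=[\![\mathcal D]\!](n_1)\uplus[\![\mathcal D]\!](n_2)$ for $\operatorname{union}(n_1,n_2)$, where $n_1,n_2$ are nodes of $\mathcal D$ with $\operatorname{dom}(\nu_1)=\operatorname{dom}(\nu_2)$ for all $\nu_1\in[\![\mathcal D]\!](n_1)$, $\nu_2\in[\![\mathcal D]\!](n_2)$. 2. *(Full persistence.)* All nodes of $\mathcal D$ are nodes of $\mathcal D'$ with the same label, the same children and the same bag of valuations, and any of them may be used in later operations. 3. *(Safety.)* If the node arguments of the operation are safe nodes of $\mathcal D$, then $n'$ is a safe node of $\mathcal D'$, and if moreover $\mathcal D$ is $4$-bounded, then so is $\mathcal D'$. In particular, if one starts from the empty ECSA and always applies the operations to safe nodes, then all results are safe and the ECSA stays $4$-bounded. 4. *(Enumeration.)* If $\mathcal D$ is $4$-bounded then, for every node $n$, the enumeration program started on $n$ prints, without preprocessing, all valuations of the bag $[\![\mathcal D]\!](n)$,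 each as often as it occurs there, with output-linear delay: the number of steps from the start to the completion of the first output $\nu_1$ is at most $c\,(|\nu_1|+1)$, the number of steps between the completion of the outputs $\nu_{i-1}$ and $\nu_i$ is at most $c\,(|\nu_i|+1)$, and the program halts at most $c$ steps after the last output. The ECSA $\mathcal D$ is unchanged and remains available afterwards. -/

import Mathlib

namespace SST

/-! ### Assignments, valuations, relabels -/

/-- An assignment over registers `R` and alphabet `Ω`: a partial function from registers to
strings over registers and letters (`none` is "undefined"). -/
abbrev Asg (R Ω : Type*) := R → Option (List (R ⊕ Ω))

namespace Asg

variable {R Ω : Type*}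

/-- The value of an assignment on one symbol: letters are mapped to themselves. -/
def onSymbol (σ : Asg R Ω) : R ⊕ Ω → Option (List (R ⊕ Ω))
  | Sum.inl X => σ X
  | Sum.inr a => some [Sum.inr a]

/-- The extension of an assignment to strings; undefined as soon as one symbol is. -/
def hat (σ : Asg R Ω) : List (R ⊕ Ω) → Option (List (R ⊕ Ω))
  | [] => some []
  | s :: u => (σ.onSymbol s).bind fun v => (σ.hat u).map fun w => v ++ w

/-- Composition: `(σ₁ ∘ σ₂)(X) = hat σ₁ (σ₂ X)`. -/
def comp (σ₁ σ₂ : Asg R Ω) : Asg R Ω := fun X => (σ₂ X).bind σ₁.hat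

/-- Every register has at most one occurrence in all the strings `σ Y` together. -/
def Copyless (σ : Asg R Ω) : Prop :=
  ∀ (X Y Y' : R) (w w' : List (R ⊕ Ω)) (i j : ℕ), σ Y = some w → σ Y' = some w' →
    w[i]? = some (Sum.inl X) → w'[j]? = some (Sum.inl X) → Y = Y' ∧ i = j

/-- The domain of an assignment. -/
def dom (σ : Asg R Ω) : Set R := {X | σ X ≠ none}

/-- The set of registers used by an assignment. -/
def reg (σ : Asg R Ω) : Set R := {Y | ∃ X w, σ X = some w ∧ Sum.inl Y ∈ w}

/-- A valuation: a partial function from registers to strings of letters. -/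
def IsValuation (σ : Asg R Ω) : Prop :=
  ∀ X w, σ X = some w → ∀ s ∈ w, ∃ a : Ω, s = Sum.inr a

/-- A relabel: a partial function from registers to registers. -/
def IsRelabel (σ : Asg R Ω) : Prop :=
  ∀ X w, σ X = some w → ∃ Y : R, w = [Sum.inl Y]

/-- The size of an assignment: the sum of the lengths of its strings. -/
def size [Fintype R] (σ : Asg R Ω) : ℕ := ∑ X, ((σ X).getD []).length

end Asg

/-! ### Enumerable Compact Sets with Assignments -/

/-- Node labels: the union symbol or an assignment. -/
inductive Label (R Ω : Type*)
  | union : Label R Ω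
  | asg (σ : Asg R Ω) : Label R Ω

/-- An Enumerable Compact Set with Assignments. Nodes are named by natural numbers (which will be
memory addresses); the values of `left`, `right`, `label` outside `nodes` are irrelevant. -/
structure ECSA (R Ω : Type*) where
  nodes : Finset ℕ
  left : ℕ → Option ℕ
  right : ℕ → Option ℕ
  label : ℕ → Label R Ω
  left_mem : ∀ n ∈ nodes, ∀ m, left n = some m → m ∈ nodes
  right_mem : ∀ n ∈ nodes, ∀ m, right n = some m → m ∈ nodes
  union_children : ∀ n ∈ nodes, label n = .union → left n ≠ none ∧ right n ≠ none
  asg_copyless : ∀ n ∈ nodes, ∀ σ, label n = .asg σ → σ.Copyless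
  asg_right : ∀ n ∈ nodes, ∀ σ, label n = .asg σ → right n = none
  asg_left : ∀ n ∈ nodes, ∀ σ, label n = .asg σ → (left n = none ↔ σ.IsValuation)
  acyclic : ∀ n, ¬ Relation.TransGen
    (fun a b => a ∈ nodes ∧ (left a = some b ∨ right a = some b)) n n

namespace ECSA

variable {R Ω : Type*}

/-- `m` is a child (left or right) of the node `n`. -/
def Child (D : ECSA R Ω) (m n : ℕ) : Prop :=
  n ∈ D.nodes ∧ (D.left n = some m ∨ D.right n = some m)

/-- A finite acyclic graph is well founded. -/
theorem wf (D : ECSA R Ω) : WellFounded D.Child := by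
  have hsw : ∀ a b, Relation.TransGen D.Child a b → Relation.TransGen
      (fun a b => a ∈ D.nodes ∧ (D.left a = some b ∨ D.right a = some b)) b a := by
    intro a b h
    induction h with
    | single h => exact .single h
    | tail _ h ih => exact .head h ih
  have hfin : WellFounded (fun a b : D.nodes => Relation.TransGen D.Child a.1 b.1) := by
    have : IsTrans D.nodes (fun a b => Relation.TransGen D.Child a.1 b.1) :=
      ⟨fun _ _ _ h h' => h.trans h'⟩
    have : Std.Irrefl (fun a b : D.nodes => Relation.TransGen D.Child a.1 b.1) :=
      ⟨fun a h => D.acyclic a.1 (hsw _ _ h)⟩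
    exact Finite.wellFounded_of_trans_of_irrefl _
  have hmem : ∀ m n, D.Child m n → m ∈ D.nodes := by
    rintro m n ⟨hn, h | h⟩
    · exact D.left_mem n hn m h
    · exact D.right_mem n hn m h
  have hacc : ∀ a : D.nodes, Acc D.Child a.1 := by
    intro a
    induction a using hfin.induction with
    | _ a ih => exact ⟨_, fun b hb => ih ⟨b, hmem b _ hb⟩ (.single hb)⟩
  exact ⟨fun n => ⟨_, fun m hm => hacc ⟨m, hmem m n hm⟩⟩⟩

/-- The bag of valuations of a node: `{λ(n)}` for a bottom node, the sum of the bags of the two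
children for a union node, and `{ν ∘ λ(n) | ν in the bag of the left child}` for the other output
nodes. (By the axioms of an ECSA a node labelled by an assignment has no left child exactly if the
label is a valuation.) -/
noncomputable def bag (D : ECSA R Ω) : ℕ → Multiset (Asg R Ω) :=
  D.wf.fix fun n rec =>
    if hn : n ∈ D.nodes then
      match D.label n, hl : D.left n, hr : D.right n with
      | .union, some a, some b => rec a ⟨hn, .inl hl⟩ + rec b ⟨hn, .inr hr⟩
      | .asg σ, none, _ => {σ}
      | .asg σ, some a, _ => (rec a ⟨hn, .inl hl⟩).map fun ν => ν.comp σ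
      | .union, _, _ => 0
    else 0

/-- `n` is a union node. -/
def IsUnion (D : ECSA R Ω) (n : ℕ) : Prop := n ∈ D.nodes ∧ D.label n = .union

/-- `n` is a bottom node (labelled by a valuation). -/
def IsNu (D : ECSA R Ω) (n : ℕ) : Prop :=
  n ∈ D.nodes ∧ ∃ σ, D.label n = .asg σ ∧ σ.IsValuation

/-- `n` is labelled by a relabel and is not a bottom node. -/
def IsGamma (D : ECSA R Ω) (n : ℕ) : Prop :=
  n ∈ D.nodes ∧ ∃ σ, D.label n = .asg σ ∧ σ.IsRelabel ∧ ¬ σ.IsValuation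

/-- `n` is labelled by an assignment that is neither a valuation nor a relabel. -/
def IsSigma (D : ECSA R Ω) (n : ℕ) : Prop :=
  n ∈ D.nodes ∧ ∃ σ, D.label n = .asg σ ∧ ¬ σ.IsRelabel ∧ ¬ σ.IsValuation

open Classical in
/-- The (left) output depth of a node: one plus that of the left child for union nodes and
relabel nodes, and `0` for the other nodes. -/
noncomputable def odepth (D : ECSA R Ω) : ℕ → ℕ :=
  D.wf.fix fun n rec =>
    if hn : D.IsUnion n ∨ D.IsGamma n then
      match hl : D.left n with
      | some a => rec a ⟨hn.elim (fun h => h.1) (fun h => h.1), .inl hl⟩ + 1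
      | none => 0
    else 0

/-- The structure is `k`-bounded. -/
def Bounded (D : ECSA R Ω) (k : ℕ) : Prop := ∀ n ∈ D.nodes, D.odepth n ≤ k

/-- The structure is garbage-free. -/
def GarbageFree (D : ECSA R Ω) : Prop :=
  ∀ n, D.IsSigma n ∨ D.IsGamma n → ∀ σ m, D.label n = .asg σ → D.left n = some m →
    ∀ ν ∈ D.bag m, ν.dom = σ.reg

/-- Safe output-nodes. -/
def SafeOutput (D : ECSA R Ω) (n : ℕ) : Prop :=
  D.IsNu n ∨ D.IsSigma n ∨
    (D.IsGamma n ∧ ∃ m, D.left n = some m ∧ (D.IsNu m ∨ D.IsSigma m))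

/-- Safe union-nodes. -/
def SafeUnion (D : ECSA R Ω) (n : ℕ) : Prop :=
  D.IsUnion n ∧ (∃ a, D.left n = some a ∧ D.SafeOutput a) ∧
    ∃ b, D.right n = some b ∧ D.odepth b ≤ 2

/-- Safe nodes. -/
def Safe (D : ECSA R Ω) (n : ℕ) : Prop :=
  D.SafeOutput n ∨ D.SafeUnion n ∨ (D.IsGamma n ∧ ∃ m, D.left n = some m ∧ D.SafeUnion m)

/-- `D'` arises from `D` by adding nodes; the old nodes are immutable: neither their label and
their children nor their bags change. -/
def Extends (D D' : ECSA R Ω) : Prop :=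
  D.nodes ⊆ D'.nodes ∧ ∀ n ∈ D.nodes, D'.label n = D.label n ∧ D'.left n = D.left n ∧
    D'.right n = D.right n ∧ D'.bag n = D.bag n

/-- The empty structure. -/
def empty : ECSA R Ω where
  nodes := ∅
  left := fun _ => none
  right := fun _ => none
  label := fun _ => .union
  left_mem := by simp
  right_mem := by simp
  union_children := by simp
  asg_copyless := by simp
  asg_right := by simp
  asg_left := by simp
  acyclic := by
    intro n h
    cases h with
    | single h => simp at h
    | tail _ h => simp at h

end ECSA

/-! ### Random access machines with uniform cost -/

/-- Structured RAM programs over natural numbers. The machine has registers (addressed directly),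
a work memory (addressed indirectly), a read-only input memory (addressed indirectly) and a
write-only output stream. The arithmetic operations are addition and (truncated) subtraction. -/
inductive Cmd
  /-- do nothing -/
  | skip
  /-- `reg r := k` -/
  | const (r k : ℕ)
  /-- `reg r := reg s` -/
  | move (r s : ℕ)
  /-- `reg r := reg s + reg t` -/
  | add (r s t : ℕ)
  /-- `reg r := reg s - reg t` -/
  | sub (r s t : ℕ)
  /-- `reg r := mem (reg s)` -/
  | load (r s : ℕ)
  /-- `mem (reg r) := reg s` -/
  | store (r s : ℕ)
  /-- `reg r := input (reg s)` -/
  | input (r s : ℕ)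
  /-- append `reg r` to the output stream -/
  | emit (r : ℕ)
  /-- sequential composition -/
  | seq (a b : Cmd)
  /-- if `reg r ≠ 0` then `a` else `b` -/
  | ite (r : ℕ) (a b : Cmd)
  /-- while `reg r ≠ 0` do `a` -/
  | loop (r : ℕ) (a : Cmd)

/-- A configuration: the commands that are still to be executed, the contents of the registers and
of the work memory, and the output produced so far. -/
@[ext] structure Config where
  code : List Cmd
  reg : ℕ → ℕ
  mem : ℕ → ℕ
  out : List ℕ

/-- One step of the machine with input memory `I`. Every instruction and every test takes one
step; a machine with nothing left to execute has halted. -/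
def step (I : ℕ → ℕ) (C : Config) : Config :=
  match C.code with
  | [] => C
  | .skip :: K => { C with code := K }
  | .const r k :: K => { C with code := K, reg := Function.update C.reg r k }
  | .move r s :: K => { C with code := K, reg := Function.update C.reg r (C.reg s) }
  | .add r s t :: K =>
      { C with code := K, reg := Function.update C.reg r (C.reg s + C.reg t) }
  | .sub r s t :: K =>
      { C with code := K, reg := Function.update C.reg r (C.reg s - C.reg t) }
  | .load r s :: K => { C with code := K, reg := Function.update C.reg r (C.mem (C.reg s)) }
  | .store r s :: K => { C with code := K, mem := Function.update C.mem (C.reg r) (C.reg s) }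
  | .input r s :: K => { C with code := K, reg := Function.update C.reg r (I (C.reg s)) }
  | .emit r :: K => { C with code := K, out := C.out ++ [C.reg r] }
  | .seq a b :: K => { C with code := a :: b :: K }
  | .ite r a b :: K => { C with code := (if C.reg r ≠ 0 then a else b) :: K }
  | .loop r a :: K => { C with code := if C.reg r ≠ 0 then a :: .loop r a :: K else K }

/-- The configuration after `t` steps of the program `P`, started with register contents `s` and
work memory `W`. -/
def runFor (I : ℕ → ℕ) (P : Cmd) (s W : ℕ → ℕ) (t : ℕ) : Config :=
  (step I)^[t] ⟨[P], s, W, []⟩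

/-- Started with register contents `s` and work memory `W`, the program `P` halts after at most `c`
steps, with `result` in register `0` and with work memory `W'`. -/
def HaltsWithin (I : ℕ → ℕ) (c : ℕ) (P : Cmd) (s W : ℕ → ℕ) (result : ℕ) (W' : ℕ → ℕ) : Prop :=
  ∃ t ≤ c, (runFor I P s W t).code = [] ∧ (runFor I P s W t).reg 0 = result ∧
    (runFor I P s W t).mem = W'

/-! ### Representation in memory -/

section Representation

variable {R Ω : Type*} [Fintype R]

/-- The code of a symbol: registers are numbered from `0` by `ρ`, and the letters, numbered by `ω`,
come after the registers. -/
def symbolCode (ρ : R ≃ Fin (Fintype.card R)) (ω : Ω ↪ ℕ) : R ⊕ Ω → ℕ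
  | Sum.inl X => (ρ X : ℕ)
  | Sum.inr a => Fintype.card R + ω a

/-- The memory `B` holds the string `w` at address `q`: its length and then its symbols. -/
def HoldsString (ρ : R ≃ Fin (Fintype.card R)) (ω : Ω ↪ ℕ) (B : ℕ → ℕ) (q : ℕ)
    (w : List (R ⊕ Ω)) : Prop :=
  B q = w.length ∧ ∀ (i : ℕ) (h : i < w.length), B (q + 1 + i) = symbolCode ρ ω w[i]

/-- The memory `B` holds the assignment `σ` at address `p`: a table with one entry for every
register, which is `0` if `σ` is undefined there and else the (nonzero) address of the string. -/
def HoldsAsg (ρ : R ≃ Fin (Fintype.card R)) (ω : Ω ↪ ℕ) (B : ℕ → ℕ) (p : ℕ)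
    (σ : Asg R Ω) : Prop :=
  ∀ X : R, match σ X with
    | none => B (p + ρ X) = 0
    | some w => B (p + ρ X) ≠ 0 ∧ HoldsString ρ ω B (B (p + ρ X)) w

/-- The structure `D` is stored in the work memory `W` (with input memory `I`). The name of a node
is its nonzero address `n`. The cell `n` tells the kind of the label (`0`: union; `1`: an assignment
in the input memory; `2`: an assignment in the work memory), the cells `n + 1`, `n + 2` hold the
addresses of the left and right child (`0`: none), and the cell `n + 3` the address of the
assignment. All other cells are at the disposal of the implementation. -/
def ECSA.StoredIn (D : ECSA R Ω) (ρ : R ≃ Fin (Fintype.card R)) (ω : Ω ↪ ℕ)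
    (I W : ℕ → ℕ) : Prop :=
  ∀ n ∈ D.nodes, n ≠ 0 ∧ W (n + 1) = (D.left n).getD 0 ∧ W (n + 2) = (D.right n).getD 0 ∧
    match D.label n with
    | .union => W n = 0
    | .asg σ => (W n = 1 ∧ HoldsAsg ρ ω I (W (n + 3)) σ) ∨ (W n = 2 ∧ HoldsAsg ρ ω W (W (n + 3)) σ)

/-- How a valuation is printed: for every register, in the order of their numbers, `0` if it is
undefined and else `1` followed by its string, a letter `a` being printed as `ω a + 3`; at the end
the end marker `2`. (Register symbols do not occur in valuations.) -/
def printed (ρ : R ≃ Fin (Fintype.card R)) (ω : Ω ↪ ℕ) (ν : Asg R Ω) : List ℕ :=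
  ((List.finRange (Fintype.card R)).flatMap fun i =>
    match ν (ρ.symm i) with
    | none => [0]
    | some w => 1 :: w.filterMap (Sum.elim (fun _ => none) (fun a => some (ω a + 3)))) ++ [2]

/-- Started with register contents `s` and work memory `W`, the program `P` prints the elements of
the bag `B` one after the other, every element as often as it occurs in `B`, and halts with work
memory `W'`. Between the completion of two consecutive outputs (for the first output: since the
start) it makes at most `c * (|ν| + 1)` steps, where `ν` is the later one of the two outputs, and
it halts at most `c` steps after the last output. -/
def EnumeratesWithOutputLinearDelay (ρ : R ≃ Fin (Fintype.card R)) (ω : Ω ↪ ℕ) (I : ℕ → ℕ) (c : ℕ)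
    (P : Cmd) (s W : ℕ → ℕ) (B : Multiset (Asg R Ω)) (W' : ℕ → ℕ) : Prop :=
  ∃ (vs : List (Asg R Ω)) (t : ℕ → ℕ) (T : ℕ), (vs : Multiset (Asg R Ω)) = B ∧
    t 0 = 0 ∧
    (∀ (i : ℕ) (h : i < vs.length),
      t i ≤ t (i + 1) ∧ t (i + 1) ≤ t i + c * ((vs[i]).size + 1) ∧
      (runFor I P s W (t (i + 1))).out = (vs.take (i + 1)).flatMap (printed ρ ω)) ∧
    t vs.length ≤ T ∧ T ≤ t vs.length + c ∧
    (runFor I P s W T).code = [] ∧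
    (runFor I P s W T).out = vs.flatMap (printed ρ ω) ∧
    (runFor I P s W T).mem = W'

end Representation

/-- The programs of an implementation of the data structure. They get their arguments in the
registers `0` and `1`, return their result in register `0`, may find arbitrary values in all other
registers, and keep all their data in the work memory. -/
structure Implementation where
  init : Cmd
  add : Cmd
  extend : Cmd
  union : Cmd
  enumerate : Cmd

end SST

/-! Every node record carries, besides its label and children, a *handle*: the address of a
persistent tree (`Tree`) together with a skeleton that is to be applied to the bag of this tree. The
ECSA records account for safety and output depth, the trees for the delay of the enumeration; the
invariant `Good` keeps the two in agreement.

A skeleton (`Skel`) is a copyless assignment without letters. Its values are lists without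
repetitions over the finite set of registers, so there are only finitely many skeletons, and their
composition is a finite table that can be written into the program text, independently of the
alphabet. Whether an assignment in the input memory is a skeleton can be decided in constant time,
because in a copyless assignment a string with more than |R| symbols must contain a letter
(`strShape_of_long`, `eval_classify`).

A tree is an item together with a list. The item is a valuation, or the bag of a child tree composed
with an assignment that has a letter. Extending by a skeleton changes only the skeleton of the
handle; extending by an assignment with letters makes a one-item tree over the old one; a union
copies the item of the first tree into one new record, which points to the second tree and to the
list of the first (`Tree.Represents.union`). Hence every operation allocates boundedly many records.
Apart from the free pointer in cell `0` no allocated cell is ever overwritten, which yields full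
persistence.

The enumeration is a depth-first traversal. A descent through child pointers passes a letter on
every level but the deepest, and as no value is lost in a composition all these letters occur in the
output (`Asg.Fits.size_comp`); so the path to an output ν has length at most |ν| + 1
(`Level.length_le`). Nonempty lists met on the way are put on a stack, and removing the top entry
leads in constant time to a nonempty tree (`eval_popCmd`). The output is printed by expanding
registers along the path. By copylessness no string of the path is expanded twice, which makes
printing linear (`Level.sum_work_le`).

For safety, a relabel on top of a relabel is fused with it (`relabelCmd_spec`). A safe argument of a
union is a safe output-node or is split into a safe output-node o and a rest r, a relabel being
distributed over the two parts (`splitCmd_spec`). If both arguments split, the result is o₁ ∪ (o₂ ∪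
(r₁ ∪ r₂)) (`combine_spec`). Output depth follows left children only, so both outer unions have
depth at most 2, while r₁ ∪ r₂ may reach depth 4. -/

namespace SST

/-! ### Program logic for the machine -/

/-- The machine state without the code. -/
structure St where
  reg : ℕ → ℕ
  mem : ℕ → ℕ
  out : List ℕ

namespace Cmd

/-- The denotation of a program; only meaningful for loop-free programs. -/
def eval (I : ℕ → ℕ) : Cmd → St → St
  | .skip, C => C
  | .const r k, C => { C with reg := Function.update C.reg r k }
  | .move r s, C => { C with reg := Function.update C.reg r (C.reg s) }
  | .add r s t, C => { C with reg := Function.update C.reg r (C.reg s + C.reg t) }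
  | .sub r s t, C => { C with reg := Function.update C.reg r (C.reg s - C.reg t) }
  | .load r s, C => { C with reg := Function.update C.reg r (C.mem (C.reg s)) }
  | .store r s, C => { C with mem := Function.update C.mem (C.reg r) (C.reg s) }
  | .input r s, C => { C with reg := Function.update C.reg r (I (C.reg s)) }
  | .emit r, C => { C with out := C.out ++ [C.reg r] }
  | .seq a b, C => b.eval I (a.eval I C)
  | .ite r a b, C => if C.reg r ≠ 0 then a.eval I C else b.eval I C
  | .loop _ _, C => C

/-- The program has no loops. -/
def LoopFree : Cmd → Prop
  | .seq a b => a.LoopFree ∧ b.LoopFree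
  | .ite _ a b => a.LoopFree ∧ b.LoopFree
  | .loop _ _ => False
  | _ => True

/-- A bound for the number of steps of a loop-free program. -/
def cost : Cmd → ℕ
  | .seq a b => a.cost + b.cost + 1
  | .ite _ a b => a.cost + b.cost + 1
  | _ => 1

/-- Sequential composition of a list of programs. -/
def blk : List Cmd → Cmd
  | [] => .skip
  | a :: l => .seq a (blk l)

variable {I : ℕ → ℕ}

@[simp] theorem eval_skip (C : St) : eval I .skip C = C := rfl
@[simp] theorem eval_const (r k : ℕ) (C : St) :
    eval I (.const r k) C = ⟨Function.update C.reg r k, C.mem, C.out⟩ := rfl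
@[simp] theorem eval_move (r s : ℕ) (C : St) :
    eval I (.move r s) C = ⟨Function.update C.reg r (C.reg s), C.mem, C.out⟩ := rfl
@[simp] theorem eval_add (r s t : ℕ) (C : St) :
    eval I (.add r s t) C = ⟨Function.update C.reg r (C.reg s + C.reg t), C.mem, C.out⟩ := rfl
@[simp] theorem eval_sub (r s t : ℕ) (C : St) :
    eval I (.sub r s t) C = ⟨Function.update C.reg r (C.reg s - C.reg t), C.mem, C.out⟩ := rfl
@[simp] theorem eval_load (r s : ℕ) (C : St) :
    eval I (.load r s) C = ⟨Function.update C.reg r (C.mem (C.reg s)), C.mem, C.out⟩ := rfl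
@[simp] theorem eval_store (r s : ℕ) (C : St) :
    eval I (.store r s) C = ⟨C.reg, Function.update C.mem (C.reg r) (C.reg s), C.out⟩ := rfl
@[simp] theorem eval_input (r s : ℕ) (C : St) :
    eval I (.input r s) C = ⟨Function.update C.reg r (I (C.reg s)), C.mem, C.out⟩ := rfl
@[simp] theorem eval_emit (r : ℕ) (C : St) :
    eval I (.emit r) C = ⟨C.reg, C.mem, C.out ++ [C.reg r]⟩ := rfl
@[simp] theorem eval_seq (a b : Cmd) (C : St) :
    eval I (.seq a b) C = eval I b (eval I a C) := rfl
theorem eval_ite (r : ℕ) (a b : Cmd) (C : St) :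
    eval I (.ite r a b) C = if C.reg r ≠ 0 then eval I a C else eval I b C := rfl
theorem eval_ite_pos {r : ℕ} {a b : Cmd} {C : St} (h : C.reg r ≠ 0) :
    eval I (.ite r a b) C = eval I a C := if_pos h
theorem eval_ite_neg {r : ℕ} {a b : Cmd} {C : St} (h : C.reg r = 0) :
    eval I (.ite r a b) C = eval I b C := if_neg (by simpa using h)
@[simp] theorem eval_blk_nil (C : St) : eval I (blk []) C = C := rfl
@[simp] theorem eval_blk_cons (a : Cmd) (l : List Cmd) (C : St) :
    eval I (blk (a :: l)) C = eval I (blk l) (eval I a C) := rfl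

theorem loopFree_blk {l : List Cmd} : (blk l).LoopFree ↔ ∀ a ∈ l, a.LoopFree := by
  induction l with
  | nil => simp [blk, LoopFree]
  | cons a l ih => simp [blk, LoopFree, ih]

/-- From the state `C`, the program `P` reaches the state `C'` in at most `t` steps. -/
def Runs (I : ℕ → ℕ) (P : Cmd) (C : St) (t : ℕ) (C' : St) : Prop :=
  ∃ t' ≤ t, ∀ K, (step I)^[t'] ⟨P :: K, C.reg, C.mem, C.out⟩ = ⟨K, C'.reg, C'.mem, C'.out⟩

theorem Runs.mono {P : Cmd} {C C' : St} {t t' : ℕ} (h : Runs I P C t C') (ht : t ≤ t') :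
    Runs I P C t' C' := by
  obtain ⟨a, ha, h⟩ := h
  exact ⟨a, ha.trans ht, h⟩

/-- Runs can be chained because `Runs` quantifies over the commands `K` waiting behind the program.
The additional step is the one that unfolds `seq`. -/
theorem Runs.seq {a b : Cmd} {C C₁ C₂ : St} {t₁ t₂ : ℕ} (h₁ : Runs I a C t₁ C₁)
    (h₂ : Runs I b C₁ t₂ C₂) : Runs I (.seq a b) C (t₁ + t₂ + 1) C₂ := by
  obtain ⟨u, hu, h₁⟩ := h₁
  obtain ⟨v, hv, h₂⟩ := h₂
  refine ⟨v + u + 1, by omega, fun K => ?_⟩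
  rw [Function.iterate_succ_apply, Function.iterate_add_apply]
  show (step I)^[v] ((step I)^[u] ⟨a :: b :: K, C.reg, C.mem, C.out⟩) = _
  rw [h₁, h₂]

theorem Runs.ite_pos {r : ℕ} {a b : Cmd} {C C' : St} {t : ℕ} (hr : C.reg r ≠ 0)
    (h : Runs I a C t C') : Runs I (.ite r a b) C (t + 1) C' := by
  obtain ⟨u, hu, h⟩ := h
  refine ⟨u + 1, by omega, fun K => ?_⟩
  rw [Function.iterate_succ_apply, ← h K]
  simp [step, hr]

theorem Runs.ite_neg {r : ℕ} {a b : Cmd} {C C' : St} {t : ℕ} (hr : C.reg r = 0)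
    (h : Runs I b C t C') : Runs I (.ite r a b) C (t + 1) C' := by
  obtain ⟨u, hu, h⟩ := h
  refine ⟨u + 1, by omega, fun K => ?_⟩
  rw [Function.iterate_succ_apply, ← h K]
  simp [step, hr]

theorem Runs.loop_done {r : ℕ} {a : Cmd} {C : St} (hr : C.reg r = 0) :
    Runs I (.loop r a) C 1 C :=
  ⟨1, le_rfl, fun K => by simp [step, hr]⟩

theorem Runs.loop_step {r : ℕ} {a : Cmd} {C C₁ C₂ : St} {t₁ t₂ : ℕ} (hr : C.reg r ≠ 0)
    (h₁ : Runs I a C t₁ C₁) (h₂ : Runs I (.loop r a) C₁ t₂ C₂) :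
    Runs I (.loop r a) C (t₁ + t₂ + 1) C₂ := by
  obtain ⟨u, hu, h₁⟩ := h₁
  obtain ⟨v, hv, h₂⟩ := h₂
  refine ⟨v + u + 1, by omega, fun K => ?_⟩
  rw [Function.iterate_succ_apply, Function.iterate_add_apply]
  have : step I ⟨.loop r a :: K, C.reg, C.mem, C.out⟩ =
      ⟨a :: .loop r a :: K, C.reg, C.mem, C.out⟩ := by simp [step, hr]
  rw [this, h₁, h₂]

/-- Source of all constant time bounds: without loops the number of steps is bounded by the program
text alone, whatever the registers and the memory contain. -/
theorem Runs.of_loopFree {P : Cmd} (hP : P.LoopFree) (C : St) :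
    Runs I P C P.cost (P.eval I C) := by
  induction P generalizing C with
  | seq a b iha ihb => exact (iha hP.1 C).seq (ihb hP.2 _)
  | ite r a b iha ihb =>
    by_cases hr : C.reg r = 0
    · rw [eval_ite_neg hr]
      exact ((ihb hP.2 C).ite_neg hr).mono (by simp only [cost]; omega)
    · rw [eval_ite_pos hr]
      exact ((iha hP.1 C).ite_pos hr).mono (by simp only [cost]; omega)
  | loop => exact hP.elim
  | _ => exact ⟨1, le_rfl, fun K => rfl⟩

theorem Runs.eval_then {a b : Cmd} {C C₂ : St} {t : ℕ} (ha : a.LoopFree)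
    (h : Runs I b (a.eval I C) t C₂) : Runs I (.seq a b) C (a.cost + t + 1) C₂ :=
  (Runs.of_loopFree ha C).seq h

theorem Runs.haltsWithin {P : Cmd} {s W : ℕ → ℕ} {t c : ℕ} {C : St}
    (h : Runs I P ⟨s, W, []⟩ t C) (hc : t ≤ c) : HaltsWithin I c P s W (C.reg 0) C.mem := by
  obtain ⟨u, hu, h⟩ := h
  refine ⟨u, hu.trans hc, ?_⟩
  simp only [runFor]
  rw [h []]
  exact ⟨rfl, rfl, rfl⟩

theorem haltsWithin_of_loopFree {P : Cmd} (hP : P.LoopFree) {c : ℕ} (hc : P.cost ≤ c)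
    (s W : ℕ → ℕ) :
    HaltsWithin I c P s W ((P.eval I ⟨s, W, []⟩).reg 0) (P.eval I ⟨s, W, []⟩).mem :=
  (Runs.of_loopFree hP ⟨s, W, []⟩).haltsWithin hc

/-! ### Reading and allocating records -/

/-- The memory `W` with the list `l` written at address `f`. -/
def _root_.SST.writeAt (W : ℕ → ℕ) (f : ℕ) : List ℕ → ℕ → ℕ
  | [] => W
  | x :: l => writeAt (Function.update W f x) (f + 1) l

theorem _root_.SST.writeAt_of_lt {W : ℕ → ℕ} {f a : ℕ} {l : List ℕ} (h : a < f) :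
    writeAt W f l a = W a := by
  induction l generalizing W f with
  | nil => rfl
  | cons x l ih =>
    rw [writeAt, ih (by omega), Function.update_of_ne (by omega)]

theorem _root_.SST.writeAt_get {W : ℕ → ℕ} {f : ℕ} {l : List ℕ} {i x : ℕ} (h : l[i]? = some x) :
    writeAt W f l (f + i) = x := by
  induction l generalizing W f i with
  | nil => simp at h
  | cons y l ih =>
    cases i with
    | zero =>
      rw [writeAt, writeAt_of_lt (by omega)]
      simpa using h
    | succ i =>
      have := ih (W := Function.update W f y) (f := f + 1) (i := i) (by simpa using h)
      rw [writeAt, ← this]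
      congr 1
      omega

/-- Scratch registers: `10` holds the constant one, `11` addresses and indices; the register `12` is
the free pointer. -/
def allocAux : List ℕ → Cmd
  | [] => .skip
  | r :: l => blk [.store 12 r, .add 12 12 10, allocAux l]

/-- Store the given registers into a fresh record and advance the free pointer. -/
def alloc (l : List ℕ) : Cmd := .seq (.const 10 1) (allocAux l)

theorem loopFree_alloc (l : List ℕ) : (alloc l).LoopFree := by
  refine ⟨trivial, ?_⟩
  induction l with
  | nil => trivial
  | cons r l ih => exact ⟨trivial, trivial, ih, trivial⟩

-- Registers `10` and `12` are overwritten while the record is being written, so they must not be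
-- among the registers to be stored.
@[simp] theorem eval_alloc (l : List ℕ) (hl : 10 ∉ l) (hl' : 12 ∉ l) (C : St) :
    eval I (alloc l) C =
      ⟨Function.update (Function.update C.reg 10 1) 12 (C.reg 12 + l.length),
        writeAt C.mem (C.reg 12) (l.map C.reg), C.out⟩ := by
  have aux : ∀ (l : List ℕ) (C : St), 12 ∉ l → C.reg 10 = 1 → eval I (allocAux l) C =
      ⟨Function.update C.reg 12 (C.reg 12 + l.length),
        writeAt C.mem (C.reg 12) (l.map C.reg), C.out⟩ := by
    intro l
    induction l with
    | nil => intro C _ _; simp [allocAux, writeAt]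
    | cons r l ih =>
      intro C hl hC
      have hmap : ∀ v, List.map (Function.update C.reg 12 v) l = List.map C.reg l := by
        intro v
        refine List.map_congr_left fun x hx => Function.update_of_ne ?_ _ _
        rintro rfl
        exact hl (by simp [hx])
      simp only [allocAux, eval_blk_cons, eval_blk_nil, eval_store, eval_add]
      rw [ih _ (fun h => hl (by simp [h])) (by simp [hC])]
      simp only [hC, Function.update_self, Function.update_idem, List.map_cons, writeAt, hmap,
        List.length_cons]
      congr 2
      omega
  rw [alloc, eval_seq, eval_const, aux l _ hl' (by simp)]
  have hmap : List.map (Function.update C.reg 10 1) l = List.map C.reg l := by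
    refine List.map_congr_left fun x hx => Function.update_of_ne ?_ _ _
    rintro rfl
    exact hl hx
  simp [hmap]

/-- `reg r := mem (reg s + k)`. -/
def fetch (r s k : ℕ) : Cmd := blk [.const 11 k, .add 11 s 11, .load r 11]

theorem loopFree_fetch (r s k : ℕ) : (fetch r s k).LoopFree := by simp [fetch, blk, LoopFree]

@[simp] theorem eval_fetch (r s k : ℕ) (hs : s ≠ 11) (C : St) :
    eval I (fetch r s k) C = ⟨Function.update (Function.update C.reg 11 (C.reg s + k)) r
      (C.mem (C.reg s + k)), C.mem, C.out⟩ := by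
  simp [fetch, Function.update_of_ne hs]

/-! ### Case distinctions on the value of a register -/

/-- Run `f k` if register `r` holds `k < n`, and `d` otherwise; assumes `1` in register `10`. -/
def switch (r : ℕ) : ℕ → (ℕ → Cmd) → Cmd → Cmd
  | 0, _, d => d
  | n + 1, f, d => .ite r (.seq (.sub r r 10) (switch r n (fun k => f (k + 1)) d)) (f 0)

theorem loopFree_switch {r n : ℕ} {f : ℕ → Cmd} {d : Cmd} (hf : ∀ k, k < n → (f k).LoopFree)
    (hd : d.LoopFree) : (switch r n f d).LoopFree := by
  induction n generalizing f with
  | zero => exact hd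
  | succ n ih =>
    exact ⟨⟨trivial, ih fun k hk => hf (k + 1) (by omega)⟩, hf 0 (by omega)⟩

/-- The decrements leave the truncated difference in `r`. In the default branch this is the excess
over `n`; printing uses it to recover the number of a letter from its symbol code. -/
theorem eval_switch {r n : ℕ} {f : ℕ → Cmd} {d : Cmd} (hr : r ≠ 10) {C : St}
    (h : C.reg 10 = 1) : eval I (switch r n f d) C =
      eval I (if C.reg r < n then f (C.reg r) else d)
        ⟨Function.update C.reg r (C.reg r - n), C.mem, C.out⟩ := by
  induction n generalizing f C with
  | zero => simp [switch]
  | succ n ih =>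
    by_cases h0 : C.reg r = 0
    · rw [switch, eval_ite_neg h0]
      have : Function.update C.reg r 0 = C.reg := by rw [← h0, Function.update_eq_self]
      simp [h0, this]
    · rw [switch, eval_ite_pos h0, eval_seq, eval_sub, ih (by simp [Function.update_of_ne hr.symm, h])]
      obtain ⟨k, hk⟩ := Nat.exists_eq_succ_of_ne_zero h0
      simp [h, hk]

/-- `reg d := g (reg s)` for arguments below `n`, and `0` for the others. -/
def tabulate (n : ℕ) (g : ℕ → ℕ) (d s : ℕ) : Cmd :=
  blk [.const 10 1, .move 11 s, switch 11 n (fun k => .const d (g k)) (.const d 0), .const 11 0]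

theorem loopFree_tabulate (n : ℕ) (g : ℕ → ℕ) (d s : ℕ) : (tabulate n g d s).LoopFree := by
  refine ⟨trivial, trivial, loopFree_switch (fun _ _ => trivial) trivial, trivial, trivial⟩

-- Register `11`, the working copy of the argument, is cleared at the end, so that the resulting
-- state has the same form in all branches.
@[simp] theorem eval_tabulate {n : ℕ} {g : ℕ → ℕ} {d s : ℕ} (hd' : d ≠ 11)
    (hs : s ≠ 10) (C : St) : eval I (tabulate n g d s) C =
      ⟨Function.update (Function.update (Function.update C.reg 10 1) 11 0) d
        (if C.reg s < n then g (C.reg s) else 0), C.mem, C.out⟩ := by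
  simp only [tabulate, eval_blk_cons, eval_blk_nil, eval_const, eval_move]
  rw [eval_switch (by decide) (by simp)]
  simp only [Function.update_self, Function.update_of_ne hs]
  split_ifs with h <;>
  · simp only [eval_const, St.mk.injEq, and_true]
    rw [Function.update_comm hd', Function.update_idem, Function.update_idem]

/-- `reg d := g (reg s) (reg t)` for arguments below `n`, and `0` for the others. -/
def tabulate₂ (n : ℕ) (g : ℕ → ℕ → ℕ) (d s t : ℕ) : Cmd :=
  blk [.const 10 1, .move 11 s,
    switch 11 n (fun k => tabulate n (g k) d t) (.const d 0), .const 11 0]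

theorem loopFree_tabulate₂ (n : ℕ) (g : ℕ → ℕ → ℕ) (d s t : ℕ) :
    (tabulate₂ n g d s t).LoopFree :=
  ⟨trivial, trivial, loopFree_switch (fun _ _ => loopFree_tabulate _ _ _ _) trivial, trivial,
    trivial⟩

@[simp] theorem eval_tabulate₂ {n : ℕ} {g : ℕ → ℕ → ℕ} {d s t : ℕ} (hd' : d ≠ 11)
    (hs : s ≠ 10) (ht : t ≠ 10) (ht' : t ≠ 11) (C : St) : eval I (tabulate₂ n g d s t) C =
      ⟨Function.update (Function.update (Function.update C.reg 10 1) 11 0) d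
        (if C.reg s < n ∧ C.reg t < n then g (C.reg s) (C.reg t) else 0), C.mem, C.out⟩ := by
  simp only [tabulate₂, eval_blk_cons, eval_blk_nil, eval_const, eval_move]
  rw [eval_switch (by decide) (by simp)]
  simp only [Function.update_self, Function.update_of_ne hs]
  by_cases h : C.reg s < n
  · simp only [h, if_true, eval_tabulate hd' ht, Function.update_of_ne ht,
      Function.update_of_ne ht', true_and, Function.update_idem]
    simp only [St.mk.injEq, and_true]
    funext x
    simp only [Function.update_apply]
    split_ifs <;> first | rfl | omega
  · simp only [h, if_false, eval_const, false_and, St.mk.injEq, and_true]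
    rw [Function.update_comm hd', Function.update_idem, Function.update_idem]

end Cmd
end SST

namespace SST

/-! ### Algebra of assignments -/

namespace Asg

variable {R Ω : Type*}

theorem hat_append (σ : Asg R Ω) (u v : List (R ⊕ Ω)) :
    σ.hat (u ++ v) = (σ.hat u).bind fun a => (σ.hat v).map fun b => a ++ b := by
  induction u with
  | nil => simp [hat]
  | cons s u ih =>
    simp only [List.cons_append, hat, ih]
    cases σ.onSymbol s <;> cases σ.hat u <;> cases σ.hat v <;> simp

theorem hat_ne_none {σ : Asg R Ω} {w : List (R ⊕ Ω)} :
    σ.hat w ≠ none ↔ ∀ X, Sum.inl X ∈ w → σ X ≠ none := by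
  induction w with
  | nil => simp [hat]
  | cons s w ih =>
    have h1 : σ.hat (s :: w) ≠ none ↔ σ.onSymbol s ≠ none ∧ σ.hat w ≠ none := by
      simp only [hat]
      cases σ.onSymbol s <;> cases σ.hat w <;> simp
    rw [h1, ih]
    cases s with
    | inl Y =>
      simp only [onSymbol, List.mem_cons, Sum.inl.injEq]
      constructor
      · rintro ⟨h, h'⟩ X (rfl | hX)
        exacts [h, h' X hX]
      · exact fun h => ⟨h Y (.inl rfl), fun X hX => h X (.inr hX)⟩
    | inr a => simp [onSymbol]

/-- Both sides are partial morphisms for concatenation and agree on single symbols; `hat_append`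
does the rest. -/
theorem hat_comp (σ₁ σ₂ : Asg R Ω) (w : List (R ⊕ Ω)) :
    (σ₁.comp σ₂).hat w = (σ₂.hat w).bind σ₁.hat := by
  induction w with
  | nil => simp [hat]
  | cons s w ih =>
    simp only [hat, ih]
    cases s with
    | inl Y =>
      simp only [onSymbol, comp]
      cases σ₂ Y with
      | none => simp
      | some v =>
        cases σ₂.hat w with
        | none => cases σ₁.hat v <;> simp
        | some u => simp [hat_append]
    | inr a =>
      simp only [onSymbol]
      cases σ₂.hat w with
      | none => simp
      | some u => simp [hat, onSymbol]

theorem comp_assoc (σ₁ σ₂ σ₃ : Asg R Ω) : (σ₁.comp σ₂).comp σ₃ = σ₁.comp (σ₂.comp σ₃) := by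
  funext X
  simp only [comp]
  cases σ₃ X with
  | none => rfl
  | some w => simpa using hat_comp σ₁ σ₂ w

/-- Since `ν` is defined on every register used by `σ`, no value of `σ` becomes undefined. -/
theorem dom_comp {ν σ : Asg R Ω} (h : ν.dom = σ.reg) : (ν.comp σ).dom = σ.dom := by
  ext X
  simp only [dom, Set.mem_ofPred_eq, comp]
  cases hX : σ X with
  | none => simp
  | some w =>
    simp only [Option.bind_some, ne_eq, reduceCtorEq, not_false_eq_true, iff_true]
    refine hat_ne_none.2 fun Y hY => ?_
    have : Y ∈ ν.dom := h ▸ ⟨X, w, hX, hY⟩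
    exact this

/-- The symbols of `hat σ w` come from the strings of the symbols of `w`. -/
theorem hat_getElem? {σ : Asg R Ω} {w v : List (R ⊕ Ω)} (h : σ.hat w = some v) {i : ℕ} {X : R}
    (hi : v[i]? = some (Sum.inl X)) : ∃ (k : ℕ) (Z : R) (u pre : List (R ⊕ Ω)) (j : ℕ),
      w[k]? = some (Sum.inl Z) ∧ σ Z = some u ∧ u[j]? = some (Sum.inl X) ∧
      σ.hat (w.take k) = some pre ∧ i = pre.length + j := by
  induction w generalizing v i with
  | nil =>
    simp only [hat, Option.some.injEq] at h
    subst h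
    simp at hi
  | cons s w ih =>
    simp only [hat, Option.bind_eq_some_iff, Option.map_eq_some_iff] at h
    obtain ⟨a, ha, b, hb, rfl⟩ := h
    by_cases hia : i < a.length
    · rw [List.getElem?_append_left hia] at hi
      cases s with
      | inl Z => exact ⟨0, Z, a, [], i, rfl, ha, hi, rfl, by simp⟩
      | inr c =>
        simp only [onSymbol, Option.some.injEq] at ha
        subst ha
        cases i <;> simp at hi
    · rw [List.getElem?_append_right (by omega)] at hi
      obtain ⟨k, Z, u, pre, j, h1, h2, h3, h4, h5⟩ := ih hb hi
      refine ⟨k + 1, Z, u, a ++ pre, j, by simpa using h1, h2, h3, ?_, ?_⟩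
      · simp [hat, ha, h4]
      · simp only [List.length_append]
        omega

theorem hat_mem {σ : Asg R Ω} {w v : List (R ⊕ Ω)} (h : σ.hat w = some v) {X : R}
    (hX : Sum.inl X ∈ v) : ∃ Z u, Sum.inl Z ∈ w ∧ σ Z = some u ∧ Sum.inl X ∈ u := by
  obtain ⟨i, hi⟩ := List.mem_iff_getElem?.1 hX
  obtain ⟨k, Z, u, _, j, h1, h2, h3, _⟩ := hat_getElem? h hi
  exact ⟨Z, u, List.mem_iff_getElem?.2 ⟨k, h1⟩, h2, List.mem_iff_getElem?.2 ⟨j, h3⟩⟩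

theorem mem_hat {σ : Asg R Ω} {w v u : List (R ⊕ Ω)} (h : σ.hat w = some v) {X Z : R}
    (hZ : Sum.inl Z ∈ w) (hu : σ Z = some u) (hX : Sum.inl X ∈ u) : Sum.inl X ∈ v := by
  induction w generalizing v with
  | nil => simp at hZ
  | cons s w ih =>
    simp only [hat, Option.bind_eq_some_iff, Option.map_eq_some_iff] at h
    obtain ⟨a, ha, b, hb, rfl⟩ := h
    rcases List.mem_cons.1 hZ with rfl | hZ
    · simp only [onSymbol] at ha
      obtain rfl : a = u := by simpa [ha] using hu
      exact List.mem_append_left _ hX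
    · exact List.mem_append_right _ (ih hb hZ)

/-- A register used by `σ₁` cannot get lost: it occurs in the value of some `Z`, and `Z` is used by
`σ₂` because the domain of `σ₁` contains nothing else. -/
theorem reg_comp {σ₁ σ₂ : Asg R Ω} (h : σ₁.dom = σ₂.reg) : (σ₁.comp σ₂).reg = σ₁.reg := by
  ext X
  constructor
  · rintro ⟨Y, w, hY, hX⟩
    simp only [comp, Option.bind_eq_some_iff] at hY
    obtain ⟨v, _, hw⟩ := hY
    obtain ⟨Z, u, _, hu, hXu⟩ := hat_mem hw hX
    exact ⟨Z, u, hu, hXu⟩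
  · rintro ⟨Z, u, hu, hX⟩
    have : Z ∈ σ₂.reg := h ▸ (by simp [dom, hu])
    obtain ⟨Y, v, hv, hZ⟩ := this
    have hd : σ₁.hat v ≠ none := hat_ne_none.2 fun Z' hZ' => by
      have : Z' ∈ σ₁.dom := h ▸ ⟨Y, v, hv, hZ'⟩
      exact this
    obtain ⟨w, hw⟩ := Option.ne_none_iff_exists'.1 hd
    exact ⟨Y, w, by simp [comp, hv, hw], mem_hat hw hZ hu hX⟩

/-- By `hat_getElem?` an occurrence in the composition is determined by an occurrence inside a
string of `σ₁` and by the place of that string's register in `σ₂`. Copylessness of `σ₁` fixes the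
former, that of `σ₂` the latter, and then the prefixes before the occurrence agree as well. -/
theorem Copyless.comp {σ₁ σ₂ : Asg R Ω} (h₁ : σ₁.Copyless) (h₂ : σ₂.Copyless) :
    (σ₁.comp σ₂).Copyless := by
  intro X Y Y' w w' i j hY hY' hi hj
  simp only [Asg.comp, Option.bind_eq_some_iff] at hY hY'
  obtain ⟨v, hv, hw⟩ := hY
  obtain ⟨v', hv', hw'⟩ := hY'
  obtain ⟨k, Z, u, pre, a, e1, e2, e3, e4, e5⟩ := hat_getElem? hw hi
  obtain ⟨k', Z', u', pre', a', e1', e2', e3', e4', e5'⟩ := hat_getElem? hw' hj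
  obtain ⟨rfl, rfl⟩ := h₁ X Z Z' u u' a a' e2 e2' e3 e3'
  obtain ⟨rfl, rfl⟩ := h₂ Z Y Y' v v' k k' hv hv' e1 e1'
  rw [hv] at hv'
  obtain rfl := Option.some.inj hv'
  rw [e4] at e4'
  obtain rfl := Option.some.inj e4'
  exact ⟨rfl, by omega⟩

theorem isValuation_iff {σ : Asg R Ω} : σ.IsValuation ↔ σ.reg = ∅ := by
  rw [Set.eq_empty_iff_forall_notMem]
  constructor
  · rintro h X ⟨Y, w, hY, hX⟩
    obtain ⟨a, ha⟩ := h Y w hY _ hX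
    simp at ha
  · rintro h Y w hY (X | a) hs
    · exact (h X ⟨Y, w, hY, hs⟩).elim
    · exact ⟨a, rfl⟩

theorem IsValuation.copyless {σ : Asg R Ω} (h : σ.IsValuation) : σ.Copyless := by
  intro X Y _ w _ i _ hY _ hi _
  obtain ⟨a, ha⟩ := h Y w hY _ (List.mem_iff_getElem?.2 ⟨i, hi⟩)
  simp at ha

theorem IsRelabel.comp {σ₁ σ₂ : Asg R Ω} (h₁ : σ₁.IsRelabel) (h₂ : σ₂.IsRelabel) :
    (σ₁.comp σ₂).IsRelabel := by
  intro X w hw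
  simp only [Asg.comp, Option.bind_eq_some_iff] at hw
  obtain ⟨v, hv, hw⟩ := hw
  obtain ⟨Y, rfl⟩ := h₂ X v hv
  simp only [hat, onSymbol, Option.bind_eq_some_iff, Option.map_eq_some_iff] at hw
  obtain ⟨u, hu, b, hb, rfl⟩ := hw
  obtain ⟨Z, rfl⟩ := h₁ Y u hu
  simp only [Option.some.injEq] at hb
  exact ⟨Z, by simp [← hb]⟩

/-- `ν` fits to `σ` if it is defined exactly on the registers used by `σ`. -/
def Fits (ν σ : Asg R Ω) : Prop := ν.dom = σ.reg

theorem Fits.dom_comp {ν σ : Asg R Ω} (h : Fits ν σ) : (ν.comp σ).dom = σ.dom := Asg.dom_comp h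

theorem Fits.dom_eq_reg {ν σ₁ σ₂ : Asg R Ω} (h₁ : Fits ν σ₁) (h₂ : Fits (ν.comp σ₁) σ₂) :
    σ₁.dom = σ₂.reg := by
  rw [← h₁.dom_comp]
  exact h₂

theorem Fits.comp {ν σ₁ σ₂ : Asg R Ω} (h₁ : Fits ν σ₁) (h₂ : Fits (ν.comp σ₁) σ₂) :
    Fits ν (σ₁.comp σ₂) := by
  rw [Fits, reg_comp (h₁.dom_eq_reg h₂)]
  exact h₁

/-- The string of a register (empty if undefined). -/
def str (σ : Asg R Ω) (X : R) : List (R ⊕ Ω) := (σ X).getD []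

theorem mem_str {σ : Asg R Ω} {X : R} {s : R ⊕ Ω} (h : s ∈ σ.str X) :
    ∃ w, σ X = some w ∧ s ∈ w := by
  unfold str at h
  cases hX : σ X with
  | none => simp [hX] at h
  | some w => exact ⟨w, rfl, by simpa [hX] using h⟩

/-- In a sum over all registers occurring in a copyless assignment every register is counted at most
once. -/
theorem Copyless.sum_regs [Fintype R] {σ : Asg R Ω} (h : σ.Copyless) (f : R → ℕ)
    (hf : ∀ X, X ∉ σ.reg → f X = 0) :
    ∑ X, ((σ.str X).map (Sum.elim f fun _ => 0)).sum = ∑ Y, f Y := by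
  classical
  let regs : List (R ⊕ Ω) → List R := List.filterMap Sum.getLeft?
  have hsum : ∀ w : List (R ⊕ Ω), (w.map (Sum.elim f fun _ => 0)).sum = ((regs w).map f).sum := by
    intro w
    induction w with
    | nil => rfl
    | cons s w ih =>
      simp only [regs] at ih
      cases s with
      | inl Y => simp [regs, ih]
      | inr a => simp [regs, ih, List.filterMap_cons]
  -- All register occurrences in all values, as one list; copylessness says exactly that it has no
  -- repetitions.
  let L : List R := (Finset.univ.toList : List R).flatMap fun X => regs (σ.str X)
  have hL : L.Nodup := by
    rw [List.nodup_flatMap]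
    constructor
    · intro X _
      rw [List.Nodup, List.pairwise_filterMap, List.pairwise_iff_getElem]
      rintro i j hi hj hij Y hY Y' hY' rfl
      unfold str at hi hj hY hY'
      cases hX : σ X with
      | none => simp [hX] at hi
      | some w =>
        simp only [hX, Option.getD_some, Sum.getLeft?_eq_some_iff] at hi hj hY hY'
        have := h Y X X w w i j hX hX (by rw [← hY]; simp) (by rw [← hY']; simp)
        omega
    · refine (Finset.nodup_toList _).imp_of_mem ?_
      intro X X' _ _ hne Y hY hY'
      simp only [regs, List.mem_filterMap, Sum.getLeft?_eq_some_iff] at hY hY'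
      obtain ⟨_, hY, rfl⟩ := hY
      obtain ⟨_, hY', rfl⟩ := hY'
      obtain ⟨w, hw, hYw⟩ := mem_str hY
      obtain ⟨w', hw', hYw'⟩ := mem_str hY'
      obtain ⟨i, hi⟩ := List.mem_iff_getElem?.1 hYw
      obtain ⟨j, hj⟩ := List.mem_iff_getElem?.1 hYw'
      exact hne (h Y X X' w w' i j hw hw' hi hj).1
  have hmem : ∀ Y ∈ σ.reg, Y ∈ L := by
    rintro Y ⟨X, w, hX, hY⟩
    simp only [L, List.mem_flatMap]
    refine ⟨X, by simp, ?_⟩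
    simp only [regs, List.mem_filterMap, Sum.getLeft?_eq_some_iff]
    exact ⟨_, by simpa [str, hX] using hY, rfl⟩
  calc ∑ X, ((σ.str X).map (Sum.elim f fun _ => 0)).sum
      = ((Finset.univ.toList : List R).map fun X => ((regs (σ.str X)).map f).sum).sum := by
        simp only [hsum]
        exact (Finset.sum_map_toList _ _).symm
    _ = (L.map f).sum := by
        simp only [L]
        induction (Finset.univ.toList : List R) with
        | nil => rfl
        | cons X l ih => simp [ih]
    _ = ∑ Y ∈ L.toFinset, f Y := (List.sum_toFinset f hL).symm
    _ = ∑ Y, f Y := Finset.sum_subset (Finset.subset_univ _) fun Y _ hY =>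
        hf Y fun hY' => hY (List.mem_toFinset.2 (hmem Y hY'))

/-- Cutting `f` down to the registers that occur changes nothing on the left and reduces the claim
to `sum_regs`. -/
theorem Copyless.sum_regs_le [Fintype R] {σ : Asg R Ω} (h : σ.Copyless) (f : R → ℕ) :
    ∑ X, ((σ.str X).map (Sum.elim f fun _ => 0)).sum ≤ ∑ Y, f Y := by
  classical
  let g : R → ℕ := fun X => if X ∈ σ.reg then f X else 0
  have : ∀ X, (σ.str X).map (Sum.elim f fun _ => 0) = (σ.str X).map (Sum.elim g fun _ => 0) := by
    intro X
    refine List.map_congr_left ?_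
    rintro (Y | a) hY
    · obtain ⟨w, hw, hY⟩ := mem_str hY
      have : Y ∈ σ.reg := ⟨X, w, hw, hY⟩
      simp [g, this]
    · rfl
  simp only [this]
  rw [h.sum_regs g (fun X hX => by simp [g, hX])]
  refine Finset.sum_le_sum fun X _ => ?_
  simp only [g]
  split_ifs <;> simp

/-- The number of letters of an assignment. -/
def letters [Fintype R] (σ : Asg R Ω) : ℕ :=
  ∑ X, ((σ.str X).map (Sum.elim (fun _ => 0) fun _ => 1)).sum

theorem length_hat {ν : Asg R Ω} {w v : List (R ⊕ Ω)} (h : ν.hat w = some v) :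
    v.length = (w.map (Sum.elim (fun Y => (ν.str Y).length) fun _ => 0)).sum +
      (w.map (Sum.elim (fun _ => 0) fun _ => 1)).sum := by
  induction w generalizing v with
  | nil =>
    simp only [hat, Option.some.injEq] at h
    simp [← h]
  | cons s w ih =>
    simp only [hat, Option.bind_eq_some_iff, Option.map_eq_some_iff] at h
    obtain ⟨a, ha, b, hb, rfl⟩ := h
    rw [List.length_append, ih hb]
    cases s with
    | inl Y =>
      simp only [onSymbol] at ha
      simp [str, ha]
      omega
    | inr c =>
      simp only [onSymbol, Option.some.injEq] at ha
      simp [← ha]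
      omega

/-- Nothing is lost and nothing is copied: every string of `ν` is inserted exactly once, so sizes
add up. This equality ties the running time to the size of the output. -/
theorem Fits.size_comp [Fintype R] {ν σ : Asg R Ω} (h : Fits ν σ) (hσ : σ.Copyless) :
    (ν.comp σ).size = σ.letters + ν.size := by
  have hν : ν.size = ∑ Y, (ν.str Y).length := rfl
  rw [hν, ← hσ.sum_regs (fun Y => (ν.str Y).length), letters, ← Finset.sum_add_distrib]
  · refine Finset.sum_congr rfl fun X _ => ?_
    cases hX : σ X with
    | none => simp [Asg.comp, str, hX]
    | some w =>
      have hd : ν.hat w ≠ none := hat_ne_none.2 fun Z hZ => by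
        have : Z ∈ ν.dom := h ▸ ⟨X, w, hX, hZ⟩
        exact this
      obtain ⟨v, hv⟩ := Option.ne_none_iff_exists'.1 hd
      simp only [Asg.comp, str, hX, hv, Option.bind_some, Option.getD_some]
      rw [length_hat hv]
      simp only [str]
      omega
  · intro X hX
    rw [← h] at hX
    simp only [dom, Set.mem_ofPred_eq, not_not] at hX
    simp [str, hX]

/-- The symbols are letters and registers, and by copylessness there are at most |R| of the latter
in all strings together. -/
theorem sum_length_le [Fintype R] {σ : Asg R Ω} (hσ : σ.Copyless) :
    ∑ X, (σ.str X).length ≤ Fintype.card R + σ.letters := by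
  have h1 := hσ.sum_regs_le fun _ => 1
  simp only [Finset.sum_const, Finset.card_univ, smul_eq_mul, mul_one] at h1
  have h2 : ∀ w : List (R ⊕ Ω), w.length = (w.map (Sum.elim (fun _ => 1) fun _ => 0)).sum +
      (w.map (Sum.elim (fun _ => 0) fun _ => 1)).sum := by
    intro w
    induction w with
    | nil => rfl
    | cons s w ih => cases s <;> simp [ih] <;> omega
  simp only [h2, Finset.sum_add_distrib]
  exact Nat.add_le_add_right h1 _

/-- Some letter occurs in the assignment. -/
def HasLetter (σ : Asg R Ω) : Prop := ∃ X w a, σ X = some w ∧ Sum.inr a ∈ w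

theorem HasLetter.letters_pos [Fintype R] {σ : Asg R Ω} (h : σ.HasLetter) : 1 ≤ σ.letters := by
  obtain ⟨X, w, a, hX, ha⟩ := h
  refine le_trans ?_ (Finset.single_le_sum (f := fun X =>
    ((σ.str X).map (Sum.elim (fun _ => 0) fun _ => 1)).sum) (fun _ _ => Nat.zero_le _)
    (Finset.mem_univ X))
  refine List.single_le_sum (by simp) _ ?_
  refine List.mem_map.2 ⟨Sum.inr a, ?_, rfl⟩
  simpa [str, hX] using ha

end Asg
end SST

namespace SST

/-! ### Skeletons: copyless assignments without letters -/

/-- A copyless assignment without letters, over an unspecified alphabet. There are only finitely many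
of them. -/
def Skel (R : Type*) : Type _ :=
  {τ : R → Option (List R) // ∀ (X Y Y' : R) (w w' : List R) (i j : ℕ), τ Y = some w →
    τ Y' = some w' → w[i]? = some X → w'[j]? = some X → Y = Y' ∧ i = j}

namespace Skel

variable {R Ω : Type*}

/-- The skeleton as an assignment. -/
def toAsg (Ω : Type*) (τ : Skel R) : Asg R Ω := fun X => (τ.1 X).map (List.map Sum.inl)

theorem toAsg_eq_some {τ : Skel R} {X : R} {w : List (R ⊕ Ω)} :
    τ.toAsg Ω X = some w ↔ ∃ l, τ.1 X = some l ∧ l.map Sum.inl = w := by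
  simp [toAsg]

theorem copyless (τ : Skel R) : (τ.toAsg Ω).Copyless := by
  intro X Y Y' w w' i j hY hY' hi hj
  obtain ⟨l, hl, rfl⟩ := toAsg_eq_some.1 hY
  obtain ⟨l', hl', rfl⟩ := toAsg_eq_some.1 hY'
  exact τ.2 X Y Y' l l' i j hl hl' (by simpa using hi) (by simpa using hj)

theorem reg_toAsg (τ : Skel R) : (τ.toAsg Ω).reg = {Y | ∃ X l, τ.1 X = some l ∧ Y ∈ l} := by
  ext Y
  constructor
  · rintro ⟨X, w, hX, hY⟩
    obtain ⟨l, hl, rfl⟩ := toAsg_eq_some.1 hX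
    exact ⟨X, l, hl, by simpa using hY⟩
  · rintro ⟨X, l, hl, hY⟩
    exact ⟨X, _, toAsg_eq_some.2 ⟨l, hl, rfl⟩, by simpa using hY⟩

theorem dom_toAsg (τ : Skel R) : (τ.toAsg Ω).dom = {X | τ.1 X ≠ none} := by
  ext X
  simp [Asg.dom, toAsg]

/-- The extension of a skeleton to strings. -/
def hat (τ : Skel R) : List R → Option (List R)
  | [] => some []
  | X :: u => (τ.1 X).bind fun v => (τ.hat u).map fun w => v ++ w

theorem hat_toAsg (τ : Skel R) (l : List R) :
    (τ.toAsg Ω).hat (l.map Sum.inl) = (τ.hat l).map (List.map Sum.inl) := by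
  induction l with
  | nil => rfl
  | cons X l ih =>
    simp only [List.map_cons, Asg.hat, ih, hat, Asg.onSymbol, toAsg]
    cases τ.1 X <;> cases τ.hat l <;> simp

/-- The composition of skeletons is computed without an alphabet and yields the composition of
assignments over every alphabet. Over `Empty` this transfers copylessness to `comp`. -/
theorem comp_aux (τ₁ τ₂ : Skel R) :
    (fun X => ((τ₂.1 X).bind τ₁.hat).map (List.map Sum.inl)) =
      (τ₁.toAsg Ω).comp (τ₂.toAsg Ω) := by
  funext X
  simp only [Asg.comp, toAsg]
  cases τ₂.1 X with
  | none => rfl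
  | some l => simp only [Option.bind_some, Option.map_some]; exact (hat_toAsg τ₁ l).symm

/-- Composition of skeletons. -/
def comp (τ₁ τ₂ : Skel R) : Skel R :=
  ⟨fun X => (τ₂.1 X).bind τ₁.hat, by
    intro X Y Y' w w' i j hY hY' hi hj
    have h := (τ₁.copyless (Ω := Empty)).comp (τ₂.copyless (Ω := Empty))
    rw [← comp_aux] at h
    exact h X Y Y' (w.map Sum.inl) (w'.map Sum.inl) i j (by simp [hY]) (by simp [hY'])
      (by simp [hi]) (by simp [hj])⟩

@[simp] theorem toAsg_comp (τ₁ τ₂ : Skel R) :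
    (τ₁.comp τ₂).toAsg Ω = (τ₁.toAsg Ω).comp (τ₂.toAsg Ω) := comp_aux τ₁ τ₂

open Classical in
/-- The identity on a set of registers. -/
noncomputable def idOn (S : Set R) : Skel R :=
  ⟨fun X => if X ∈ S then some [X] else none, by
    intro X Y Y' w w' i j hY hY' hi hj
    simp only [Option.ite_none_right_eq_some, Option.some.injEq] at hY hY'
    obtain ⟨_, rfl⟩ := hY
    obtain ⟨_, rfl⟩ := hY'
    rw [List.getElem?_singleton] at hi hj
    split_ifs at hi hj with h1 h2
    simp only [Option.some.injEq] at hi hj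
    exact ⟨hi.trans hj.symm, h1.trans h2.symm⟩⟩

theorem reg_idOn (S : Set R) : ((idOn S).toAsg Ω).reg = S := by
  rw [reg_toAsg]
  ext Y
  simp only [idOn, Option.ite_none_right_eq_some, Option.some.injEq, Set.mem_ofPred_eq]
  constructor
  · rintro ⟨X, l, ⟨hX, rfl⟩, hY⟩
    rw [List.mem_singleton] at hY
    exact hY ▸ hX
  · exact fun h => ⟨Y, [Y], ⟨h, rfl⟩, by simp⟩

/-- The identity on the domain is neutral; it serves as the skeleton wherever a reference must carry
one but nothing is to be applied. -/
theorem comp_idOn (ν : Asg R Ω) : ν.comp ((idOn ν.dom).toAsg Ω) = ν := by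
  funext X
  by_cases h : X ∈ ν.dom
  · simp only [Asg.comp, toAsg, idOn, if_pos h, Option.map_some, Option.bind_some, List.map_cons,
      List.map_nil, Asg.hat, Asg.onSymbol, List.append_nil, Option.map_some]
    cases ν X <;> rfl
  · have : ν X = none := by simpa [Asg.dom] using h
    simp [Asg.comp, toAsg, idOn, if_neg h, this]

theorem fits_idOn (ν : Asg R Ω) : ν.Fits ((idOn ν.dom).toAsg Ω) := (reg_idOn _).symm

/-- Every defined value is a single register. -/
def IsRelabel (τ : Skel R) : Prop := ∀ X l, τ.1 X = some l → ∃ Y, l = [Y]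

theorem isRelabel_toAsg {τ : Skel R} : (τ.toAsg Ω).IsRelabel ↔ τ.IsRelabel := by
  constructor
  · intro h X l hl
    obtain ⟨Y, hY⟩ := h X _ (toAsg_eq_some.2 ⟨l, hl, rfl⟩)
    obtain ⟨Z, rfl, _⟩ := List.map_eq_singleton_iff.1 hY
    exact ⟨Z, rfl⟩
  · intro h X w hw
    obtain ⟨l, hl, rfl⟩ := toAsg_eq_some.1 hw
    obtain ⟨Y, rfl⟩ := h X l hl
    exact ⟨Y, rfl⟩

theorem IsRelabel.comp {τ₁ τ₂ : Skel R} (h₁ : τ₁.IsRelabel) (h₂ : τ₂.IsRelabel) :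
    (τ₁.comp τ₂).IsRelabel := by
  rw [← isRelabel_toAsg (Ω := Empty), toAsg_comp]
  exact (isRelabel_toAsg.2 h₁).comp (isRelabel_toAsg.2 h₂)

theorem letters_toAsg [Fintype R] (τ : Skel R) : (τ.toAsg Ω).letters = 0 := by
  refine Finset.sum_eq_zero fun X _ => ?_
  simp only [Asg.str, toAsg]
  cases τ.1 X with
  | none => rfl
  | some l => simp [Function.comp_def]

theorem nodup {τ : Skel R} {X : R} {l : List R} (h : τ.1 X = some l) : l.Nodup := by
  rw [List.Nodup, List.pairwise_iff_getElem]
  intro i j hi hj hij he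
  have := (τ.2 l[i] X X l l i j h h (by simp) (by simp [he])).2
  omega

/-- Copylessness makes every value a list without repetitions, and there are finitely many such
lists. This finiteness allows composition tables inside the programs. -/
instance [Finite R] : Finite (Skel R) := by
  classical
  have := Fintype.ofFinite R
  let f : Skel R → R → Option {l : List R // l.Nodup} := fun τ X =>
    match h : τ.1 X with
    | none => none
    | some l => some ⟨l, nodup h⟩
  have hf : ∀ τ X, (f τ X).map Subtype.val = τ.1 X := by
    intro τ X
    simp only [f]
    split <;> simp_all
  refine Finite.of_injective f fun τ τ' h => Subtype.ext (funext fun X => ?_)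
  rw [← hf, ← hf, h]

instance : Inhabited (Skel R) := ⟨⟨fun _ => none, by intro _ _ _ _ _ _ _ h; simp at h⟩⟩

variable [Finite R]

variable (R) in
/-- The number of skeletons. -/
noncomputable def num : ℕ := Nat.card (Skel R)

/-- The code of a skeleton. -/
noncomputable def code (τ : Skel R) : ℕ := Finite.equivFin (Skel R) τ

theorem code_lt (τ : Skel R) : τ.code < num R := (Finite.equivFin (Skel R) τ).2

open Classical in
variable (R) in
/-- The skeleton with a given code. -/
noncomputable def dec (i : ℕ) : Skel R :=
  if h : i < num R then (Finite.equivFin (Skel R)).symm ⟨i, h⟩ else default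

@[simp] theorem dec_code (τ : Skel R) : dec R τ.code = τ := by
  rw [dec, dif_pos τ.code_lt]
  simp [code]

end Skel

open Cmd

/-! ### Operations on skeletons as table lookups on their codes -/

section Programs

variable (R : Type*) [Finite R]

/-- Composition of skeletons, on codes. -/
noncomputable def compCmd (d s t : ℕ) : Cmd :=
  tabulate₂ (Skel.num R) (fun i j => ((Skel.dec R i).comp (Skel.dec R j)).code) d s t

/-- The effect of `compCmd`. -/
noncomputable def compCode (i j : ℕ) : ℕ :=
  if i < Skel.num R ∧ j < Skel.num R then ((Skel.dec R i).comp (Skel.dec R j)).code else 0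

@[simp] theorem compCode_code (τ₁ τ₂ : Skel R) :
    compCode R τ₁.code τ₂.code = (τ₁.comp τ₂).code := by
  simp [compCode, Skel.code_lt]

theorem loopFree_compCmd (d s t : ℕ) : (compCmd R d s t).LoopFree := loopFree_tabulate₂ _ _ _ _ _

@[simp] theorem eval_compCmd {I : ℕ → ℕ} {d s t : ℕ} (hd' : d ≠ 11)
    (hs : s ≠ 10) (ht : t ≠ 10) (ht' : t ≠ 11) (C : St) : eval I (compCmd R d s t) C =
      ⟨Function.update (Function.update (Function.update C.reg 10 1) 11 0) d
        (compCode R (C.reg s) (C.reg t)), C.mem, C.out⟩ :=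
  eval_tabulate₂ hd' hs ht ht' C

/-- The identity on the domain of a skeleton, on codes. -/
noncomputable def domCmd (d s : ℕ) : Cmd :=
  tabulate (Skel.num R) (fun i => (Skel.idOn ((Skel.dec R i).toAsg Empty).dom).code) d s

/-- The effect of `domCmd`. -/
noncomputable def domCode (i : ℕ) : ℕ :=
  if i < Skel.num R then (Skel.idOn ((Skel.dec R i).toAsg Empty).dom).code else 0

-- The domain of a skeleton does not depend on the alphabet, so a table made with `Empty` serves all
-- alphabets.
@[simp] theorem domCode_code (τ : Skel R) (Ω : Type*) :
    domCode R τ.code = (Skel.idOn (τ.toAsg Ω).dom).code := by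
  simp [domCode, Skel.code_lt, Skel.dom_toAsg]

theorem loopFree_domCmd (d s : ℕ) : (domCmd R d s).LoopFree := loopFree_tabulate _ _ _ _

@[simp] theorem eval_domCmd {I : ℕ → ℕ} {d s : ℕ} (hd' : d ≠ 11)
    (hs : s ≠ 10) (C : St) : eval I (domCmd R d s) C =
      ⟨Function.update (Function.update (Function.update C.reg 10 1) 11 0) d
        (domCode R (C.reg s)), C.mem, C.out⟩ :=
  eval_tabulate hd' hs C

end Programs

/-- `C'` agrees with `C` except for the registers in `S`. -/
def SameOff (S : List ℕ) (C C' : St) : Prop :=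
  C'.mem = C.mem ∧ C'.out = C.out ∧ ∀ r, r ∉ S → C'.reg r = C.reg r

theorem SameOff.refl (S : List ℕ) (C : St) : SameOff S C C := ⟨rfl, rfl, fun _ _ => rfl⟩

theorem SameOff.trans {S : List ℕ} {C C' C'' : St} (h : SameOff S C C') (h' : SameOff S C' C'') :
    SameOff S C C'' :=
  ⟨h'.1.trans h.1, h'.2.1.trans h.2.1, fun r hr => (h'.2.2 r hr).trans (h.2.2 r hr)⟩

theorem SameOff.update {S : List ℕ} {C C' : St} (h : SameOff S C C') {r : ℕ} (hr : r ∈ S) (v : ℕ) :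
    SameOff S C ⟨Function.update C'.reg r v, C'.mem, C'.out⟩ :=
  ⟨h.1, h.2.1, fun x hx => by
    rw [← h.2.2 x hx]
    exact Function.update_of_ne (by rintro rfl; exact hx hr) _ _⟩

/-! ### Classification of assignments in the input memory -/

/-- The list of the symbols of a string that has no letters. -/
def strShape {R Ω : Type*} : List (R ⊕ Ω) → Option (List R)
  | [] => some []
  | Sum.inl X :: w => (strShape w).map fun l => X :: l
  | Sum.inr _ :: _ => none

theorem strShape_eq_some {R Ω : Type*} {w : List (R ⊕ Ω)} {l : List R} :
    strShape w = some l ↔ w = l.map Sum.inl := by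
  induction w generalizing l with
  | nil => cases l <;> simp [strShape]
  | cons s w ih =>
    cases s with
    | inl X =>
      cases l with
      | nil => simp [strShape]
      | cons Y l => simp [strShape, ih, and_comm]
    | inr a => cases l <;> simp [strShape]

theorem strShape_eq_none {R Ω : Type*} {w : List (R ⊕ Ω)} (h : strShape w = none) :
    ∃ a, Sum.inr a ∈ w := by
  induction w with
  | nil => simp [strShape] at h
  | cons s w ih =>
    cases s with
    | inl X =>
      simp only [strShape, Option.map_eq_none_iff] at h
      obtain ⟨a, ha⟩ := ih h
      exact ⟨a, by simp [ha]⟩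
    | inr a => exact ⟨a, by simp⟩

section Classify

variable {R : Type*} [Fintype R] (ρ : R ≃ Fin (Fintype.card R))

open Classical in
/-- Report what is known about an assignment: register `16` becomes `0` for a relabel, `1` for other
skeletons and `2` for assignments with letters, register `17` gets the code of the skeleton, and
register `18` the code of the identity on the domain. -/
noncomputable def report (info : R → Option (Option (List R))) : Cmd :=
  blk [.const 18 (Skel.idOn {X | info X ≠ none}).code,
    if h : ∃ τ : Skel R, info = fun X => (τ.1 X).map some then
      blk [.const 16 (if h.choose.IsRelabel then 0 else 1), .const 17 h.choose.code]
    else .const 16 2]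

theorem loopFree_report (info : R → Option (Option (List R))) : (report info).LoopFree := by
  by_cases h : ∃ τ : Skel R, info = fun X => (τ.1 X).map some
  · rw [report, dif_pos h]
    exact ⟨trivial, ⟨trivial, trivial, trivial⟩, trivial⟩
  · rw [report, dif_neg h]
    exact ⟨trivial, trivial, trivial⟩

/-- Read the remaining `k` symbols of a string and continue according to its shape. -/
def readString : ℕ → List R → (Option (List R) → Cmd) → Cmd
  | 0, l, cont => cont (some l)
  | k + 1, l, cont => blk [.const 10 1, .add 13 13 10, .input 15 13,
      switch 15 (Fintype.card R)
        (fun j => if h : j < Fintype.card R then readString k (l ++ [ρ.symm ⟨j, h⟩]) cont else .skip)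
        (cont none)]

theorem loopFree_readString {k : ℕ} {l : List R} {cont : Option (List R) → Cmd}
    (h : ∀ o, (cont o).LoopFree) : (readString ρ k l cont).LoopFree := by
  induction k generalizing l with
  | zero => exact h _
  | succ k ih =>
    refine ⟨trivial, trivial, trivial, loopFree_switch (fun j hj => ?_) (h _), trivial⟩
    simp only [hj, dite_true]
    exact ih

open Classical in
/-- Read the table entries of the given registers of the assignment at the address in register
`1`. -/
noncomputable def readTable : List R → (R → Option (Option (List R))) → Cmd
  | [], info => report info
  | X :: Xs, info => blk [.const 11 (ρ X), .add 11 1 11, .input 13 11,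
      .ite 13
        (blk [.input 14 13, .const 10 1, switch 14 (Fintype.card R + 1)
          (fun k => readString ρ k [] fun o => readTable Xs (Function.update info X (some o)))
          (readTable Xs (Function.update info X (some none)))])
        (readTable Xs (Function.update info X none))]

theorem loopFree_readTable {Xs : List R} {info : R → Option (Option (List R))} :
    (readTable ρ Xs info).LoopFree := by
  induction Xs generalizing info with
  | nil => exact loopFree_report _
  | cons X Xs ih =>
    refine ⟨trivial, trivial, trivial, ⟨⟨trivial, trivial, ?_, trivial⟩, ih⟩, trivial⟩
    exact loopFree_switch (fun k _ => loopFree_readString ρ fun _ => ih) ih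

/-- Classify the assignment at the address in register `1`. -/
noncomputable def classify : Cmd := readTable ρ Finset.univ.toList fun _ => none

theorem loopFree_classify : (classify ρ).LoopFree := loopFree_readTable ρ

variable {ρ} {Ω : Type*} {ω : Ω ↪ ℕ} {I : ℕ → ℕ}

/-- The registers used for reading an assignment. -/
abbrev readRegs : List ℕ := [10, 11, 13, 14, 15]

/-- Register `13` holds the address just before the next symbol, at the beginning that of the length
cell. The symbols already read are held in `l`, that is, in the place reached in the program text.
Reading stops at the first letter. -/
theorem eval_readString {u : List (R ⊕ Ω)} {l : List R} {cont : Option (List R) → Cmd} {C : St}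
    (hu : ∀ (i : ℕ) (h : i < u.length), I (C.reg 13 + 1 + i) = symbolCode ρ ω u[i]) :
    ∃ C', SameOff readRegs C C' ∧ eval I (readString ρ u.length l cont) C =
      eval I (cont ((strShape u).map fun v => l ++ v)) C' := by
  induction u generalizing l C with
  | nil => exact ⟨C, .refl _ _, by simp [readString, strShape]⟩
  | cons s u ih =>
    have h0 := hu 0 (by simp)
    simp only [List.getElem_cons_zero, add_zero] at h0
    simp only [List.length_cons, readString, eval_blk_cons, eval_blk_nil, eval_const, eval_add,
      eval_input]
    rw [eval_switch (by decide) (by simp)]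
    simp only [Function.update_self, ne_eq, Nat.reduceEqDiff,
      not_false_eq_true, Function.update_of_ne, h0]
    cases s with
    | inl X =>
      simp only [symbolCode, Fin.is_lt, if_true, dite_true, Fin.eta, Equiv.symm_apply_apply]
      have hih := fun i hi => hu (i + 1) (Nat.succ_lt_succ hi)
      obtain ⟨C', hC', he⟩ := ih (l := l ++ [X])
        (C := ⟨Function.update (Function.update (Function.update (Function.update C.reg 10 1) 13
          (C.reg 13 + 1)) 15 (ρ X)) 15 (ρ X - Fintype.card R), C.mem, C.out⟩) (fun i hi => by
          have := hih i hi
          simp only [List.getElem_cons_succ] at this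
          simp only [ne_eq, Nat.reduceEqDiff, not_false_eq_true,
            Function.update_of_ne, Function.update_self]
          rw [← this]
          congr 1
          omega)
      refine ⟨C', ?_, he.trans ?_⟩
      · exact ((((SameOff.refl readRegs C).update (r := 10) (by simp) _).update (r := 13)
            (by simp) _).update (r := 15) (by simp) _).update (r := 15) (by simp) _ |>.trans hC'
      · congr 2
        simp [strShape, Function.comp_def]
    | inr a =>
      simp only [symbolCode, add_lt_iff_neg_left, not_lt_zero, if_false, strShape, Option.map_none]
      exact ⟨_, ((((SameOff.refl readRegs C).update (r := 10) (by simp) _).update (r := 13)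
            (by simp) _).update (r := 15) (by simp) _).update (r := 15) (by simp) _, rfl⟩

/-- What the classification finds out about an assignment. -/
def shape (σ : Asg R Ω) (X : R) : Option (Option (List R)) := (σ X).map strShape

/-- Without letters a copyless string is free of repetitions and has at most |R| symbols. So the
reader may give up on longer strings, which keeps the classification in constant time. -/
theorem strShape_of_long {σ : Asg R Ω} (hσ : σ.Copyless) {X : R} {w : List (R ⊕ Ω)}
    (hw : σ X = some w) (hl : ¬ w.length < Fintype.card R + 1) : strShape w = none := by
  by_contra h
  obtain ⟨l, hl'⟩ := Option.ne_none_iff_exists'.1 h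
  obtain rfl := strShape_eq_some.1 hl'
  have hn : l.Nodup := by
    rw [List.Nodup, List.pairwise_iff_getElem]
    intro i j hi hj hij he
    have := (hσ l[i] X X _ _ i j hw hw (by simp) (by simp [he])).2
    omega
  have := hn.length_le_card
  simp at hl
  omega

-- What has been found out is stored in no register: the program branches over all possible shapes,
-- and each branch ends in its own `report` with the finding `info` hard-wired.
open Classical in
theorem eval_readTable {σ : Asg R Ω} (hσ : σ.Copyless) {Xs : List R}
    {info : R → Option (Option (List R))} {C : St} (hp : HoldsAsg ρ ω I (C.reg 1) σ) :
    ∃ C', SameOff readRegs C C' ∧ eval I (readTable ρ Xs info) C =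
      eval I (report fun X => if X ∈ Xs then shape σ X else info X) C' := by
  induction Xs generalizing info C with
  | nil => exact ⟨C, .refl _ _, by simp [readTable]⟩
  | cons X Xs ih =>
    have hX := hp X
    -- The recursive call for the remaining entries, common to all outcomes of reading the entry of
    -- `X`.
    have hfin : ∀ (o : Option (Option (List R))), o = shape σ X → ∀ C₁, SameOff readRegs C C₁ →
        ∃ C', SameOff readRegs C C' ∧ eval I (readTable ρ Xs (Function.update info X o)) C₁ =
          eval I (report fun Y => if Y ∈ X :: Xs then shape σ Y else info Y) C' := by
      rintro o rfl C₁ h₁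
      have h1 : C₁.reg 1 = C.reg 1 := h₁.2.2 1 (by simp)
      obtain ⟨C', hC', he⟩ := ih (info := Function.update info X (shape σ X)) (C := C₁) (h1 ▸ hp)
      refine ⟨C', h₁.trans hC', he.trans ?_⟩
      congr 2
      funext Y
      by_cases hY : Y = X
      · subst hY; simp
      · simp [hY]
    have hs : SameOff readRegs C ⟨Function.update (Function.update (Function.update C.reg 11 (ρ X))
        11 (C.reg 1 + ρ X)) 13 (I (C.reg 1 + ρ X)), C.mem, C.out⟩ :=
      (((SameOff.refl readRegs C).update (r := 11) (by simp) _).update (r := 11)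
            (by simp) _).update (r := 13) (by simp) _
    simp only [readTable, eval_blk_cons, eval_blk_nil, eval_const, eval_add, eval_input,
      Function.update_self, ne_eq, OfNat.one_ne_ofNat, not_false_eq_true, Function.update_of_ne]
    cases hσX : σ X with
    | none =>
      rw [hσX] at hX
      rw [eval_ite_neg (by simpa using hX)]
      exact hfin _ (by simp [shape, hσX]) _ hs
    | some w =>
      rw [hσX] at hX
      obtain ⟨h0, hl, hw⟩ := hX
      rw [eval_ite_pos (by simpa using h0)]
      simp only [eval_blk_cons, eval_blk_nil, eval_const, eval_input]
      rw [eval_switch (by decide) (by simp)]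
      simp only [Function.update_self, ne_eq, Nat.reduceEqDiff,
        not_false_eq_true, Function.update_of_ne, hl]
      have hs' := (((hs.update (r := 14) (by simp) w.length).update (r := 10) (by simp) 1).update
        (r := 14) (by simp) (w.length - (Fintype.card R + 1)))
      split_ifs with hlen
      · obtain ⟨C₁, hC₁, he⟩ := eval_readString (ρ := ρ) (ω := ω) (I := I) (u := w) (l := [])
          (cont := fun o => readTable ρ Xs (Function.update info X (some o)))
          (C := ⟨Function.update (Function.update (Function.update (Function.update
            (Function.update (Function.update C.reg 11 (ρ X)) 11 (C.reg 1 + ρ X)) 13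
            (I (C.reg 1 + ρ X))) 14 w.length) 10 1) 14 (w.length - (Fintype.card R + 1)),
            C.mem, C.out⟩) (fun i hi => by simpa using hw i hi)
        obtain ⟨C', hC', he'⟩ := hfin (some (strShape w)) (by simp [shape, hσX]) C₁
          (hs'.trans hC₁)
        refine ⟨C', hC', he.trans ?_⟩
        rw [← he']
        simp
      · exact hfin _ (by simp [shape, hσX, strShape_of_long hσ hσX hlen]) _ hs'

/-- The result of the classification. -/
theorem eval_classify {σ : Asg R Ω} (hσ : σ.Copyless) {C : St} (hp : HoldsAsg ρ ω I (C.reg 1) σ) :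
    SameOff [10, 11, 13, 14, 15, 16, 17, 18] C (eval I (classify ρ) C) ∧
    (eval I (classify ρ) C).reg 18 = (Skel.idOn σ.dom).code ∧
    (((eval I (classify ρ) C).reg 16 = 0 ∧ ∃ τ : Skel R, σ = τ.toAsg Ω ∧ τ.IsRelabel ∧
        (eval I (classify ρ) C).reg 17 = τ.code) ∨
      ((eval I (classify ρ) C).reg 16 = 1 ∧ ∃ τ : Skel R, σ = τ.toAsg Ω ∧ ¬ τ.IsRelabel ∧
        (eval I (classify ρ) C).reg 17 = τ.code) ∨
      ((eval I (classify ρ) C).reg 16 = 2 ∧ σ.HasLetter)) := by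
  classical
  obtain ⟨C', hC', he⟩ := eval_readTable hσ (Xs := Finset.univ.toList) (info := fun _ => none) hp
  rw [classify, he]
  have hi : (fun X => if X ∈ (Finset.univ.toList : List R) then shape σ X else none) =
      shape σ := by simp
  simp only [hi]
  have hC : SameOff [10, 11, 13, 14, 15, 16, 17, 18] C C' :=
    ⟨hC'.1, hC'.2.1, fun r hr => hC'.2.2 r fun h => hr (by simp at h ⊢; tauto)⟩
  have hdom : {X | shape σ X ≠ none} = σ.dom := by
    ext X
    simp [shape, Asg.dom]
  by_cases h : ∃ τ : Skel R, shape σ = fun X => (τ.1 X).map some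
  · have hτ := h.choose_spec
    have hσ : σ = h.choose.toAsg Ω := by
      funext X
      have := congrFun hτ X
      cases hX : σ X with
      | none =>
        simp only [shape, hX, Option.map_none] at this
        simp [Skel.toAsg, Option.map_eq_none_iff.1 this.symm]
      | some w =>
        simp only [shape, hX, Option.map_some] at this
        obtain ⟨l, hl, hl'⟩ := Option.map_eq_some_iff.1 this.symm
        simp [Skel.toAsg, hl, strShape_eq_some.1 hl'.symm]
    rw [report, dif_pos h, hdom]
    simp only [eval_blk_cons, eval_blk_nil, eval_const]
    refine ⟨((hC.update (by simp) _).update (by simp) _).update (by simp) _, by simp, ?_⟩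
    by_cases hr : h.choose.IsRelabel
    · exact .inl ⟨by simp [hr], _, hσ, hr, by simp⟩
    · exact .inr (.inl ⟨by simp [hr], _, hσ, hr, by simp⟩)
  · rw [report, dif_neg h, hdom]
    simp only [eval_blk_cons, eval_blk_nil, eval_const]
    refine ⟨(hC.update (by simp) _).update (by simp) _, by simp, .inr (.inr ⟨by simp, ?_⟩)⟩
    -- Without any letter all shapes would be defined and would form a skeleton, against the
    -- assumption of this branch.
    by_contra hn
    refine h ⟨⟨fun X => (σ X).bind strShape, ?_⟩, ?_⟩
    · intro X Y Y' w w' i j hY hY' hi hj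
      obtain ⟨v, hv, hvw⟩ := Option.bind_eq_some_iff.1 hY
      obtain ⟨v', hv', hvw'⟩ := Option.bind_eq_some_iff.1 hY'
      obtain rfl := strShape_eq_some.1 hvw
      obtain rfl := strShape_eq_some.1 hvw'
      exact hσ X Y Y' _ _ i j hv hv' (by simp [hi]) (by simp [hj])
    · funext X
      cases hX : σ X with
      | none => simp [shape, hX]
      | some w =>
        cases hs : strShape w with
        | none =>
          obtain ⟨a, ha⟩ := strShape_eq_none hs
          exact (hn ⟨X, w, a, hX, ha⟩).elim
        | some l => simp [shape, hX, hs]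

end Classify

/-! ### The static part of the work memory -/

section Static

variable {R : Type*} [Fintype R] (ρ : R ≃ Fin (Fintype.card R))

variable (R) in
/-- The address of the table of the relabel with code `i`. -/
def tableAddr (i : ℕ) : ℕ := 1 + 2 * Fintype.card R + i * Fintype.card R

variable (R) in
/-- The end of the static part of the memory. -/
noncomputable def staticEnd : ℕ := tableAddr R (Skel.num R)

/-- The static part of the memory: the strings of length one consisting of a register, and the
tables of all relabels. -/
noncomputable def staticMem (a : ℕ) : ℕ :=
  if a = 0 then staticEnd R
  else if a < 1 + 2 * Fintype.card R then (if (a - 1) % 2 = 0 then 1 else (a - 1) / 2)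
  else if h : (a - (1 + 2 * Fintype.card R)) % Fintype.card R < Fintype.card R then
    match (Skel.dec R ((a - (1 + 2 * Fintype.card R)) / Fintype.card R)).1 (ρ.symm ⟨_, h⟩) with
    | some [Y] => 1 + 2 * ρ Y
    | _ => 0
  else 0

/-- Initialization of the memory. -/
noncomputable def initCmd : Cmd :=
  blk ((List.range (staticEnd R)).map fun a =>
    blk [.const 2 a, .const 3 (staticMem ρ a), .store 2 3])

theorem loopFree_initCmd : (initCmd ρ).LoopFree := by
  rw [initCmd, loopFree_blk]
  intro a ha
  obtain ⟨b, _, rfl⟩ := List.mem_map.1 ha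
  exact ⟨trivial, trivial, trivial, trivial⟩

theorem eval_initCmd {I : ℕ → ℕ} (C : St) {a : ℕ} (ha : a < staticEnd R) :
    (eval I (initCmd ρ) C).mem a = staticMem ρ a := by
  have : ∀ (l : List ℕ) (C : St),
      (eval I (blk (l.map fun a => blk [.const 2 a, .const 3 (staticMem ρ a), .store 2 3])) C).mem a
        = if a ∈ l then staticMem ρ a else C.mem a := by
    intro l
    induction l with
    | nil => simp
    | cons b l ih =>
      intro C
      rw [List.map_cons, eval_blk_cons, ih]
      simp only [eval_blk_cons, eval_const, eval_store, eval_blk_nil]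
      by_cases hb : a = b
      · subst hb; simp
      · simp [hb]
  rw [initCmd, this]
  simp [ha]

variable {ρ}

/-- The memory contains the static part (except for the free pointer in the cell `0`). -/
def StaticIn (ρ : R ≃ Fin (Fintype.card R)) (W : ℕ → ℕ) : Prop :=
  ∀ a, 0 < a → a < staticEnd R → W a = staticMem ρ a

/-- Composed relabels need not occur in the input memory. As there are finitely many, the
initialization writes the tables of all of them, and a fused relabel node refers to one of these
tables. -/
theorem StaticIn.holdsAsg {W : ℕ → ℕ} (h : StaticIn ρ W) {τ : Skel R} (hτ : τ.IsRelabel)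
    {Ω : Type*} (ω : Ω ↪ ℕ) : HoldsAsg ρ ω W (tableAddr R τ.code) (τ.toAsg Ω) := by
  -- The one-symbol string `Y` occupies two cells from `1 + 2 * ρ Y` on: its length and its symbol.
  have hstr : ∀ Y : R, W (1 + 2 * ρ Y) = 1 ∧ W (1 + 2 * ρ Y + 1) = ρ Y := by
    intro Y
    have hY := (ρ Y).2
    have hle : 1 + 2 * Fintype.card R ≤ staticEnd R := by simp [staticEnd, tableAddr]
    constructor
    · rw [h _ (by omega) (by omega), staticMem, if_neg (by omega), if_pos (by omega),
        if_pos (by omega)]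
    · rw [h _ (by omega) (by omega), staticMem, if_neg (by omega), if_pos (by omega),
        if_neg (by omega)]
      omega
  intro X
  have hX := (ρ X).2
  have hlt : tableAddr R τ.code + ρ X < staticEnd R := by
    have : (τ.code + 1) * Fintype.card R ≤ Skel.num R * Fintype.card R :=
      Nat.mul_le_mul_right _ τ.code_lt
    simp only [staticEnd, tableAddr]
    rw [Nat.add_mul] at this
    omega
  have hval : W (tableAddr R τ.code + ρ X) =
      match τ.1 X with
      | some [Y] => 1 + 2 * ρ Y
      | _ => 0 := by
    -- Relative to the start of the tables, quotient and remainder of the address modulo |R| give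
    -- back the code of the relabel and the number of the register.
    have e : tableAddr R τ.code + ρ X - (1 + 2 * Fintype.card R) =
        ρ X + Fintype.card R * τ.code := by
      simp only [tableAddr]
      rw [Nat.mul_comm τ.code]
      omega
    have e1 : (tableAddr R τ.code + ρ X - (1 + 2 * Fintype.card R)) % Fintype.card R = ρ X := by
      rw [e, Nat.add_mul_mod_self_left, Nat.mod_eq_of_lt hX]
    have e2 : (tableAddr R τ.code + ρ X - (1 + 2 * Fintype.card R)) / Fintype.card R = τ.code := by
      rw [e, Nat.add_mul_div_left _ _ (by omega), Nat.div_eq_of_lt hX, zero_add]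
    rw [h _ (by simp only [tableAddr]; omega) hlt, staticMem,
      if_neg (by simp only [tableAddr]; omega), if_neg (by simp only [tableAddr]; omega),
      dif_pos (by rw [e1]; exact hX)]
    have e3 : ρ.symm ⟨_, (by rw [e1]; exact hX :
        (tableAddr R τ.code + ρ X - (1 + 2 * Fintype.card R)) % Fintype.card R <
          Fintype.card R)⟩ = X := by
      rw [Equiv.symm_apply_eq]
      exact Fin.ext e1
    rw [e3, e2, Skel.dec_code]
  cases hτX : τ.1 X with
  | none =>
    have h0 : τ.toAsg Ω X = none := by simp [Skel.toAsg, hτX]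
    rw [h0]
    rw [hτX] at hval
    exact hval
  | some l =>
    obtain ⟨Y, rfl⟩ := hτ X l hτX
    have h0 : τ.toAsg Ω X = some [Sum.inl Y] := by simp [Skel.toAsg, hτX]
    rw [h0]
    rw [hτX] at hval
    simp only at hval ⊢
    rw [hval]
    refine ⟨by omega, (hstr Y).1, fun i hi => ?_⟩
    have : i = 0 := by simpa using hi
    subst this
    exact (hstr Y).2

end Static

/-! ### Growing an ECSA -/

namespace ECSA

variable {R Ω : Type*} {D D' D'' : ECSA R Ω} {n a b k : ℕ} {σ : Asg R Ω}

theorem bag_union (hn : n ∈ D.nodes) (h : D.label n = .union) (ha : D.left n = some a)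
    (hb : D.right n = some b) : D.bag n = D.bag a + D.bag b := by
  rw [bag, WellFounded.fix_eq]
  simp only [hn, dite_true]
  split <;> simp_all
  subst_vars
  rfl

theorem bag_nu (hn : n ∈ D.nodes) (h : D.label n = .asg σ) (ha : D.left n = none) :
    D.bag n = {σ} := by
  rw [bag, WellFounded.fix_eq]
  simp only [hn, dite_true]
  split <;> simp_all

theorem bag_asg (hn : n ∈ D.nodes) (h : D.label n = .asg σ) (ha : D.left n = some a) :
    D.bag n = (D.bag a).map fun ν => ν.comp σ := by
  rw [bag, WellFounded.fix_eq]
  simp only [hn, dite_true]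
  split <;> simp_all
  subst_vars
  rfl

theorem odepth_succ (h : D.IsUnion n ∨ D.IsGamma n) (ha : D.left n = some a) :
    D.odepth n = D.odepth a + 1 := by
  rw [odepth, WellFounded.fix_eq]
  simp only [h, dite_true]
  split <;> simp_all
  subst_vars
  rfl

theorem odepth_zero (h : ¬ (D.IsUnion n ∨ D.IsGamma n)) : D.odepth n = 0 := by
  rw [odepth, WellFounded.fix_eq]
  simp only [h, dite_false]

/-- `D` is a part of `D'`: it has fewer nodes, with the same labels and children. -/
structure Sub (D D' : ECSA R Ω) : Prop where
  nodes : D.nodes ⊆ D'.nodes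
  label : ∀ n ∈ D.nodes, D'.label n = D.label n
  left : ∀ n ∈ D.nodes, D'.left n = D.left n
  right : ∀ n ∈ D.nodes, D'.right n = D.right n

theorem Sub.refl (D : ECSA R Ω) : Sub D D :=
  ⟨subset_rfl, fun _ _ => rfl, fun _ _ => rfl, fun _ _ => rfl⟩

theorem Sub.trans (h : Sub D D') (h' : Sub D' D'') : Sub D D'' :=
  ⟨h.nodes.trans h'.nodes, fun n hn => (h'.label n (h.nodes hn)).trans (h.label n hn),
    fun n hn => (h'.left n (h.nodes hn)).trans (h.left n hn),
    fun n hn => (h'.right n (h.nodes hn)).trans (h.right n hn)⟩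

/-- The bag depends only on the nodes below, and the children of an old node are old nodes. -/
theorem Sub.bag (h : Sub D D') (hn : n ∈ D.nodes) : D'.bag n = D.bag n := by
  induction n using D.wf.induction with
  | _ n ih =>
    have hn' := h.nodes hn
    have hl := h.left n hn
    have hlab := h.label n hn
    cases hlabel : D.label n with
    | union =>
      obtain ⟨h1, h2⟩ := D.union_children n hn hlabel
      obtain ⟨a, ha⟩ := Option.ne_none_iff_exists'.1 h1
      obtain ⟨b, hb⟩ := Option.ne_none_iff_exists'.1 h2
      rw [bag_union hn hlabel ha hb, bag_union hn' (hlab.trans hlabel) (hl.trans ha)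
        ((h.right n hn).trans hb), ih a ⟨hn, .inl ha⟩ (D.left_mem n hn a ha),
        ih b ⟨hn, .inr hb⟩ (D.right_mem n hn b hb)]
    | asg σ =>
      cases ha : D.left n with
      | none => rw [bag_nu hn hlabel ha, bag_nu hn' (hlab.trans hlabel) (hl.trans ha)]
      | some a =>
        rw [bag_asg hn hlabel ha, bag_asg hn' (hlab.trans hlabel) (hl.trans ha),
          ih a ⟨hn, .inl ha⟩ (D.left_mem n hn a ha)]

theorem Sub.isUnion (h : Sub D D') (hn : n ∈ D.nodes) : D'.IsUnion n ↔ D.IsUnion n := by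
  simp [IsUnion, hn, h.nodes hn, h.label n hn]

theorem Sub.isNu (h : Sub D D') (hn : n ∈ D.nodes) : D'.IsNu n ↔ D.IsNu n := by
  simp [IsNu, hn, h.nodes hn, h.label n hn]

theorem Sub.isGamma (h : Sub D D') (hn : n ∈ D.nodes) : D'.IsGamma n ↔ D.IsGamma n := by
  simp [IsGamma, hn, h.nodes hn, h.label n hn]

theorem Sub.isSigma (h : Sub D D') (hn : n ∈ D.nodes) : D'.IsSigma n ↔ D.IsSigma n := by
  simp [IsSigma, hn, h.nodes hn, h.label n hn]

theorem Sub.odepth (h : Sub D D') (hn : n ∈ D.nodes) : D'.odepth n = D.odepth n := by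
  induction n using D.wf.induction with
  | _ n ih =>
    have hiff : (D'.IsUnion n ∨ D'.IsGamma n) ↔ (D.IsUnion n ∨ D.IsGamma n) := by
      rw [h.isUnion hn, h.isGamma hn]
    by_cases hc : D.IsUnion n ∨ D.IsGamma n
    · have hex : D.left n ≠ none := by
        rcases hc with hc | ⟨_, σ, hσ, _, hv⟩
        · exact (D.union_children n hn hc.2).1
        · exact fun he => hv ((D.asg_left n hn σ hσ).1 he)
      obtain ⟨a, ha⟩ := Option.ne_none_iff_exists'.1 hex
      rw [odepth_succ hc ha, odepth_succ (hiff.2 hc) ((h.left n hn).trans ha),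
        ih a ⟨hn, .inl ha⟩ (D.left_mem n hn a ha)]
    · rw [odepth_zero hc, odepth_zero (hiff.not.2 hc)]

theorem Sub.extends (h : Sub D D') : D.Extends D' :=
  ⟨h.nodes, fun n hn => ⟨h.label n hn, h.left n hn, h.right n hn, h.bag hn⟩⟩

theorem Sub.safeOutput (h : Sub D D') (hs : D.SafeOutput n) : D'.SafeOutput n := by
  rcases hs with hs | hs | ⟨hs, m, hm, hm'⟩
  · exact .inl ((h.isNu hs.1).2 hs)
  · exact .inr (.inl ((h.isSigma hs.1).2 hs))
  · have := D.left_mem n hs.1 m hm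
    exact .inr (.inr ⟨(h.isGamma hs.1).2 hs, m, (h.left n hs.1).trans hm,
      by rwa [h.isNu this, h.isSigma this]⟩)

theorem Sub.safeUnion (h : Sub D D') (hs : D.SafeUnion n) : D'.SafeUnion n := by
  obtain ⟨hu, ⟨a, ha, hsa⟩, b, hb, hbd⟩ := hs
  exact ⟨(h.isUnion hu.1).2 hu, ⟨a, (h.left n hu.1).trans ha, h.safeOutput hsa⟩, b,
    (h.right n hu.1).trans hb, by rwa [h.odepth (D.right_mem n hu.1 b hb)]⟩

theorem Sub.safe (h : Sub D D') (hs : D.Safe n) : D'.Safe n := by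
  rcases hs with hs | hs | ⟨hs, m, hm, hm'⟩
  · exact .inl (h.safeOutput hs)
  · exact .inr (.inl (h.safeUnion hs))
  · exact .inr (.inr ⟨(h.isGamma hs.1).2 hs, m, (h.left n hs.1).trans hm, h.safeUnion hm'⟩)

/-- The four kinds of nodes. -/
theorem node_cases (hn : n ∈ D.nodes) :
    (D.label n = .union ∧ ∃ a ∈ D.nodes, ∃ b ∈ D.nodes, D.left n = some a ∧ D.right n = some b) ∨
    (∃ σ, D.label n = .asg σ ∧ σ.IsValuation ∧ D.left n = none) ∨
    (∃ σ, D.label n = .asg σ ∧ ¬ σ.IsValuation ∧ ∃ a ∈ D.nodes, D.left n = some a) := by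
  cases hlabel : D.label n with
  | union =>
    obtain ⟨h1, h2⟩ := D.union_children n hn hlabel
    obtain ⟨a, ha⟩ := Option.ne_none_iff_exists'.1 h1
    obtain ⟨b, hb⟩ := Option.ne_none_iff_exists'.1 h2
    exact .inl ⟨rfl, a, D.left_mem n hn a ha, b, D.right_mem n hn b hb, ha, hb⟩
  | asg σ =>
    by_cases hv : σ.IsValuation
    · exact .inr (.inl ⟨σ, rfl, hv, (D.asg_left n hn σ hlabel).2 hv⟩)
    · obtain ⟨a, ha⟩ := Option.ne_none_iff_exists'.1
        fun h => hv ((D.asg_left n hn σ hlabel).1 h)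
      exact .inr (.inr ⟨σ, rfl, hv, a, D.left_mem n hn a ha, ha⟩)

/-- Left children lead from every node to a bottom node. An element of the bag is needed whenever a
domain or a set of registers is to be read off from it. -/
theorem bag_ne_zero (hn : n ∈ D.nodes) : D.bag n ≠ 0 := by
  induction n using D.wf.induction with
  | _ n ih =>
    rcases node_cases hn with ⟨hl, a, ha, b, _, hla, hrb⟩ | ⟨σ, hl, _, hla⟩ |
      ⟨σ, hl, _, a, ha, hla⟩
    · rw [bag_union hn hl hla hrb]
      have := ih a ⟨hn, .inl hla⟩ ha
      simp [this]
    · rw [bag_nu hn hl hla]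
      simp
    · rw [bag_asg hn hl hla]
      simpa using ih a ⟨hn, .inl hla⟩ ha

/-- Add a new node. -/
def insertNode (D : ECSA R Ω) (n : ℕ) (lab : Label R Ω) (l r : Option ℕ) (hn : n ∉ D.nodes)
    (hl : ∀ m, l = some m → m ∈ D.nodes) (hr : ∀ m, r = some m → m ∈ D.nodes)
    (hu : lab = .union → l ≠ none ∧ r ≠ none)
    (ha : ∀ σ, lab = .asg σ → σ.Copyless ∧ r = none ∧ (l = none ↔ σ.IsValuation)) :
    ECSA R Ω where
  nodes := insert n D.nodes
  left := Function.update D.left n l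
  right := Function.update D.right n r
  label := Function.update D.label n lab
  left_mem := by
    intro x hx m hm
    rcases eq_or_ne x n with rfl | hne
    · simp only [Function.update_self] at hm
      exact Finset.mem_insert_of_mem (hl m hm)
    · simp only [Function.update_of_ne hne] at hm
      exact Finset.mem_insert_of_mem (D.left_mem x (Finset.mem_of_mem_insert_of_ne hx hne) m hm)
  right_mem := by
    intro x hx m hm
    rcases eq_or_ne x n with rfl | hne
    · simp only [Function.update_self] at hm
      exact Finset.mem_insert_of_mem (hr m hm)
    · simp only [Function.update_of_ne hne] at hm
      exact Finset.mem_insert_of_mem (D.right_mem x (Finset.mem_of_mem_insert_of_ne hx hne) m hm)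
  union_children := by
    intro x hx h
    rcases eq_or_ne x n with rfl | hne
    · simp only [Function.update_self] at h ⊢
      exact hu h
    · simp only [Function.update_of_ne hne] at h ⊢
      exact D.union_children x (Finset.mem_of_mem_insert_of_ne hx hne) h
  asg_copyless := by
    intro x hx σ h
    rcases eq_or_ne x n with rfl | hne
    · simp only [Function.update_self] at h
      exact (ha σ h).1
    · simp only [Function.update_of_ne hne] at h
      exact D.asg_copyless x (Finset.mem_of_mem_insert_of_ne hx hne) σ h
  asg_right := by
    intro x hx σ h
    rcases eq_or_ne x n with rfl | hne
    · simp only [Function.update_self] at h ⊢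
      exact (ha σ h).2.1
    · simp only [Function.update_of_ne hne] at h ⊢
      exact D.asg_right x (Finset.mem_of_mem_insert_of_ne hx hne) σ h
  asg_left := by
    intro x hx σ h
    rcases eq_or_ne x n with rfl | hne
    · simp only [Function.update_self] at h ⊢
      exact (ha σ h).2.2
    · simp only [Function.update_of_ne hne] at h ⊢
      exact D.asg_left x (Finset.mem_of_mem_insert_of_ne hx hne) σ h
  acyclic := by
    -- All edges, old and new, end in old nodes. Hence no edge leads into `n`, and a cycle would lie
    -- entirely in `D`.
    have hedge : ∀ x y, (x ∈ insert n D.nodes ∧ (Function.update D.left n l x = some y ∨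
        Function.update D.right n r x = some y)) → y ∈ D.nodes ∧ (x ∈ D.nodes →
        x ∈ D.nodes ∧ (D.left x = some y ∨ D.right x = some y)) := by
      rintro x y ⟨hx, h⟩
      rcases eq_or_ne x n with rfl | hne
      · simp only [Function.update_self] at h
        exact ⟨h.elim (hl y) (hr y), fun h => (hn h).elim⟩
      · simp only [Function.update_of_ne hne] at h
        have hx := Finset.mem_of_mem_insert_of_ne hx hne
        exact ⟨h.elim (D.left_mem x hx y) (D.right_mem x hx y), fun _ => ⟨hx, h⟩⟩
    intro x h
    have hx : x ∈ D.nodes := by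
      cases h with
      | single h => exact (hedge _ _ h).1
      | tail _ h => exact (hedge _ _ h).1
    refine D.acyclic x ?_
    have : ∀ y, Relation.TransGen (fun a b => a ∈ insert n D.nodes ∧
        (Function.update D.left n l a = some b ∨ Function.update D.right n r a = some b)) x y →
        y ∈ D.nodes ∧ Relation.TransGen (fun a b => a ∈ D.nodes ∧
          (D.left a = some b ∨ D.right a = some b)) x y := by
      intro y hy
      induction hy with
      | single h => exact ⟨(hedge _ _ h).1, .single ((hedge _ _ h).2 hx)⟩
      | tail _ h ih => exact ⟨(hedge _ _ h).1, ih.2.tail ((hedge _ _ h).2 ih.1)⟩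
    exact (this x h).2

/-- `D'` arises from `D` by adding the node `n` with the given label and children. -/
structure IsInsert (D D' : ECSA R Ω) (n : ℕ) (lab : Label R Ω) (l r : Option ℕ) : Prop where
  sub : Sub D D'
  nodes : D'.nodes = insert n D.nodes
  label : D'.label n = lab
  left : D'.left n = l
  right : D'.right n = r

theorem exists_isInsert (D : ECSA R Ω) {n : ℕ} {lab : Label R Ω} {l r : Option ℕ}
    (hn : n ∉ D.nodes)
    (hl : ∀ m, l = some m → m ∈ D.nodes) (hr : ∀ m, r = some m → m ∈ D.nodes)
    (hu : lab = .union → l ≠ none ∧ r ≠ none)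
    (ha : ∀ σ, lab = .asg σ → σ.Copyless ∧ r = none ∧ (l = none ↔ σ.IsValuation)) :
    ∃ D', IsInsert D D' n lab l r := by
  refine ⟨D.insertNode n lab l r hn hl hr hu ha, ⟨Finset.subset_insert _ _, ?_, ?_, ?_⟩, rfl, ?_,
    ?_, ?_⟩
  iterate 3
    intro x hx
    have : x ≠ n := by rintro rfl; exact hn hx
    simp [insertNode, this]
  iterate 3 simp [insertNode]

theorem exists_insert_union (D : ECSA R Ω) (hn : n ∉ D.nodes) (ha : a ∈ D.nodes)
    (hb : b ∈ D.nodes) : ∃ D', IsInsert D D' n .union (some a) (some b) :=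
  D.exists_isInsert hn (by simpa using ha) (by simpa using hb) (by simp) (by simp)

theorem exists_insert_nu (D : ECSA R Ω) (hn : n ∉ D.nodes) (hσ : σ.IsValuation) :
    ∃ D', IsInsert D D' n (.asg σ) none none :=
  D.exists_isInsert hn (by simp) (by simp) (by simp) (by
    rintro _ ⟨⟩
    exact ⟨hσ.copyless, rfl, by simp [hσ]⟩)

theorem exists_insert_asg (D : ECSA R Ω) (hn : n ∉ D.nodes) (ha : a ∈ D.nodes) (hσ : σ.Copyless)
    (hv : ¬ σ.IsValuation) : ∃ D', IsInsert D D' n (.asg σ) (some a) none :=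
  D.exists_isInsert hn (by simpa using ha) (by simp) (by simp) (by
    rintro _ ⟨⟩
    exact ⟨hσ, rfl, by simp [hv]⟩)

namespace IsInsert

variable {lab : Label R Ω} {l r : Option ℕ}

theorem mem (h : IsInsert D D' n lab l r) : n ∈ D'.nodes := by simp [h.nodes]

theorem bounded (h : IsInsert D D' n lab l r) (hD : D.Bounded k) (hn : D'.odepth n ≤ k) :
    D'.Bounded k := by
  intro x hx
  rw [h.nodes, Finset.mem_insert] at hx
  rcases hx with rfl | hx
  · exact hn
  · rw [h.sub.odepth hx]
    exact hD x hx

theorem bag_union (h : IsInsert D D' n .union (some a) (some b)) (ha : a ∈ D.nodes)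
    (hb : b ∈ D.nodes) : D'.bag n = D.bag a + D.bag b := by
  rw [ECSA.bag_union h.mem h.label h.left h.right, h.sub.bag ha, h.sub.bag hb]

theorem odepth_union (h : IsInsert D D' n .union (some a) (some b)) (ha : a ∈ D.nodes) :
    D'.odepth n = D.odepth a + 1 := by
  rw [odepth_succ (.inl ⟨h.mem, h.label⟩) h.left, h.sub.odepth ha]

theorem bag_nu (h : IsInsert D D' n (.asg σ) none none) : D'.bag n = {σ} :=
  ECSA.bag_nu h.mem h.label h.left

theorem bag_asg (h : IsInsert D D' n (.asg σ) (some a) none) (ha : a ∈ D.nodes) :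
    D'.bag n = (D.bag a).map fun ν => ν.comp σ := by
  rw [ECSA.bag_asg h.mem h.label h.left, h.sub.bag ha]

theorem garbageFree (h : IsInsert D D' n lab l r) (hD : D.GarbageFree)
    (hn : ∀ σ m, lab = .asg σ → l = some m → m ∈ D.nodes ∧ ∀ ν ∈ D.bag m, ν.dom = σ.reg) :
    D'.GarbageFree := by
  intro x hx σ m hσ hm ν hν
  have hxn : x ∈ D'.nodes := hx.elim (fun h => h.1) fun h => h.1
  rw [h.nodes, Finset.mem_insert] at hxn
  rcases eq_or_ne x n with rfl | hne
  · rw [h.label] at hσ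
    rw [h.left] at hm
    obtain ⟨hmD, hfit⟩ := hn σ m hσ hm
    rw [h.sub.bag hmD] at hν
    exact hfit ν hν
  · have hxD := hxn.resolve_left hne
    rw [h.sub.label x hxD] at hσ
    rw [h.sub.left x hxD] at hm
    rw [h.sub.isSigma hxD, h.sub.isGamma hxD] at hx
    rw [h.sub.bag (D.left_mem x hxD m hm)] at hν
    exact hD x hx σ m hσ hm ν hν

end IsInsert

theorem garbageFree_empty : (empty : ECSA R Ω).GarbageFree := by
  intro n hn
  have : n ∈ (empty : ECSA R Ω).nodes := hn.elim (fun h => h.1) fun h => h.1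
  simp [empty] at this

end ECSA

/-! ### Bags of assignments -/

section Bags

variable {R Ω : Type*}

/-- Compose all elements of a bag with an assignment. -/
def compAll (M : Multiset (Asg R Ω)) (σ : Asg R Ω) : Multiset (Asg R Ω) := M.map fun ν => ν.comp σ

@[simp] theorem compAll_zero (σ : Asg R Ω) : compAll 0 σ = 0 := rfl

@[simp] theorem compAll_singleton (ν σ : Asg R Ω) : compAll {ν} σ = {ν.comp σ} := rfl

@[simp] theorem compAll_add (M N : Multiset (Asg R Ω)) (σ : Asg R Ω) :
    compAll (M + N) σ = compAll M σ + compAll N σ := Multiset.map_add _ _ _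

theorem compAll_compAll (M : Multiset (Asg R Ω)) (σ₁ σ₂ : Asg R Ω) :
    compAll (compAll M σ₁) σ₂ = compAll M (σ₁.comp σ₂) := by
  simp [compAll, Multiset.map_map, Asg.comp_assoc]

/-- All elements of the bag fit to the assignment. -/
def AllFit (M : Multiset (Asg R Ω)) (σ : Asg R Ω) : Prop := ∀ ν ∈ M, ν.Fits σ

theorem allFit_zero (σ : Asg R Ω) : AllFit 0 σ := by simp [AllFit]

theorem allFit_add {M N : Multiset (Asg R Ω)} {σ : Asg R Ω} :
    AllFit (M + N) σ ↔ AllFit M σ ∧ AllFit N σ := by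
  simp only [AllFit, Multiset.mem_add]
  exact ⟨fun h => ⟨fun ν hν => h ν (.inl hν), fun ν hν => h ν (.inr hν)⟩,
    fun h ν hν => hν.elim (h.1 ν) (h.2 ν)⟩

theorem AllFit.comp {M : Multiset (Asg R Ω)} {σ₁ σ₂ : Asg R Ω} (h₁ : AllFit M σ₁)
    (h₂ : AllFit (compAll M σ₁) σ₂) : AllFit M (σ₁.comp σ₂) :=
  fun ν hν => (h₁ ν hν).comp (h₂ _ (Multiset.mem_map_of_mem _ hν))

theorem AllFit.dom_eq {M : Multiset (Asg R Ω)} {σ : Asg R Ω} (h : AllFit M σ) :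
    ∀ ν ∈ compAll M σ, ν.dom = σ.dom := by
  intro ν hν
  obtain ⟨ν', hν', rfl⟩ := Multiset.mem_map.1 hν
  exact (h ν' hν').dom_comp

theorem compAll_idOn {M : Multiset (Asg R Ω)} {S : Set R} (h : ∀ ν ∈ M, ν.dom = S) :
    compAll M ((Skel.idOn S).toAsg Ω) = M := by
  rw [compAll]
  conv_rhs => rw [← Multiset.map_id M]
  refine Multiset.map_congr rfl fun ν hν => ?_
  rw [← h ν hν]
  exact Skel.comp_idOn ν

theorem allFit_idOn {M : Multiset (Asg R Ω)} {S : Set R} (h : ∀ ν ∈ M, ν.dom = S) :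
    AllFit M ((Skel.idOn S).toAsg Ω) := by
  intro ν hν
  rw [← h ν hν]
  exact Skel.fits_idOn ν

/-- The assignment that is nowhere defined. -/
def nowhere : Asg R Ω := fun _ => none

/-- A valuation is regarded as its own composition with `nowhere`; thus items with and without a
child obey the same rules. -/
theorem allFit_nowhere {σ : Asg R Ω} (h : σ.IsValuation) : AllFit {nowhere} σ := by
  intro ν hν
  rw [Multiset.mem_singleton] at hν
  subst hν
  rw [Asg.Fits, Asg.isValuation_iff.1 h]
  simp [Asg.dom, nowhere]

theorem _root_.SST.Asg.hat_of_letters {ν : Asg R Ω} {w : List (R ⊕ Ω)}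
    (h : ∀ s ∈ w, ∃ a, s = Sum.inr a) : ν.hat w = some w := by
  induction w with
  | nil => rfl
  | cons s w ih =>
    obtain ⟨a, rfl⟩ := h s (by simp)
    simp [Asg.hat, Asg.onSymbol, ih fun s hs => h s (by simp [hs])]

theorem _root_.SST.Asg.IsValuation.comp_eq {ν σ : Asg R Ω} (h : σ.IsValuation) :
    ν.comp σ = σ := by
  funext X
  rw [Asg.comp]
  cases hX : σ X with
  | none => rfl
  | some w => exact Asg.hat_of_letters (h X w hX)

end Bags

/-! ### The trees used for enumeration -/

/-- The tree structure behind the nodes. A tree represents its *item* together with its *list*, which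
consists of the `right` subtree and of the list of the `left` subtree. The item is a valuation `σ`, or
the valuations of the `child` subtree composed with an assignment `σ` (at address `p` of the input
memory) that has letters. All references to subtrees carry skeletons to be applied. -/
inductive Tree (R Ω : Type*)
  | nil
  | node (a : Skel R) (p : ℕ) (σ : Asg R Ω) (c : Skel R) (child : Tree R Ω) (r : Skel R)
      (right : Tree R Ω) (l : Skel R) (left : Tree R Ω)

namespace Tree

variable {R Ω : Type*}

/-- Is this the empty tree? -/
def isNil : Tree R Ω → Bool
  | nil => true
  | node .. => false

theorem isNil_iff {T : Tree R Ω} : T.isNil = true ↔ T = nil := by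
  cases T <;> simp [isNil]

theorem isNil_iff_not {T : Tree R Ω} : T.isNil = false ↔ T ≠ nil := by
  cases T <;> simp [isNil]

/-- The bag and the list of a tree. -/
def bags : Tree R Ω → Multiset (Asg R Ω) × Multiset (Asg R Ω)
  | nil => (0, 0)
  | node a _ σ c child r right l left =>
    (compAll (compAll (if child.isNil then {nowhere} else compAll (bags child).1 (c.toAsg Ω)) σ)
        (a.toAsg Ω) +
      (compAll (bags right).1 (r.toAsg Ω) + compAll (bags left).2 (l.toAsg Ω)),
    compAll (bags right).1 (r.toAsg Ω) + compAll (bags left).2 (l.toAsg Ω))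

/-- The bag of a tree. -/
def bag (T : Tree R Ω) : Multiset (Asg R Ω) := (bags T).1

/-- The part of the bag of a tree that does not belong to its item. -/
def list (T : Tree R Ω) : Multiset (Asg R Ω) := (bags T).2

/-- The valuations at the child of an item. -/
def source (child : Tree R Ω) (c : Skel R) : Multiset (Asg R Ω) :=
  if child.isNil then {nowhere} else compAll child.bag (c.toAsg Ω)

@[simp] theorem bag_nil : (nil : Tree R Ω).bag = 0 := rfl
@[simp] theorem list_nil : (nil : Tree R Ω).list = 0 := rfl

variable {a c r l : Skel R} {p : ℕ} {σ : Asg R Ω} {child right left : Tree R Ω}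

theorem list_node : (node a p σ c child r right l left).list =
    compAll right.bag (r.toAsg Ω) + compAll left.list (l.toAsg Ω) := rfl

theorem bag_node : (node a p σ c child r right l left).bag =
    compAll (compAll (source child c) σ) (a.toAsg Ω) +
      (node a p σ c child r right l left).list := rfl

/-- Is there a nonempty list? -/
def HasList : Tree R Ω → Prop
  | nil => False
  | node _ _ _ _ _ _ right _ _ => right ≠ nil

/-- The invariants of a tree. -/
def WF : Tree R Ω → Prop
  | nil => True
  | node a _ σ c child r right l left =>
    σ.Copyless ∧ WF child ∧ (child ≠ nil → σ.HasLetter ∧ AllFit child.bag (c.toAsg Ω)) ∧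
    AllFit (source child c) σ ∧ AllFit (compAll (source child c) σ) (a.toAsg Ω) ∧
    WF right ∧ AllFit right.bag (r.toAsg Ω) ∧
    WF left ∧ AllFit left.list (l.toAsg Ω) ∧
    (left ≠ nil → right ≠ nil ∧ left.HasList)

/-- A tree with a skeleton to be applied represents the bag `M`. -/
def Represents (T : Tree R Ω) (τ : Skel R) (M : Multiset (Asg R Ω)) : Prop :=
  T ≠ nil ∧ T.WF ∧ AllFit T.bag (τ.toAsg Ω) ∧ compAll T.bag (τ.toAsg Ω) = M

/-- Applying a skeleton leaves the tree untouched: the tree is shared and only the skeleton of the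
handle changes. -/
theorem Represents.comp {T : Tree R Ω} {τ γ : Skel R} {M : Multiset (Asg R Ω)}
    (h : T.Represents τ M) (hγ : AllFit M (γ.toAsg Ω)) :
    T.Represents (τ.comp γ) (compAll M (γ.toAsg Ω)) := by
  obtain ⟨h1, h2, h3, rfl⟩ := h
  refine ⟨h1, h2, ?_, ?_⟩
  · rw [Skel.toAsg_comp]
    exact h3.comp hγ
  · rw [compAll_compAll, Skel.toAsg_comp]

/-- The tree consisting of a single item. -/
noncomputable def single (p : ℕ) (σ : Asg R Ω) (c : Skel R) (child : Tree R Ω) : Tree R Ω :=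
  node (Skel.idOn σ.dom) p σ c child (Skel.idOn σ.dom) nil (Skel.idOn σ.dom) nil

theorem represents_single (hσ : σ.Copyless) (hw : child.WF)
    (hl : child ≠ nil → σ.HasLetter ∧ AllFit child.bag (c.toAsg Ω))
    (hs : AllFit (source child c) σ) :
    (single p σ c child).Represents (Skel.idOn σ.dom) (compAll (source child c) σ) := by
  have hd := hs.dom_eq
  have hb : (single p σ c child).bag = compAll (source child c) σ := by
    rw [single, bag_node, list_node, compAll_idOn hd]
    simp
  refine ⟨by simp [single], ?_, ?_, ?_⟩
  · exact ⟨hσ, hw, hl, hs, allFit_idOn hd, trivial, allFit_zero _, trivial, allFit_zero _,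
      fun h => (h rfl).elim⟩
  · rw [hb]
    exact allFit_idOn hd
  · rw [hb]
    exact compAll_idOn hd

theorem represents_nu (hσ : σ.IsValuation) :
    (single p σ (Skel.idOn σ.dom) nil).Represents (Skel.idOn σ.dom) {σ} := by
  have := represents_single (p := p) (c := Skel.idOn σ.dom) (child := nil) hσ.copyless trivial
    (fun h => (h rfl).elim) (allFit_nowhere hσ)
  rwa [source, if_pos (by rfl), compAll_singleton, hσ.comp_eq] at this

/-- Only an assignment with a letter makes the tree deeper, so depth is always paid for by output
symbols. -/
theorem Represents.extend {M : Multiset (Asg R Ω)} (h : child.Represents c M) (hσ : σ.Copyless)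
    (hl : σ.HasLetter) (hM : AllFit M σ) :
    (single p σ c child).Represents (Skel.idOn σ.dom) (compAll M σ) := by
  obtain ⟨h1, h2, h3, rfl⟩ := h
  have hs : source child c = compAll child.bag (c.toAsg Ω) := by
    rw [source, isNil_iff_not.2 h1]
    rfl
  rw [← hs]
  exact represents_single hσ h2 (fun _ => ⟨hl, h3⟩) (by rwa [hs])

/-- The union of two trees. -/
def union (T₁ : Tree R Ω) (τ₁ : Skel R) (T₂ : Tree R Ω) (τ₂ : Skel R) : Tree R Ω :=
  match T₁ with
  | nil => nil
  | node a p σ c child _ right _ _ =>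
    node (a.comp τ₁) p σ c child τ₂ T₂ τ₁ (if right.isNil then nil else T₁)

/-- The bag of `T₁` is its item plus its list. The new record takes over the item, with `τ₁`
composed into its skeleton, points to `T₂` on the right, and to `T₁` itself on the left, where only
the list of `T₁` counts. All skeletons are now inside the record, so the handle carries an identity.
-/
theorem Represents.union {T₁ T₂ : Tree R Ω} {τ₁ τ₂ : Skel R} {M₁ M₂ : Multiset (Asg R Ω)}
    (h₁ : T₁.Represents τ₁ M₁) (h₂ : T₂.Represents τ₂ M₂) (hne : M₁ ≠ 0)
    (hd : ∀ ν₁ ∈ M₁, ∀ ν₂ ∈ M₂, ν₁.dom = ν₂.dom) :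
    (T₁.union τ₁ T₂ τ₂).Represents (Skel.idOn (τ₁.toAsg Ω).dom) (M₁ + M₂) := by
  obtain ⟨h1, h2, h3, rfl⟩ := h₁
  obtain ⟨k1, k2, k3, rfl⟩ := h₂
  cases T₁ with
  | nil => exact (h1 rfl).elim
  | node a p σ c child r right l left =>
    obtain ⟨e1, e2, e3, e4, e5, e6, e7, e8, e9, e10⟩ := id h2
    rw [bag_node, allFit_add] at h3
    -- If `T₁` has an empty list, the left reference is `nil`. So a left reference always stands for
    -- a nonempty list, and the enumeration never has to skip empty ones.
    have hL : ∀ T, T = (if right.isNil then nil else node a p σ c child r right l left) →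
        T.list = (node a p σ c child r right l left).list ∧ T.WF ∧ (T ≠ nil → T.HasList) := by
      rintro T rfl
      split_ifs with hr
      · rw [isNil_iff] at hr
        have hle : left = nil := by
          by_contra hle
          exact (e10 hle).1 hr
        subst hr hle
        exact ⟨by simp [list_node], trivial, fun h => (h rfl).elim⟩
      · exact ⟨rfl, h2, fun _ h => hr (isNil_iff.2 h)⟩
    obtain ⟨hL1, hL2, hL3⟩ := hL _ rfl
    have hbag : ((node a p σ c child r right l left).union τ₁ T₂ τ₂).bag =
        compAll (node a p σ c child r right l left).bag (τ₁.toAsg Ω) +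
          compAll T₂.bag (τ₂.toAsg Ω) := by
      rw [Tree.union, bag_node, list_node, bag_node, hL1, compAll_add, Skel.toAsg_comp,
        compAll_compAll _ (a.toAsg Ω)]
      abel
    have hdom : ∀ ν ∈ compAll (node a p σ c child r right l left).bag (τ₁.toAsg Ω) +
          compAll T₂.bag (τ₂.toAsg Ω), ν.dom = (τ₁.toAsg Ω).dom := by
      have h1 : ∀ ν ∈ compAll (node a p σ c child r right l left).bag (τ₁.toAsg Ω),
          ν.dom = (τ₁.toAsg Ω).dom := AllFit.dom_eq (by rw [bag_node, allFit_add]; exact h3)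
      intro ν hν
      rcases Multiset.mem_add.1 hν with hν | hν
      · exact h1 ν hν
      -- An element of the nonempty bag `M₁` carries the domain over to the elements of the second
      -- bag.
      · obtain ⟨ν₁, hν₁⟩ := Multiset.exists_mem_of_ne_zero hne
        rw [← hd ν₁ hν₁ ν hν, h1 ν₁ hν₁]
    refine ⟨by simp [Tree.union], ?_, ?_, ?_⟩
    · refine ⟨e1, e2, e3, e4, ?_, k2, k3, hL2, ?_, fun h => ⟨k1, hL3 h⟩⟩
      · rw [Skel.toAsg_comp]
        exact e5.comp h3.1
      · rw [hL1]
        exact h3.2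
    · rw [hbag]
      exact allFit_idOn hdom
    · rw [hbag]
      exact compAll_idOn hdom

variable [Fintype R] (ρ : R ≃ Fin (Fintype.card R)) (ω : Ω ↪ ℕ) (I : ℕ → ℕ)

/-- The tree is stored at address `q` of the work memory `W`, below the address `f`. -/
def Holds (W : ℕ → ℕ) (f : ℕ) : Tree R Ω → ℕ → Prop
  | nil, q => q = 0
  | node a p σ c child r right l left, q =>
    0 < q ∧ q + 8 ≤ f ∧ W q = a.code ∧ W (q + 1) = p ∧ HoldsAsg ρ ω I p σ ∧
    Holds W f child (W (q + 2)) ∧ W (q + 3) = c.code ∧ Holds W f right (W (q + 4)) ∧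
    W (q + 5) = r.code ∧ Holds W f left (W (q + 6)) ∧ W (q + 7) = l.code

variable {ρ ω I}

theorem Holds.ne_zero {W : ℕ → ℕ} {f q : ℕ} {T : Tree R Ω} (h : T.Holds ρ ω I W f q) :
    q ≠ 0 ↔ T ≠ nil := by
  cases T with
  | nil => simpa [Holds] using h
  | node => simpa using h.1.ne'

/-- The memory `W'` agrees with `W` below the address `f`, except possibly for the cell `0`. -/
def _root_.SST.Keeps (f : ℕ) (W W' : ℕ → ℕ) : Prop := ∀ a, 0 < a → a < f → W' a = W a

theorem _root_.SST.Keeps.refl (f : ℕ) (W : ℕ → ℕ) : Keeps f W W := fun _ _ _ => rfl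

theorem _root_.SST.Keeps.trans {f f' : ℕ} {W W' W'' : ℕ → ℕ} (h : Keeps f W W')
    (h' : Keeps f' W' W'') (hf : f ≤ f') : Keeps f W W'' :=
  fun a h0 ha => (h' a h0 (by omega)).trans (h a h0 ha)

theorem _root_.SST.keeps_writeAt (f : ℕ) (W : ℕ → ℕ) (v : List ℕ) : Keeps f W (writeAt W f v) :=
  fun _ _ ha => writeAt_of_lt ha

/-- Persistence: new records are written at or above the free pointer, so trees below it survive. -/
theorem Holds.mono {W W' : ℕ → ℕ} {f f' q : ℕ} {T : Tree R Ω} (h : T.Holds ρ ω I W f q)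
    (hW : Keeps f W W') (hf : f ≤ f') : T.Holds ρ ω I W' f' q := by
  induction T generalizing q with
  | nil => exact h
  | node a p σ c child r right l left ihc ihr ihl =>
    obtain ⟨h0, h1, h2, h3, h4, h5, h6, h7, h8, h9, h10⟩ := h
    refine ⟨h0, by omega, ?_, ?_, h4, ?_, ?_, ?_, ?_, ?_, ?_⟩
    · rw [hW _ (by omega) (by omega), h2]
    · rw [hW _ (by omega) (by omega), h3]
    · rw [hW _ (by omega) (by omega)]
      exact ihc h5
    · rw [hW _ (by omega) (by omega), h6]
    · rw [hW _ (by omega) (by omega)]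
      exact ihr h7
    · rw [hW _ (by omega) (by omega), h8]
    · rw [hW _ (by omega) (by omega)]
      exact ihl h9
    · rw [hW _ (by omega) (by omega), h10]

theorem holds_writeAt {W : ℕ → ℕ} {f qc qr ql : ℕ} (hf : 0 < f) (hp : HoldsAsg ρ ω I p σ)
    (hc : child.Holds ρ ω I W f qc) (hr : right.Holds ρ ω I W f qr)
    (hl : left.Holds ρ ω I W f ql) :
    (node a p σ c child r right l left).Holds ρ ω I
      (writeAt W f [a.code, p, qc, c.code, qr, r.code, ql, l.code]) (f + 8) f := by
  have hk := keeps_writeAt f W [a.code, p, qc, c.code, qr, r.code, ql, l.code]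
  refine ⟨hf, le_rfl, ?_, ?_, hp, ?_, ?_, ?_, ?_, ?_, ?_⟩
  · exact writeAt_get (i := 0) rfl
  · exact writeAt_get rfl
  · rw [writeAt_get (i := 2) rfl]
    exact hc.mono hk (by omega)
  · exact writeAt_get rfl
  · rw [writeAt_get (i := 4) rfl]
    exact hr.mono hk (by omega)
  · exact writeAt_get rfl
  · rw [writeAt_get (i := 6) rfl]
    exact hl.mono hk (by omega)
  · exact writeAt_get rfl

end Tree

/-! ### The invariant of the data structure -/

section Invariant

variable {R Ω : Type*} [Fintype R] (ρ : R ≃ Fin (Fintype.card R)) (ω : Ω ↪ ℕ) (I : ℕ → ℕ)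

/-- The handle (a skeleton and a tree) stored in the cells `n + 5` and `n + 6` represents `M`. -/
def HandleIn (W : ℕ → ℕ) (f n : ℕ) (M : Multiset (Asg R Ω)) : Prop :=
  ∃ (τ : Skel R) (T : Tree R Ω), W (n + 5) = τ.code ∧ T.Holds ρ ω I W f (W (n + 6)) ∧
    T.Represents τ M

/-- The kind, the label and the code of the relabel of the node `n` are stored in the cells `n`,
`n + 3` and `n + 4`. -/
def LabelIn (W : ℕ → ℕ) (n : ℕ) : Label R Ω → Prop
  | .union => W n = 0 ∧ W (n + 4) = 0
  | .asg σ =>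
    (W n = 1 ∧ HoldsAsg ρ ω I (W (n + 3)) σ ∧ W (n + 4) = 0 ∧ (σ.IsValuation ∨ ¬ σ.IsRelabel)) ∨
    (W n = 2 ∧ ∃ γ : Skel R, σ = γ.toAsg Ω ∧ γ.IsRelabel ∧ ¬ σ.IsValuation ∧
      W (n + 3) = tableAddr R γ.code ∧ W (n + 4) = γ.code + 1)

/-- The node `n` is stored. -/
structure NodeIn (W : ℕ → ℕ) (f : ℕ) (D : ECSA R Ω) (n : ℕ) : Prop where
  pos : 0 < n
  le : n + 7 ≤ f
  left : W (n + 1) = (D.left n).getD 0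
  right : W (n + 2) = (D.right n).getD 0
  label : LabelIn ρ ω I W n (D.label n)
  handle : HandleIn ρ ω I W f n (D.bag n)

/-- The structure `D` is stored in the memory `W`, below the address `f`. -/
structure Good (W : ℕ → ℕ) (f : ℕ) (D : ECSA R Ω) : Prop where
  static : StaticIn ρ W
  le : staticEnd R ≤ f
  node : ∀ n ∈ D.nodes, NodeIn ρ ω I W f D n
  garbageFree : D.GarbageFree

variable {ρ ω I} {W W' : ℕ → ℕ} {f f' n : ℕ} {D D' : ECSA R Ω}

theorem Good.pos (h : Good ρ ω I W f D) : 0 < f :=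
  lt_of_lt_of_le (by simp only [staticEnd, tableAddr]; omega) h.le

theorem HandleIn.mono {M : Multiset (Asg R Ω)} (h : HandleIn ρ ω I W f n M) (hn : n + 7 ≤ f)
    (hW : Keeps f W W') (hf : f ≤ f') : HandleIn ρ ω I W' f' n M := by
  obtain ⟨τ, T, h1, h2, h3⟩ := h
  refine ⟨τ, T, ?_, ?_, h3⟩
  · rw [hW _ (by omega) (by omega), h1]
  · rw [hW _ (by omega) (by omega)]
    exact h2.mono hW hf

theorem LabelIn.mono {lab : Label R Ω} (h : LabelIn ρ ω I W n lab) (hn : n + 7 ≤ f) (h0 : 0 < n)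
    (hW : Keeps f W W') : LabelIn ρ ω I W' n lab := by
  have e0 := hW n h0 (by omega)
  have e3 := hW (n + 3) (by omega) (by omega)
  have e4 := hW (n + 4) (by omega) (by omega)
  cases lab <;> simpa only [LabelIn, e0, e3, e4] using h

theorem Good.mono (h : Good ρ ω I W f D) (hW : Keeps f W W') (hf : f ≤ f') :
    Good ρ ω I W' f' D where
  static := fun a h0 ha => (hW a h0 (lt_of_lt_of_le ha h.le)).trans (h.static a h0 ha)
  le := h.le.trans hf
  node := fun n hn => by
    have hN := h.node n hn
    have hle := hN.le
    exact ⟨hN.pos, by omega, by rw [hW _ (by omega) (by omega), hN.left],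
      by rw [hW _ (by omega) (by omega), hN.right], hN.label.mono hle hN.pos hW,
      hN.handle.mono hle hW hf⟩
  garbageFree := h.garbageFree

/-- All node records end below the free pointer, which is therefore a fresh name for the next node.
-/
theorem Good.notMem (h : Good ρ ω I W f D) : f ∉ D.nodes := fun hf => by
  have := (h.node f hf).le
  omega

theorem Good.storedIn (h : Good ρ ω I W f D) : D.StoredIn ρ ω I W := by
  intro n hn
  have hN := h.node n hn
  refine ⟨hN.pos.ne', hN.left, hN.right, ?_⟩
  have hl := hN.label
  cases hlab : D.label n with
  | union =>
    rw [hlab] at hl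
    exact hl.1
  | asg σ =>
    rw [hlab] at hl
    rcases hl with ⟨h1, h2, _⟩ | ⟨h1, γ, rfl, hγ, _, h2, _⟩
    · exact .inl ⟨h1, h2⟩
    · refine .inr ⟨h1, ?_⟩
      rw [h2]
      exact h.static.holdsAsg hγ ω

/-- Adding a node to the structure. -/
theorem Good.insert (h : Good ρ ω I W f D) {lab : Label R Ω} {l r : Option ℕ}
    {k l' r' p g t q : ℕ} (hD : D.IsInsert D' f lab l r) (hl : l' = l.getD 0) (hr : r' = r.getD 0)
    (hlab : LabelIn ρ ω I (writeAt W f [k, l', r', p, g, t, q]) f lab)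
    {τ : Skel R} {T : Tree R Ω} (ht : t = τ.code) (hT : T.Holds ρ ω I W f q)
    (hM : T.Represents τ (D'.bag f))
    (hg : ∀ σ m, lab = .asg σ → l = some m → m ∈ D.nodes ∧ AllFit (D.bag m) σ) :
    Good ρ ω I (writeAt W f [k, l', r', p, g, t, q]) (f + 7) D' := by
  have hk := keeps_writeAt f W [k, l', r', p, g, t, q]
  have h' := h.mono hk (show f ≤ f + 7 by omega)
  refine ⟨h'.static, h'.le, fun n hn => ?_, hD.garbageFree h.garbageFree hg⟩
  rw [hD.nodes, Finset.mem_insert] at hn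
  rcases eq_or_ne n f with rfl | hne
  · refine ⟨h.pos, le_rfl, ?_, ?_, ?_, τ, T, ?_, ?_, hM⟩
    · rw [hD.left, ← hl]
      exact writeAt_get rfl
    · rw [hD.right, ← hr]
      exact writeAt_get rfl
    · rwa [hD.label]
    · rw [← ht]
      exact writeAt_get rfl
    · rw [writeAt_get (i := 6) rfl]
      exact hT.mono hk (by omega)
  · have hn := hn.resolve_left hne
    have hN := h'.node n hn
    exact ⟨hN.pos, hN.le, by rw [hN.left, hD.sub.left n hn], by rw [hN.right, hD.sub.right n hn],
      by rw [hD.sub.label n hn]; exact hN.label, by rw [hD.sub.bag hn]; exact hN.handle⟩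

end Invariant

/-! ### Programs creating nodes -/

section NodePrograms

variable (R : Type*) [Fintype R]

/-- Create a node for the composition of the bag of the node in register `30` with the relabel in
register `31`; the new node is returned in register `32`. A relabel node is not put on top of another
one: the two relabels are composed. -/
noncomputable def relabelCmd : Cmd :=
  blk [fetch 20 30 5, fetch 21 30 6, compCmd R 20 20 31, fetch 22 30 4,
    .ite 22 (blk [.const 10 1, .sub 22 22 10, compCmd R 23 22 31, fetch 24 30 1])
      (blk [.move 23 31, .move 24 30]),
    tabulate (Skel.num R) (tableAddr R) 25 23, .const 10 1, .add 26 23 10, .const 27 2,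
    .const 28 0, .move 32 12, alloc [27, 24, 28, 25, 26, 20, 21]]

theorem loopFree_relabelCmd : (relabelCmd R).LoopFree := by
  simp [relabelCmd, blk, LoopFree, loopFree_fetch, loopFree_compCmd, loopFree_tabulate,
    loopFree_alloc]

/-- Create a union node for the nodes in the registers `30` and `31`; the new node is returned in
register `32`. -/
noncomputable def pairCmd : Cmd :=
  blk [fetch 20 30 5, fetch 21 30 6, fetch 22 31 5, fetch 23 31 6,
    fetch 24 21 0, compCmd R 24 24 20, fetch 25 21 1, fetch 26 21 2, fetch 27 21 3, fetch 28 21 4,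
    .ite 28 (.move 28 21) .skip, domCmd R 29 20,
    .move 33 12, alloc [24, 25, 26, 27, 23, 22, 28, 20],
    .const 34 0, .move 32 12, alloc [34, 30, 31, 34, 34, 29, 33]]

theorem loopFree_pairCmd : (pairCmd R).LoopFree := by
  simp [pairCmd, blk, LoopFree, loopFree_fetch, loopFree_compCmd, loopFree_domCmd,
    loopFree_alloc]

/-- The registers used by the programs creating nodes. -/
abbrev nodeRegs : List ℕ := [10, 11, 12, 20, 21, 22, 23, 24, 25, 26, 27, 28, 29, 32, 33, 34]

variable {R} {I : ℕ → ℕ}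

theorem eval_relabelCmd (C : St) : ∃ C', eval I (relabelCmd R) C = C' ∧
    (∀ r, r ∉ nodeRegs → C'.reg r = C.reg r) ∧ C'.out = C.out ∧
    C'.reg 32 = C.reg 12 ∧ C'.reg 12 = C.reg 12 + 7 ∧
    ∃ g, C'.mem = writeAt C.mem (C.reg 12)
      [2, if C.mem (C.reg 30 + 4) = 0 then C.reg 30 else C.mem (C.reg 30 + 1), 0,
        if g < Skel.num R then tableAddr R g else 0, g + 1,
        compCode R (C.mem (C.reg 30 + 5)) (C.reg 31), C.mem (C.reg 30 + 6)] ∧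
      g = if C.mem (C.reg 30 + 4) = 0 then C.reg 31
        else compCode R (C.mem (C.reg 30 + 4) - 1) (C.reg 31) := by
  refine ⟨_, rfl, ?_⟩
  by_cases h : C.mem (C.reg 30 + 4) = 0
  all_goals
    simp [relabelCmd, eval_ite, h, Function.update_apply]
    intro r
    simp +contextual

theorem eval_pairCmd (C : St) : ∃ C', eval I (pairCmd R) C = C' ∧
    (∀ r, r ∉ nodeRegs → C'.reg r = C.reg r) ∧ C'.out = C.out ∧
    C'.reg 32 = C.reg 12 + 8 ∧ C'.reg 12 = C.reg 12 + 8 + 7 ∧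
    ∃ c τ₁, c = C.mem (C.reg 30 + 6) ∧ τ₁ = C.mem (C.reg 30 + 5) ∧
    C'.mem = writeAt (writeAt C.mem (C.reg 12)
      [compCode R (C.mem c) τ₁, C.mem (c + 1), C.mem (c + 2), C.mem (c + 3),
        C.mem (C.reg 31 + 6), C.mem (C.reg 31 + 5), if C.mem (c + 4) = 0 then 0 else c, τ₁])
      (C.reg 12 + 8) [0, C.reg 30, C.reg 31, 0, 0, domCode R τ₁, C.reg 12] := by
  refine ⟨_, rfl, ?_⟩
  by_cases h : C.mem (C.mem (C.reg 30 + 6) + 4) = 0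
  all_goals
    simp [pairCmd, eval_ite, h, Function.update_apply]
    intro r
    simp +contextual

end NodePrograms

/-- The node `n'` of `D'` arises from the node `n` of `D` by a relabel. -/
structure RelabelStep {R Ω : Type*} (D D' : ECSA R Ω) (n n' : ℕ) (γ : Skel R) : Prop where
  bag : D'.bag n' = compAll (D.bag n) (γ.toAsg Ω)
  insert : ∃ (γ' : Skel R) (m : ℕ), γ'.IsRelabel ∧ ¬ (γ'.toAsg Ω).IsValuation ∧ m ∈ D.nodes ∧
    D.IsInsert D' n' (.asg (γ'.toAsg Ω)) (some m) none ∧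
    ((¬ D.IsGamma n ∧ m = n) ∨ (D.IsGamma n ∧ D.left n = some m))

/-! ### Correctness of the programs creating nodes -/

section NodeSpecs

variable {R Ω : Type*} [Fintype R] {ρ : R ≃ Fin (Fintype.card R)} {ω : Ω ↪ ℕ} {I : ℕ → ℕ}
  {D : ECSA R Ω} {C : St}

/-- In the handle only the skeleton is composed with `γ`. The cell at offset `4` is `0` unless the
node is a relabel node, and then one more than the code of its relabel; it decides whether `γ` gets
a node of its own or is fused with the relabel already there. -/
theorem relabelCmd_spec (h : Good ρ ω I C.mem (C.reg 12) D) (hn : C.reg 30 ∈ D.nodes)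
    {γ : Skel R} (hγ : C.reg 31 = γ.code) (hr : γ.IsRelabel) (hv : ¬ (γ.toAsg Ω).IsValuation)
    (hfit : AllFit (D.bag (C.reg 30)) (γ.toAsg Ω)) :
    ∃ C', eval I (relabelCmd R) C = C' ∧ (∀ r, r ∉ nodeRegs → C'.reg r = C.reg r) ∧
      ∃ D', Good ρ ω I C'.mem (C'.reg 12) D' ∧ RelabelStep D D' (C.reg 30) (C'.reg 32) γ := by
  obtain ⟨C', he, hreg, -, h32, h12, g, hmem, hg⟩ := eval_relabelCmd (R := R) (I := I) C
  refine ⟨C', he, hreg, ?_⟩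
  have hN := h.node _ hn
  obtain ⟨τ, T, hτ, hT, hrep⟩ := hN.handle
  have hrep' := hrep.comp hfit
  rw [hτ, hγ, compCode_code] at hmem
  rw [hγ] at hg
  rw [h12, h32, hmem]
  -- the label and the child of the new node
  have key : ∃ (γ' : Skel R) (m : ℕ), γ'.IsRelabel ∧ ¬ (γ'.toAsg Ω).IsValuation ∧ m ∈ D.nodes ∧
      ((¬ D.IsGamma (C.reg 30) ∧ m = C.reg 30) ∨
        (D.IsGamma (C.reg 30) ∧ D.left (C.reg 30) = some m)) ∧
      compAll (D.bag m) (γ'.toAsg Ω) = compAll (D.bag (C.reg 30)) (γ.toAsg Ω) ∧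
      AllFit (D.bag m) (γ'.toAsg Ω) ∧ g = γ'.code ∧
      (if C.mem (C.reg 30 + 4) = 0 then C.reg 30 else C.mem (C.reg 30 + 1)) = m := by
    have hl := hN.label
    have simple : C.mem (C.reg 30 + 4) = 0 → ¬ D.IsGamma (C.reg 30) → _ := fun h0 hng =>
      (⟨γ, C.reg 30, hr, hv, hn, .inl ⟨hng, rfl⟩, rfl, hfit, by rw [hg, if_pos h0],
        by rw [if_pos h0]⟩ : ∃ (γ' : Skel R) (m : ℕ), γ'.IsRelabel ∧
      ¬ (γ'.toAsg Ω).IsValuation ∧ m ∈ D.nodes ∧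
      ((¬ D.IsGamma (C.reg 30) ∧ m = C.reg 30) ∨
        (D.IsGamma (C.reg 30) ∧ D.left (C.reg 30) = some m)) ∧
      compAll (D.bag m) (γ'.toAsg Ω) = compAll (D.bag (C.reg 30)) (γ.toAsg Ω) ∧
      AllFit (D.bag m) (γ'.toAsg Ω) ∧ g = γ'.code ∧
      (if C.mem (C.reg 30 + 4) = 0 then C.reg 30 else C.mem (C.reg 30 + 1)) = m)
    cases hlab : D.label (C.reg 30) with
    | union =>
      rw [hlab] at hl
      refine simple hl.2 ?_
      rintro ⟨_, σ, hσ, _⟩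
      rw [hlab] at hσ
      exact absurd hσ (by simp)
    | asg σ =>
      rw [hlab] at hl
      rcases hl with ⟨_, _, h0, hor⟩ | ⟨_, γ₁, rfl, hγ₁, hv₁, _, h4⟩
      · refine simple h0 ?_
        rintro ⟨_, σ', hσ', h1, h2⟩
        rw [hlab] at hσ'
        cases hσ'
        exact hor.elim h2 fun h => h h1
      · have hga : D.IsGamma (C.reg 30) := ⟨hn, _, hlab, Skel.isRelabel_toAsg.2 hγ₁, hv₁⟩
        obtain ⟨m, hm⟩ := Option.ne_none_iff_exists'.1
          fun h => hv₁ ((D.asg_left _ hn _ hlab).1 h)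
        have hmD := D.left_mem _ hn m hm
        have hbag := ECSA.bag_asg hn hlab hm
        have hfit₁ : AllFit (D.bag m) (γ₁.toAsg Ω) :=
          fun ν hν => h.garbageFree _ (.inr hga) _ m hlab hm ν hν
        have hfit' : AllFit (D.bag m) ((γ₁.comp γ).toAsg Ω) := by
          rw [Skel.toAsg_comp]
          refine hfit₁.comp ?_
          rw [hbag] at hfit
          exact hfit
        -- The fused relabel sits on the child `m` of the old relabel node. It is no valuation: it
        -- uses the same registers as `γ₁`, both sets being the domain of an arbitrary element of
        -- the nonempty bag of `m`.
        refine ⟨γ₁.comp γ, m, hγ₁.comp hr, ?_, hmD, .inr ⟨hga, hm⟩, ?_, hfit', ?_, ?_⟩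
        · intro hval
          obtain ⟨ν, hν⟩ := Multiset.exists_mem_of_ne_zero (ECSA.bag_ne_zero hmD)
          rw [Asg.isValuation_iff, ← hfit' ν hν, hfit₁ ν hν, ← Asg.isValuation_iff] at hval
          exact hv₁ hval
        · rw [hbag, Skel.toAsg_comp, ← compAll_compAll]
          rfl
        · rw [hg, h4, if_neg (by omega), Nat.add_sub_cancel, compCode_code]
        · rw [h4, if_neg (by omega), hN.left, hm]
          rfl
  obtain ⟨γ', m, hr', hv', hm, hcase, hbag, hfit', rfl, hif⟩ := key
  rw [hif, if_pos γ'.code_lt]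
  obtain ⟨D', hD'⟩ := D.exists_insert_asg h.notMem hm γ'.copyless hv'
  have hb : D'.bag (C.reg 12) = compAll (D.bag (C.reg 30)) (γ.toAsg Ω) := by
    rw [hD'.bag_asg hm]
    exact hbag
  refine ⟨D', h.insert hD' rfl rfl (.inr ⟨?_, γ', rfl, hr', hv', ?_, ?_⟩) rfl hT (hb ▸ hrep') ?_,
    hb, γ', m, hr', hv', hm, hD', hcase⟩
  · exact writeAt_get (i := 0) rfl
  · exact writeAt_get rfl
  · exact writeAt_get rfl
  · rintro σ m' ⟨⟩ ⟨⟩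
    exact ⟨hm, hfit'⟩

/-- Eight cells for the union of the two trees are followed by seven cells for the node itself. The
new tree is that of `Tree.Represents.union`, read off from the record of the first tree. -/
theorem pairCmd_spec (h : Good ρ ω I C.mem (C.reg 12) D) (h₁ : C.reg 30 ∈ D.nodes)
    (h₂ : C.reg 31 ∈ D.nodes)
    (hd : ∀ ν₁ ∈ D.bag (C.reg 30), ∀ ν₂ ∈ D.bag (C.reg 31), ν₁.dom = ν₂.dom) :
    ∃ C', eval I (pairCmd R) C = C' ∧ (∀ r, r ∉ nodeRegs → C'.reg r = C.reg r) ∧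
      ∃ D', Good ρ ω I C'.mem (C'.reg 12) D' ∧
        D.IsInsert D' (C'.reg 32) .union (some (C.reg 30)) (some (C.reg 31)) := by
  obtain ⟨C', he, hreg, -, h32, h12, c, t, hc, ht, hmem⟩ := eval_pairCmd (R := R) (I := I) C
  refine ⟨C', he, hreg, ?_⟩
  obtain ⟨τ₁, T₁, hτ₁, hT₁, hrep₁⟩ := (h.node _ h₁).handle
  obtain ⟨τ₂, T₂, hτ₂, hT₂, hrep₂⟩ := (h.node _ h₂).handle
  rw [hτ₁] at ht
  rw [← hc] at hT₁
  have hrep := hrep₁.union hrep₂ (ECSA.bag_ne_zero h₁) hd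
  have hholds : (T₁.union τ₁ T₂ τ₂).Holds ρ ω I (writeAt C.mem (C.reg 12)
      [compCode R (C.mem c) t, C.mem (c + 1), C.mem (c + 2), C.mem (c + 3),
        C.mem (C.reg 31 + 6), C.mem (C.reg 31 + 5), if C.mem (c + 4) = 0 then 0 else c, t])
      (C.reg 12 + 8) (C.reg 12) := by
    cases T₁ with
    | nil => exact (hrep₁.1 rfl).elim
    | node a p σ cc child r right l left =>
      obtain ⟨e0, e1, e2, e3, e4, e5, e6, e7, e8, e9, e10⟩ := id hT₁
      rw [e2, e3, e6, ht, hτ₂, compCode_code]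
      refine Tree.holds_writeAt h.pos e4 e5 hT₂ ?_
      -- The program tests the address of the right subtree of `T₁` to see whether its list is
      -- empty.
      by_cases hr : right = .nil
      · rw [if_pos (Tree.isNil_iff.2 hr),
          if_pos (by simpa using e7.ne_zero.not.2 (not_not.2 hr))]
        rfl
      · rw [if_neg (by rwa [Tree.isNil_iff]), if_neg (e7.ne_zero.2 hr)]
        exact hT₁
  have h' := h.mono (keeps_writeAt (C.reg 12) C.mem
      [compCode R (C.mem c) t, C.mem (c + 1), C.mem (c + 2), C.mem (c + 3),
        C.mem (C.reg 31 + 6), C.mem (C.reg 31 + 5), if C.mem (c + 4) = 0 then 0 else c, t])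
      (show C.reg 12 ≤ C.reg 12 + 8 by omega)
  obtain ⟨D', hD'⟩ := D.exists_insert_union h'.notMem h₁ h₂
  rw [h12, h32, hmem]
  rw [← hD'.bag_union h₁ h₂] at hrep
  refine ⟨D', h'.insert hD' rfl rfl ⟨writeAt_get (i := 0) rfl, writeAt_get rfl⟩
    (by rw [ht]; exact domCode_code R τ₁ Ω) hholds hrep ?_, hD'⟩
  rintro σ m ⟨⟩

end NodeSpecs

/-! ### Safety of the new nodes -/

namespace ECSA

variable {R Ω : Type*} {D D' : ECSA R Ω} {n a b : ℕ} {σ : Asg R Ω}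

theorem IsNu.not_succ (h : D.IsNu n) : ¬ (D.IsUnion n ∨ D.IsGamma n) := by
  obtain ⟨_, σ, hσ, hv⟩ := h
  rintro (⟨_, h⟩ | ⟨_, σ', h, _, h'⟩)
  · rw [hσ] at h
    cases h
  · rw [hσ] at h
    cases h
    exact h' hv

theorem IsSigma.not_succ (h : D.IsSigma n) : ¬ (D.IsUnion n ∨ D.IsGamma n) := by
  obtain ⟨_, σ, hσ, hr, _⟩ := h
  rintro (⟨_, h⟩ | ⟨_, σ', h, h', _⟩)
  · rw [hσ] at h
    cases h
  · rw [hσ] at h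
    cases h
    exact hr h'

theorem IsGamma.not_isUnion (h : D.IsGamma n) : ¬ D.IsUnion n := by
  obtain ⟨_, σ, hσ, _⟩ := h
  rintro ⟨_, h⟩
  rw [hσ] at h
  cases h

theorem SafeOutput.odepth_le (h : D.SafeOutput n) : D.odepth n ≤ 1 := by
  rcases h with h | h | ⟨h, m, hm, h' | h'⟩
  · simp [odepth_zero h.not_succ]
  · simp [odepth_zero h.not_succ]
  · simp [odepth_succ (.inr h) hm, odepth_zero h'.not_succ]
  · simp [odepth_succ (.inr h) hm, odepth_zero h'.not_succ]

theorem SafeOutput.not_isUnion (h : D.SafeOutput n) : ¬ D.IsUnion n := by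
  rcases h with h | h | ⟨h, _⟩
  · exact fun hu => h.not_succ (.inl hu)
  · exact fun hu => h.not_succ (.inl hu)
  · exact h.not_isUnion

theorem SafeUnion.odepth_le (h : D.SafeUnion n) : D.odepth n ≤ 2 := by
  obtain ⟨hu, ⟨a, ha, hs⟩, _⟩ := h
  rw [odepth_succ (.inl hu) ha]
  have := hs.odepth_le
  omega

/-- The bound 3 leaves room for exactly one further relabel in a 4-bounded structure. -/
theorem Safe.odepth_le (h : D.Safe n) : D.odepth n ≤ 3 := by
  rcases h with h | h | ⟨h, m, hm, h'⟩
  · have := h.odepth_le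
    omega
  · have := h.odepth_le
    omega
  · rw [odepth_succ (.inr h) hm]
    have := h'.odepth_le
    omega

theorem Safe.safeUnion (h : D.Safe n) (hu : D.IsUnion n) : D.SafeUnion n := by
  rcases h with h | h | ⟨h, _⟩
  · exact (h.not_isUnion hu).elim
  · exact h
  · exact (h.not_isUnion hu).elim

theorem Safe.safeOutput (h : D.Safe n) (hu : ¬ D.IsUnion n)
    (hg : D.IsGamma n → ∀ m, D.left n = some m → ¬ D.IsUnion m) : D.SafeOutput n := by
  rcases h with h | h | ⟨h, m, hm, h'⟩
  · exact h
  · exact (hu h.1).elim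
  · exact (hg h m hm h'.1).elim

theorem Safe.safeUnion_left (h : D.Safe n) (hg : D.IsGamma n) {m : ℕ} (hm : D.left n = some m)
    (hu : D.IsUnion m) : D.SafeUnion m := by
  rcases h with (h | h | ⟨_, m', hm', h'⟩) | h | ⟨_, m', hm', h'⟩
  · exact (h.not_succ (.inr hg)).elim
  · exact (h.not_succ (.inr hg)).elim
  · rw [hm] at hm'
    cases hm'
    exact (h'.elim (fun h => h.not_succ (.inl hu)) fun h => h.not_succ (.inl hu)).elim
  · exact (hg.not_isUnion h.1).elim
  · rw [hm] at hm'
    cases hm'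
    exact h'

theorem IsInsert.safeUnion (h : IsInsert D D' n .union (some a) (some b)) (ha : D.SafeOutput a)
    (hb : b ∈ D.nodes) (hd : D.odepth b ≤ 2) : D'.SafeUnion n :=
  ⟨⟨h.mem, h.label⟩, ⟨a, h.left, h.sub.safeOutput ha⟩, b, h.right, by rwa [h.sub.odepth hb]⟩

theorem IsInsert.odepth_asg_eq_zero {l r : Option ℕ} (h : IsInsert D D' n (.asg σ) l r)
    (hσ : σ.IsValuation ∨ ¬ σ.IsRelabel) : D'.odepth n = 0 ∧ D'.SafeOutput n := by
  by_cases hv : σ.IsValuation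
  · have hn : D'.IsNu n := ⟨h.mem, σ, h.label, hv⟩
    exact ⟨odepth_zero hn.not_succ, .inl hn⟩
  · have hn : D'.IsSigma n := ⟨h.mem, σ, h.label, hσ.resolve_left hv, hv⟩
    exact ⟨odepth_zero hn.not_succ, .inr (.inl hn)⟩

end ECSA

namespace RelabelStep

variable {R Ω : Type*} {D D' : ECSA R Ω} {n n' : ℕ} {γ : Skel R}

theorem sub (h : RelabelStep D D' n n' γ) : D.Sub D' := by
  obtain ⟨_, _, _, _, _, h, _⟩ := h.insert
  exact h.sub

theorem mem (h : RelabelStep D D' n n' γ) : n' ∈ D'.nodes := by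
  obtain ⟨_, _, _, _, _, h, _⟩ := h.insert
  exact h.mem

theorem odepth_le (h : RelabelStep D D' n n' γ) : D'.odepth n' ≤ D.odepth n + 1 := by
  obtain ⟨γ', m, hr, hv, hm, h, hc⟩ := h.insert
  have hg : D'.IsGamma n' := ⟨h.mem, _, h.label, Skel.isRelabel_toAsg.2 hr, hv⟩
  rw [ECSA.odepth_succ (.inr hg) h.left, h.sub.odepth hm]
  rcases hc with ⟨_, rfl⟩ | ⟨hg', hl⟩
  · exact le_rfl
  · rw [ECSA.odepth_succ (.inr hg') hl]
    omega

theorem safeOutput (h : RelabelStep D D' n n' γ) (hs : D.SafeOutput n) : D'.SafeOutput n' := by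
  obtain ⟨γ', m, hr, hv, hm, h, hc⟩ := h.insert
  have hg : D'.IsGamma n' := ⟨h.mem, _, h.label, Skel.isRelabel_toAsg.2 hr, hv⟩
  refine .inr (.inr ⟨hg, m, h.left, ?_⟩)
  rw [h.sub.isNu hm, h.sub.isSigma hm]
  rcases hc with ⟨hg', rfl⟩ | ⟨hg', hl⟩
  · rcases hs with hs | hs | ⟨hs, _⟩
    · exact .inl hs
    · exact .inr hs
    · exact (hg' hs).elim
  · rcases hs with hs | hs | ⟨_, m', hm', hs⟩
    · exact (hs.not_succ (.inr hg')).elim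
    · exact (hs.not_succ (.inr hg')).elim
    · rw [hl] at hm'
      cases hm'
      exact hs

/-- Thanks to fusion a relabel node over a relabel node never arises: relabelling a relabelled safe
union-node again gives a relabel node directly over that union-node. -/
theorem safe (hst : RelabelStep D D' n n' γ) (hs : D.Safe n) : D'.Safe n' := by
  rcases hs with hs | hs | ⟨hs, m', hm', hs'⟩
  · exact .inl (hst.safeOutput hs)
  all_goals
    obtain ⟨γ', m, hr, hv, hm, h, hc⟩ := hst.insert
    have hg : D'.IsGamma n' := ⟨h.mem, _, h.label, Skel.isRelabel_toAsg.2 hr, hv⟩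
    refine .inr (.inr ⟨hg, m, h.left, h.sub.safeUnion ?_⟩)
  · rcases hc with ⟨_, rfl⟩ | ⟨hg', _⟩
    · exact hs
    · exact (hg'.not_isUnion hs.1).elim
  · rcases hc with ⟨hg', _⟩ | ⟨_, hl⟩
    · exact (hg' hs).elim
    · rw [hm'] at hl
      cases hl
      exact hs'

theorem bounded (hst : RelabelStep D D' n n' γ) (hd : D.odepth n ≤ 3) (hD : D.Bounded 4) :
    D'.Bounded 4 := by
  have := hst.odepth_le
  obtain ⟨γ', m, hr, hv, hm, h, hc⟩ := hst.insert
  exact h.bounded hD (by omega)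

end RelabelStep

/-! ### The operations -/

section Operations

variable {R : Type*} [Fintype R] (ρ : R ≃ Fin (Fintype.card R))

/-- The operation `add`. -/
noncomputable def addCmd : Cmd :=
  blk [.const 2 0, .load 12 2, .move 1 0, classify ρ,
    .move 22 12, .const 23 0, alloc [18, 1, 23, 18, 23, 18, 23, 18],
    .const 24 1, .move 32 12, alloc [24, 23, 23, 1, 23, 18, 22],
    .move 0 32, .const 2 0, .store 2 12]

theorem loopFree_addCmd : (addCmd ρ).LoopFree := by
  simp [addCmd, blk, LoopFree, loopFree_alloc, loopFree_classify]

/-- The operation `extend`. -/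
noncomputable def extendCmd : Cmd :=
  blk [.const 2 0, .load 12 2, classify ρ,
    .ite 16
      (blk [fetch 20 0 5, fetch 21 0 6, .const 10 1, .sub 16 16 10, .const 23 0,
        .ite 16
          (blk [.move 22 12, alloc [18, 1, 21, 20, 23, 18, 23, 18], .move 20 18, .move 21 22])
          (compCmd R 20 20 17),
        .const 24 1, .move 32 12, alloc [24, 0, 23, 1, 23, 20, 21]])
      (blk [.move 30 0, .move 31 17, relabelCmd R]),
    .move 0 32, .const 2 0, .store 2 12]

theorem loopFree_extendCmd : (extendCmd ρ).LoopFree := by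
  simp [extendCmd, blk, LoopFree, loopFree_alloc, loopFree_classify, loopFree_relabelCmd,
    loopFree_compCmd, loopFree_fetch]

variable {ρ} {Ω : Type*} {ω : Ω ↪ ℕ} {I : ℕ → ℕ} {D : ECSA R Ω}

/-- Memory receives a one-item tree without subtrees (eight cells) and then the node (seven cells).
All skeletons are the identity on the domain, whose code the classification delivers in register
`18`. -/
theorem addCmd_spec {s W : ℕ → ℕ} (h : Good ρ ω I W (W 0) D) {ν : Asg R Ω} (hν : ν.IsValuation)
    (hs : HoldsAsg ρ ω I (s 0) ν) : ∃ C', eval I (addCmd ρ) ⟨s, W, []⟩ = C' ∧ ∃ D',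
      Good ρ ω I C'.mem (C'.mem 0) D' ∧ D.IsInsert D' (C'.reg 0) (.asg ν) none none := by
  refine ⟨_, rfl, ?_⟩
  obtain ⟨C₁, hC₁⟩ : ∃ C₁, C₁ = eval I (classify ρ)
      ⟨Function.update (Function.update (Function.update s 2 0) 12 (W 0)) 1 (s 0), W, []⟩ :=
    ⟨_, rfl⟩
  obtain ⟨⟨hm, _, hreg⟩, h18, _⟩ := eval_classify (ρ := ρ) (ω := ω) (I := I) hν.copyless
    (C := ⟨Function.update (Function.update (Function.update s 2 0) 12 (W 0)) 1 (s 0), W, []⟩)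
    (by simpa using hs)
  rw [← hC₁] at hm hreg h18
  have h1 : C₁.reg 1 = s 0 := by simpa using hreg 1 (by simp)
  have h12 : C₁.reg 12 = W 0 := by simpa [Function.update_apply] using hreg 12 (by simp)
  have hmem : (eval I (addCmd ρ) ⟨s, W, []⟩).mem = Function.update (writeAt (writeAt W (W 0)
      [C₁.reg 18, s 0, 0, C₁.reg 18, 0, C₁.reg 18, 0, C₁.reg 18]) (W 0 + 8)
      [1, 0, 0, s 0, 0, C₁.reg 18, W 0]) 0 (W 0 + 8 + 7) := by
    simp [addCmd, ← hC₁, h1, h12, hm]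
  have h0 : (eval I (addCmd ρ) ⟨s, W, []⟩).reg 0 = W 0 + 8 := by
    simp [addCmd, ← hC₁, h1, h12, hm]
  rw [h0, hmem, Function.update_self]
  have h' := h.mono (keeps_writeAt (W 0) W
    [C₁.reg 18, s 0, 0, C₁.reg 18, 0, C₁.reg 18, 0, C₁.reg 18]) (show W 0 ≤ W 0 + 8 by omega)
  obtain ⟨D', hD'⟩ := D.exists_insert_nu h'.notMem hν
  refine ⟨D', Good.mono (f := W 0 + 8 + 7) (W := writeAt (writeAt W (W 0)
      [C₁.reg 18, s 0, 0, C₁.reg 18, 0, C₁.reg 18, 0, C₁.reg 18]) (W 0 + 8)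
      [1, 0, 0, s 0, 0, C₁.reg 18, W 0]) ?_
    -- The free pointer in cell `0` is updated last, and the invariant does not look at this cell.
    (fun a ha _ => Function.update_of_ne ha.ne' _ _) le_rfl, hD'⟩
  have hrep := Tree.represents_nu (p := s 0) hν
  rw [← hD'.bag_nu] at hrep
  refine h'.insert hD' rfl rfl (.inl ⟨writeAt_get (i := 0) rfl, ?_, writeAt_get rfl, .inl hν⟩) h18
    (T := Tree.single (s 0) ν (Skel.idOn ν.dom) .nil) ?_ hrep ?_
  · rw [writeAt_get (i := 3) rfl]
    exact hs
  · rw [h18]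
    exact Tree.holds_writeAt h.pos hs rfl rfl rfl
  · rintro σ m _ ⟨⟩

/-- Three cases: a relabel is handled by `relabelCmd`; another skeleton gives a σ-node but shares
the old tree; an assignment with letters gives a σ-node and a new item over the old tree. The new
σ-nodes have output depth 0 and are safe output-nodes. -/
theorem extendCmd_spec {s W : ℕ → ℕ} (h : Good ρ ω I W (W 0) D) (hn : s 0 ∈ D.nodes)
    {σ : Asg R Ω} (hσ : σ.Copyless) (hv : ¬ σ.IsValuation) (hs : HoldsAsg ρ ω I (s 1) σ)
    (hfit : AllFit (D.bag (s 0)) σ) :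
    ∃ C', eval I (extendCmd ρ) ⟨s, W, []⟩ = C' ∧ ∃ D',
      Good ρ ω I C'.mem (C'.mem 0) D' ∧ D.Sub D' ∧ C'.reg 0 ∈ D'.nodes ∧
      D'.bag (C'.reg 0) = compAll (D.bag (s 0)) σ ∧
      (D.Safe (s 0) → D'.Safe (C'.reg 0) ∧ (D.Bounded 4 → D'.Bounded 4)) := by
  refine ⟨_, rfl, ?_⟩
  obtain ⟨C₁, hC₁⟩ : ∃ C₁, C₁ = eval I (classify ρ)
      ⟨Function.update (Function.update s 2 0) 12 (W 0), W, []⟩ := ⟨_, rfl⟩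
  obtain ⟨⟨hm, _, hreg⟩, h18, hkind⟩ := eval_classify (ρ := ρ) (ω := ω) (I := I) hσ
    (C := ⟨Function.update (Function.update s 2 0) 12 (W 0), W, []⟩)
    (by simpa [Function.update_apply] using hs)
  rw [← hC₁] at hm hreg h18 hkind
  simp only at hm
  have h0 : C₁.reg 0 = s 0 := by simpa [Function.update_apply] using hreg 0 (by simp)
  have h1 : C₁.reg 1 = s 1 := by simpa [Function.update_apply] using hreg 1 (by simp)
  have h12 : C₁.reg 12 = W 0 := by simpa [Function.update_apply] using hreg 12 (by simp)
  obtain ⟨τ, T, hτ, hT, hrep⟩ := (h.node _ hn).handle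
  -- the common part of the two cases without a relabel
  have hins : ∀ W' f' t q, Good ρ ω I W' f' D → ∀ (τ' : Skel R) (T' : Tree R Ω), t = τ'.code →
      T'.Holds ρ ω I W' f' q → T'.Represents τ' (compAll (D.bag (s 0)) σ) → ¬ σ.IsRelabel →
      (eval I (extendCmd ρ) ⟨s, W, []⟩).mem =
        Function.update (writeAt W' f' [1, s 0, 0, s 1, 0, t, q]) 0 (f' + 7) →
      (eval I (extendCmd ρ) ⟨s, W, []⟩).reg 0 = f' → ∃ D',
      Good ρ ω I (eval I (extendCmd ρ) ⟨s, W, []⟩).mem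
        ((eval I (extendCmd ρ) ⟨s, W, []⟩).mem 0) D' ∧ D.Sub D' ∧
      (eval I (extendCmd ρ) ⟨s, W, []⟩).reg 0 ∈ D'.nodes ∧
      D'.bag ((eval I (extendCmd ρ) ⟨s, W, []⟩).reg 0) = compAll (D.bag (s 0)) σ ∧
      (D.Safe (s 0) → D'.Safe ((eval I (extendCmd ρ) ⟨s, W, []⟩).reg 0) ∧
        (D.Bounded 4 → D'.Bounded 4)) := by
    intro W' f' t q hW' τ' T' ht hT' hrep' hr hmem hreg0
    obtain ⟨D', hD'⟩ := D.exists_insert_asg hW'.notMem hn hσ hv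
    have hbag : D'.bag f' = compAll (D.bag (s 0)) σ := hD'.bag_asg hn
    obtain ⟨hod, hso⟩ := hD'.odepth_asg_eq_zero (.inr hr)
    rw [hreg0, hmem, Function.update_self]
    refine ⟨D', Good.mono (f := f' + 7) (W := writeAt W' f' [1, s 0, 0, s 1, 0, t, q]) ?_
      (fun a ha _ => Function.update_of_ne ha.ne' _ _) le_rfl, hD'.sub, hD'.mem, hbag,
      fun _ => ⟨.inl hso, fun hb => hD'.bounded hb (by omega)⟩⟩
    refine hW'.insert hD' rfl rfl (.inl ⟨writeAt_get (i := 0) rfl, ?_, writeAt_get rfl, .inr hr⟩) ht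
      hT' (hbag ▸ hrep') ?_
    · rw [writeAt_get (i := 3) rfl]
      exact hs
    · rintro _ _ ⟨⟩ ⟨⟩
      exact ⟨hn, hfit⟩
  rcases hkind with ⟨h16, γ, rfl, hγ, h17⟩ | ⟨h16, γ, rfl, hγ, h17⟩ | ⟨h16, hlet⟩
  · obtain ⟨C', he, -, D', hD', hst⟩ := relabelCmd_spec (ρ := ρ) (ω := ω) (I := I) (D := D)
      (C := ⟨Function.update (Function.update C₁.reg 30 (C₁.reg 0)) 31 (C₁.reg 17), C₁.mem, C₁.out⟩)
      (by simpa [Function.update_apply, h12, hm] using h)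
      (by simpa [Function.update_apply, h0] using hn) (γ := γ) (by simpa using h17) hγ hv
      (by simpa [Function.update_apply, h0] using hfit)
    have hn' : (Function.update (Function.update C₁.reg 30 (C₁.reg 0)) 31 (C₁.reg 17)) 30 = s 0 := by
      simp [h0]
    simp only [hn'] at hst
    have hmem : (eval I (extendCmd ρ) ⟨s, W, []⟩).mem =
        Function.update C'.mem 0 (C'.reg 12) := by
      simp [extendCmd, eval_ite, ← hC₁, h16, he]
    have hreg0 : (eval I (extendCmd ρ) ⟨s, W, []⟩).reg 0 = C'.reg 32 := by
      simp [extendCmd, eval_ite, ← hC₁, h16, he]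
    rw [hreg0, hmem, Function.update_self]
    exact ⟨D', hD'.mono (fun a ha _ => Function.update_of_ne ha.ne' _ _) le_rfl, hst.sub, hst.mem,
      hst.bag, fun hsafe => ⟨hst.safe hsafe, hst.bounded hsafe.odepth_le⟩⟩
  -- A skeleton that is not a relabel: no tree record is allocated, and the skeleton of the handle
  -- is composed with `γ`.
  · refine hins W (W 0) _ _ h (τ.comp γ) T rfl hT (hrep.comp hfit)
      (Skel.isRelabel_toAsg.not.2 hγ) ?_ ?_
    · simp [extendCmd, eval_ite, ← hC₁, h16, hm, h0, h1, h12, h17, hτ]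
    · simp [extendCmd, eval_ite, ← hC₁, h16, hm, h0, h1, h12, h17, hτ]
  -- An assignment with a letter: the eight cells hold the item with the old tree as its child.
  · have h' := h.mono (keeps_writeAt (W 0) W
      [C₁.reg 18, s 1, W (s 0 + 6), W (s 0 + 5), 0, C₁.reg 18, 0, C₁.reg 18])
      (show W 0 ≤ W 0 + 8 by omega)
    refine hins _ (W 0 + 8) (C₁.reg 18) (W 0) h' (Skel.idOn σ.dom) (Tree.single (s 1) σ τ T) h18
      ?_ (hrep.extend hσ hlet hfit) ?_ ?_ ?_
    · rw [h18, hτ]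
      exact Tree.holds_writeAt h.pos hs hT rfl rfl
    -- A relabel has no letters, so this node is indeed a σ-node.
    · intro hr
      obtain ⟨X, w, a, hX, ha⟩ := hlet
      obtain ⟨Y, rfl⟩ := hr X w hX
      simp at ha
    · simp [extendCmd, eval_ite, ← hC₁, h16, hm, h0, h1, h12]
    · simp [extendCmd, eval_ite, ← hC₁, h16, hm, h0, h1, h12]

end Operations

/-! ### The operation union: splitting the arguments -/

section Union

variable (R : Type*) [Fintype R]

/-- A union node for the nodes in the registers `x` and `y`. -/
noncomputable def pairOn (x y : ℕ) : Cmd := blk [.move 30 x, .move 31 y, pairCmd R]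

theorem loopFree_pairOn (x y : ℕ) : (pairOn R x y).LoopFree :=
  ⟨trivial, trivial, loopFree_pairCmd R, trivial⟩

/-- The relabel of the node in register `x` by the skeleton in register `y`. -/
noncomputable def relabelOn (x y : ℕ) : Cmd := blk [.move 30 x, .move 31 y, relabelCmd R]

theorem loopFree_relabelOn (x y : ℕ) : (relabelOn R x y).LoopFree :=
  ⟨trivial, trivial, loopFree_relabelCmd R, trivial⟩

/-- If the node in register `44` is a union node or a relabel node over a union node, then set
register `35` to one and put nodes for the two parts of the union into the registers `36` and `37`;
else set register `35` to zero. -/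
noncomputable def splitCmd : Cmd :=
  blk [.load 38 44,
    .ite 38
      (blk [fetch 39 44 4,
        .ite 39
          (blk [fetch 40 44 1, .load 41 40,
            .ite 41 (.const 35 0)
              (blk [.const 10 1, .sub 42 39 10, fetch 43 40 1, fetch 38 40 2,
                relabelOn R 43 42, .move 36 32, relabelOn R 38 42, .move 37 32, .const 35 1])])
          (.const 35 0)])
      (blk [fetch 36 44 1, fetch 37 44 2, .const 35 1])]

theorem loopFree_splitCmd : (splitCmd R).LoopFree := by
  simp [splitCmd, blk, LoopFree, loopFree_fetch, loopFree_relabelOn]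

/-- The operation `union`. -/
noncomputable def unionCmd : Cmd :=
  blk [.const 2 0, .load 12 2, .move 44 0, splitCmd R,
    .move 45 35, .move 46 36, .move 47 37, .move 44 1, splitCmd R,
    .ite 45
      (.ite 35
        (blk [pairOn R 47 37, pairOn R 36 32, pairOn R 46 32])
        (blk [pairOn R 46 47, pairOn R 1 32]))
      (.ite 35
        (blk [pairOn R 36 37, pairOn R 0 32])
        (pairOn R 0 1)),
    .move 0 32, .const 2 0, .store 2 12]

theorem loopFree_unionCmd : (unionCmd R).LoopFree := by
  simp [unionCmd, blk, LoopFree, loopFree_splitCmd, loopFree_pairOn]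

variable {R} {Ω : Type*} {ρ : R ≃ Fin (Fintype.card R)} {ω : Ω ↪ ℕ} {I : ℕ → ℕ}
  {D : ECSA R Ω} {C : St}

/-- The registers used by `pairOn` and `relabelOn`. -/
abbrev onRegs : List ℕ := 30 :: 31 :: nodeRegs

theorem pairOn_spec {x y : ℕ} (hy : y ≠ 30) (h : Good ρ ω I C.mem (C.reg 12) D)
    (h₁ : C.reg x ∈ D.nodes) (h₂ : C.reg y ∈ D.nodes)
    (hd : ∀ ν₁ ∈ D.bag (C.reg x), ∀ ν₂ ∈ D.bag (C.reg y), ν₁.dom = ν₂.dom) :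
    ∃ C', eval I (pairOn R x y) C = C' ∧ (∀ r, r ∉ onRegs → C'.reg r = C.reg r) ∧
      ∃ D', Good ρ ω I C'.mem (C'.reg 12) D' ∧
        D.IsInsert D' (C'.reg 32) .union (some (C.reg x)) (some (C.reg y)) := by
  obtain ⟨C', he, hreg, hex⟩ := pairCmd_spec (ρ := ρ) (ω := ω) (I := I) (D := D)
    (C := ⟨Function.update (Function.update C.reg 30 (C.reg x)) 31 (C.reg y), C.mem, C.out⟩)
    (by simpa using h) (by simpa using h₁) (by simpa using h₂) (by simpa using hd)
  refine ⟨C', ?_, fun r hr => ?_, by simpa using hex⟩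
  · simp [pairOn, hy, he]
  · simp only [onRegs, List.mem_cons, not_or] at hr
    rw [hreg r (by simpa using hr.2.2)]
    simp [hr.1, hr.2.1]

theorem relabelOn_spec {x y : ℕ} (hy : y ≠ 30) (h : Good ρ ω I C.mem (C.reg 12) D)
    (hn : C.reg x ∈ D.nodes) {γ : Skel R} (hγ : C.reg y = γ.code) (hr : γ.IsRelabel)
    (hv : ¬ (γ.toAsg Ω).IsValuation) (hfit : AllFit (D.bag (C.reg x)) (γ.toAsg Ω)) :
    ∃ C', eval I (relabelOn R x y) C = C' ∧ (∀ r, r ∉ onRegs → C'.reg r = C.reg r) ∧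
      ∃ D', Good ρ ω I C'.mem (C'.reg 12) D' ∧ RelabelStep D D' (C.reg x) (C'.reg 32) γ := by
  obtain ⟨C', he, hreg, hex⟩ := relabelCmd_spec (ρ := ρ) (ω := ω) (I := I) (D := D)
    (C := ⟨Function.update (Function.update C.reg 30 (C.reg x)) 31 (C.reg y), C.mem, C.out⟩)
    (by simpa using h) (by simpa using hn) (by simpa using hγ) hr hv (by simpa using hfit)
  refine ⟨C', ?_, fun r hr => ?_, by simpa using hex⟩
  · simp [relabelOn, hy, he]
  · simp only [onRegs, List.mem_cons, not_or] at hr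
    rw [hreg r (by simpa using hr.2.2)]
    simp [hr.1, hr.2.1]

/-- The kind of a node can be read off from the memory. -/
theorem Good.isUnion_iff {W : ℕ → ℕ} {f n : ℕ} (h : Good ρ ω I W f D) (hn : n ∈ D.nodes) :
    W n = 0 ↔ D.IsUnion n := by
  have hl := (h.node n hn).label
  cases hlab : D.label n with
  | union =>
    rw [hlab] at hl
    exact ⟨fun _ => ⟨hn, hlab⟩, fun _ => hl.1⟩
  | asg σ =>
    rw [hlab] at hl
    constructor
    · intro h0
      rcases hl with ⟨h1, _⟩ | ⟨h1, _⟩ <;> omega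
    · rintro ⟨_, h⟩
      rw [hlab] at h
      cases h

theorem Good.isGamma_iff {W : ℕ → ℕ} {f n : ℕ} (h : Good ρ ω I W f D) (hn : n ∈ D.nodes) :
    W (n + 4) ≠ 0 ↔ D.IsGamma n := by
  have hl := (h.node n hn).label
  cases hlab : D.label n with
  | union =>
    rw [hlab] at hl
    refine ⟨fun h => (h hl.2).elim, ?_⟩
    rintro ⟨_, σ, h, _⟩
    rw [hlab] at h
    cases h
  | asg σ =>
    rw [hlab] at hl
    rcases hl with ⟨_, _, h0, hor⟩ | ⟨_, γ, rfl, hγ, hv, _, h4⟩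
    · refine ⟨fun h => (h h0).elim, ?_⟩
      rintro ⟨_, σ', h, hr, hv⟩
      rw [hlab] at h
      cases h
      exact (hor.elim hv fun h => h hr).elim
    · exact ⟨fun _ => ⟨hn, _, hlab, Skel.isRelabel_toAsg.2 hγ, hv⟩, fun _ => by omega⟩

/-- The registers used by `splitCmd`. -/
abbrev splitRegs : List ℕ := 35 :: 36 :: 37 :: 38 :: 39 :: 40 :: 41 :: 42 :: 43 :: onRegs

/-- A safe node that has no union at the top or directly under its relabel is a safe output-node and
stays whole. Otherwise its two parts are the children of the union, after distributing the relabel,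
if there is one, over them. -/
theorem splitCmd_spec (h : Good ρ ω I C.mem (C.reg 12) D) (hn : C.reg 44 ∈ D.nodes) :
    ∃ C', eval I (splitCmd R) C = C' ∧ (∀ r, r ∉ splitRegs → C'.reg r = C.reg r) ∧
      ∃ D', Good ρ ω I C'.mem (C'.reg 12) D' ∧ D.Sub D' ∧
        ((C'.reg 35 = 0 ∧ D' = D ∧ (D.Safe (C.reg 44) → D.SafeOutput (C.reg 44))) ∨
        (C'.reg 35 = 1 ∧ C'.reg 36 ∈ D'.nodes ∧ C'.reg 37 ∈ D'.nodes ∧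
          D'.bag (C'.reg 36) + D'.bag (C'.reg 37) = D.bag (C.reg 44) ∧
          (D.Safe (C.reg 44) → D'.SafeOutput (C'.reg 36) ∧ D'.odepth (C'.reg 37) ≤ 3 ∧
            (D.Bounded 4 → D'.Bounded 4)))) := by
  refine ⟨_, rfl, ?_⟩
  have hN := h.node _ hn
  by_cases hu : D.IsUnion (C.reg 44)
  · have h0 := (h.isUnion_iff hn).2 hu
    obtain ⟨a, ha⟩ := Option.ne_none_iff_exists'.1 (D.union_children _ hn hu.2).1
    obtain ⟨b, hb⟩ := Option.ne_none_iff_exists'.1 (D.union_children _ hn hu.2).2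
    have ea : C.mem (C.reg 44 + 1) = a := by rw [hN.left, ha]; rfl
    have eb : C.mem (C.reg 44 + 2) = b := by rw [hN.right, hb]; rfl
    constructor
    · intro r hr
      simp only [splitRegs, onRegs, nodeRegs, List.mem_cons, List.not_mem_nil, or_false,
        not_or] at hr
      simp [splitCmd, eval_ite, h0, hr]
    · refine ⟨D, ?_, ECSA.Sub.refl D, .inr ⟨?_, ?_, ?_, ?_, ?_⟩⟩
      · simpa [splitCmd, eval_ite, h0, Function.update_apply] using h
      · simp [splitCmd, eval_ite, h0]
      · simpa [splitCmd, eval_ite, h0, Function.update_apply, ea] using D.left_mem _ hn a ha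
      · simpa [splitCmd, eval_ite, h0, Function.update_apply, eb] using D.right_mem _ hn b hb
      · simp [splitCmd, eval_ite, h0, ea, eb, ECSA.bag_union hn hu.2 ha hb]
      · intro hs
        obtain ⟨_, ⟨a', ha', hsa⟩, b', hb', hsb⟩ := hs.safeUnion hu
        rw [ha] at ha'
        rw [hb] at hb'
        cases ha'
        cases hb'
        simpa [splitCmd, eval_ite, h0, Function.update_apply, ea, eb, hsa] using by omega
  · have h0 := (h.isUnion_iff hn).not.2 hu
    by_cases hg : D.IsGamma (C.reg 44)
    · have h4 := (h.isGamma_iff hn).2 hg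
      obtain ⟨_, σ, hlab, hrel, hval⟩ := id hg
      obtain ⟨m, hm⟩ := Option.ne_none_iff_exists'.1
        fun h => hval ((D.asg_left _ hn _ hlab).1 h)
      have hmD := D.left_mem _ hn m hm
      have em : C.mem (C.reg 44 + 1) = m := by rw [hN.left, hm]; rfl
      by_cases hmu : D.IsUnion m
      · have hm0 := (h.isUnion_iff hmD).2 hmu
        have hM := h.node _ hmD
        obtain ⟨a, ha⟩ := Option.ne_none_iff_exists'.1 (D.union_children _ hmD hmu.2).1
        obtain ⟨b, hb⟩ := Option.ne_none_iff_exists'.1 (D.union_children _ hmD hmu.2).2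
        have haD := D.left_mem _ hmD a ha
        have hbD := D.right_mem _ hmD b hb
        have ea : C.mem (m + 1) = a := by rw [hM.left, ha]; rfl
        have eb : C.mem (m + 2) = b := by rw [hM.right, hb]; rfl
        obtain ⟨γ, rfl, hγ, hγ4⟩ : ∃ γ : Skel R, σ = γ.toAsg Ω ∧ γ.IsRelabel ∧
            C.mem (C.reg 44 + 4) = γ.code + 1 := by
          have hl := hN.label
          rw [hlab] at hl
          rcases hl with ⟨_, _, h0, _⟩ | ⟨_, γ, hσ, hγ, _, _, h4⟩
          · exact (h4 h0).elim
          · exact ⟨γ, hσ, hγ, h4⟩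
        have hfit : AllFit (D.bag m) (γ.toAsg Ω) :=
          fun ν hν => h.garbageFree _ (.inr hg) _ m hlab hm ν hν
        have hbm := ECSA.bag_union hmD hmu.2 ha hb
        rw [hbm, allFit_add] at hfit
        -- the state before the two relabels
        obtain ⟨C₁, hC₁, hr₁, h12, hm₁, h43, h38, h42⟩ : ∃ C₁ : St, eval I (splitCmd R) C =
            eval I (blk [relabelOn R 43 42, .move 36 32, relabelOn R 38 42, .move 37 32,
              .const 35 1]) C₁ ∧ (∀ r, r ∉ splitRegs → C₁.reg r = C.reg r) ∧
            C₁.reg 12 = C.reg 12 ∧ C₁.mem = C.mem ∧ C₁.reg 43 = a ∧ C₁.reg 38 = b ∧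
            C₁.reg 42 = γ.code := by
          -- The intermediate state is left open; executing the program symbolically determines it.
          apply Exists.intro
          apply And.intro
          · simp only [splitCmd, eval_blk_cons, eval_blk_nil, eval_load]
            rw [eval_ite_pos (by simpa using h0)]
            simp only [eval_blk_cons, eval_blk_nil, eval_fetch _ _ _ (by decide : (44 : ℕ) ≠ 11)]
            rw [eval_ite_pos (by simp [hγ4])]
            simp only [eval_blk_cons, eval_blk_nil, eval_fetch _ _ _ (by decide : (44 : ℕ) ≠ 11),
              eval_load]
            rw [eval_ite_neg (by simp [em, hm0])]
            simp only [eval_const, eval_sub, eval_blk_cons, eval_blk_nil,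
              eval_fetch _ _ _ (by decide : (40 : ℕ) ≠ 11)]
            rfl
          · simp [em, ea, eb, hγ4]
            intro r
            simp +contextual
        obtain ⟨C₂, he₂, hreg₂, D₂, hD₂, hst₂⟩ := relabelOn_spec (C := C₁) (x := 43) (y := 42)
          (by decide) (by rwa [hm₁, h12]) (by rwa [h43]) h42 hγ hval (by rw [h43]; exact hfit.1)
        have hbD₂ := hst₂.sub.nodes hbD
        obtain ⟨C₃, he₃, hreg₃, D₃, hD₃, hst₃⟩ := relabelOn_spec (D := D₂)
          (C := ⟨Function.update C₂.reg 36 (C₂.reg 32), C₂.mem, C₂.out⟩) (x := 38) (y := 42)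
          (by decide) (by simpa using hD₂)
          (by simpa [hreg₂ 38 (by simp), h38] using hbD₂) (γ := γ)
          (by simpa [hreg₂ 42 (by simp)] using h42) hγ hval
          (by simpa [hreg₂ 38 (by simp), h38, hst₂.sub.bag hbD] using hfit.2)
        have h36 : C₃.reg 36 = C₂.reg 32 := by simpa using hreg₃ 36 (by simp)
        have hb' : (Function.update C₂.reg 36 (C₂.reg 32)) 38 = b := by
          simp [hreg₂ 38 (by simp), h38]
        simp only [hb'] at hst₃
        rw [h43] at hst₂
        have hfinal : eval I (splitCmd R) C = ⟨Function.update (Function.update C₃.reg 37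
            (C₃.reg 32)) 35 1, C₃.mem, C₃.out⟩ := by
          rw [hC₁]
          simp [he₂, he₃]
        rw [hfinal]
        constructor
        · intro r hr
          have hr' := hr
          simp only [splitRegs, onRegs, nodeRegs, List.mem_cons, List.not_mem_nil, or_false,
            not_or] at hr'
          have hron : r ∉ onRegs := fun h => hr (by simp at h ⊢; tauto)
          rw [← hr₁ r hr, ← hreg₂ r hron]
          simp only [Function.update_apply, hr', if_false]
          rw [hreg₃ r hron]
          simp [hr']
        · refine ⟨D₃, by simpa using hD₃, hst₂.sub.trans hst₃.sub, .inr ⟨by simp, ?_, ?_, ?_, ?_⟩⟩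
          · simpa [h36] using hst₃.sub.nodes hst₂.mem
          · simpa using hst₃.mem
          · have e1 := hst₃.bag
            rw [hst₂.sub.bag hbD] at e1
            have e2 := hst₂.bag
            rw [← hst₃.sub.bag hst₂.mem] at e2
            have e3 := ECSA.bag_asg hn hlab hm
            simp only [ne_eq, Nat.reduceEqDiff, not_false_eq_true, Function.update_of_ne,
              Function.update_self, h36, e1, e2]
            rw [e3, hbm, ← compAll_add]
            rfl
          -- The relabelled left part remains a safe output-node. The right part had depth at most
          -- 2, and the relabel adds at most 1.
          · intro hs
            obtain ⟨_, ⟨a', ha', hsa⟩, b', hb', hsb⟩ := hs.safeUnion_left hg hm hmu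
            rw [ha] at ha'
            rw [hb] at hb'
            cases ha'
            cases hb'
            have d1 := hst₃.odepth_le
            rw [hst₂.sub.odepth hbD] at d1
            have d2 := hsa.odepth_le
            simp only [ne_eq, Nat.reduceEqDiff, not_false_eq_true, Function.update_of_ne,
              Function.update_self, h36]
            exact ⟨hst₃.sub.safeOutput (hst₂.safeOutput hsa), by omega,
              fun hB => hst₃.bounded (by rw [hst₂.sub.odepth hbD]; omega)
                (hst₂.bounded (by omega) hB)⟩
      · have hm0 := (h.isUnion_iff hmD).not.2 hmu
        constructor
        · intro r hr
          simp only [splitRegs, onRegs, nodeRegs, List.mem_cons, List.not_mem_nil, or_false,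
            not_or] at hr
          simp [splitCmd, eval_ite, h0, h4, em, hm0, hr]
        · refine ⟨D, ?_, ECSA.Sub.refl D, .inl ⟨?_, rfl, fun hs => hs.safeOutput hu ?_⟩⟩
          · simpa [splitCmd, eval_ite, h0, h4, em, hm0, Function.update_apply] using h
          · simp [splitCmd, eval_ite, h0, h4, em, hm0]
          · intro _ m' hm' hu'
            rw [hm] at hm'
            cases hm'
            exact hmu hu'
    · have h4 : C.mem (C.reg 44 + 4) = 0 := not_not.1 ((h.isGamma_iff hn).not.2 hg)
      constructor
      · intro r hr
        simp only [splitRegs, onRegs, nodeRegs, List.mem_cons, List.not_mem_nil, or_false,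
          not_or] at hr
        simp [splitCmd, eval_ite, h0, h4, hr]
      · refine ⟨D, ?_, ECSA.Sub.refl D, .inl ⟨?_, rfl, fun hs => hs.safeOutput hu
          fun hg' => (hg hg').elim⟩⟩
        · simpa [splitCmd, eval_ite, h0, h4, Function.update_apply] using h
        · simp [splitCmd, eval_ite, h0, h4]

end Union

/-! ### The operation union: joining the parts -/

section Union

variable {R Ω : Type*} [Fintype R] {ρ : R ≃ Fin (Fintype.card R)} {ω : Ω ↪ ℕ} {I : ℕ → ℕ}
  {D : ECSA R Ω}

/-- Combining the parts of the two arguments of a union. The flag in register `45` tells whether the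
first node (in register `0`) was split into the nodes in `46` and `47`; the flag in register `35`
whether the second node (in register `1`) was split into those in `36` and `37`. -/
theorem combine_spec {D₀ : ECSA R Ω} {C : St} (h : Good ρ ω I C.mem (C.reg 12) D)
    (hsub : D₀.Sub D) (h₁ : C.reg 0 ∈ D₀.nodes) (h₂ : C.reg 1 ∈ D₀.nodes) {S : Set R}
    (hS₁ : ∀ ν ∈ D.bag (C.reg 0), ν.dom = S) (hS₂ : ∀ ν ∈ D.bag (C.reg 1), ν.dom = S)
    (hsafe₁ : (C.reg 45 = 0 ∧ (D₀.Safe (C.reg 0) → D.SafeOutput (C.reg 0))) ∨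
      (C.reg 45 = 1 ∧ C.reg 46 ∈ D.nodes ∧ C.reg 47 ∈ D.nodes ∧
        D.bag (C.reg 46) + D.bag (C.reg 47) = D.bag (C.reg 0) ∧
        (D₀.Safe (C.reg 0) → D.SafeOutput (C.reg 46) ∧ D.odepth (C.reg 47) ≤ 3)))
    (hsafe₂ : (C.reg 35 = 0 ∧ (D₀.Safe (C.reg 1) → D.SafeOutput (C.reg 1))) ∨
      (C.reg 35 = 1 ∧ C.reg 36 ∈ D.nodes ∧ C.reg 37 ∈ D.nodes ∧
        D.bag (C.reg 36) + D.bag (C.reg 37) = D.bag (C.reg 1) ∧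
        (D₀.Safe (C.reg 1) → D.SafeOutput (C.reg 36) ∧ D.odepth (C.reg 37) ≤ 3))) :
    ∃ C', eval I (.ite 45
      (.ite 35
        (blk [pairOn R 47 37, pairOn R 36 32, pairOn R 46 32])
        (blk [pairOn R 46 47, pairOn R 1 32]))
      (.ite 35
        (blk [pairOn R 36 37, pairOn R 0 32])
        (pairOn R 0 1))) C = C' ∧ ∃ D', Good ρ ω I C'.mem (C'.reg 12) D' ∧ D.Sub D' ∧
      C'.reg 32 ∈ D'.nodes ∧ D'.bag (C'.reg 32) = D.bag (C.reg 0) + D.bag (C.reg 1) ∧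
      (D₀.Safe (C.reg 0) → D₀.Safe (C.reg 1) → D'.SafeUnion (C'.reg 32) ∧
        (D.Bounded 4 → D'.Bounded 4)) := by
  have k₁ := hsub.nodes h₁
  have k₂ := hsub.nodes h₂
  have hdom : ∀ {M N : Multiset (Asg R Ω)}, (∀ ν ∈ M, ν.dom = S) → (∀ ν ∈ N, ν.dom = S) →
      ∀ ν₁ ∈ M, ∀ ν₂ ∈ N, ν₁.dom = ν₂.dom :=
    fun hM hN ν₁ h₁ ν₂ h₂ => (hM ν₁ h₁).trans (hN ν₂ h₂).symm
  have hadd : ∀ {M N : Multiset (Asg R Ω)}, (∀ ν ∈ M + N, ν.dom = S) ↔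
      (∀ ν ∈ M, ν.dom = S) ∧ (∀ ν ∈ N, ν.dom = S) := by
    intro M N
    simp only [Multiset.mem_add]
    exact ⟨fun h => ⟨fun ν hν => h ν (.inl hν), fun ν hν => h ν (.inr hν)⟩,
      fun h ν hν => hν.elim (h.1 ν) (h.2 ν)⟩
  rcases hsafe₁ with ⟨f₁, hsafe₁⟩ | ⟨f₁, a₁, b₁, hb₁, hsafe₁⟩ <;>
    rcases hsafe₂ with ⟨f₂, hsafe₂⟩ | ⟨f₂, a₂, b₂, hb₂, hsafe₂⟩
  · rw [eval_ite_neg f₁, eval_ite_neg f₂]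
    obtain ⟨C', he, -, D', hD', hi⟩ := pairOn_spec (x := 0) (y := 1) (by decide) h k₁ k₂
      (hdom hS₁ hS₂)
    refine ⟨C', he, D', hD', hi.sub, hi.mem, hi.bag_union k₁ k₂, fun s₁ s₂ => ?_⟩
    have d₁ := (hsafe₁ s₁).odepth_le
    have d₂ := (hsafe₂ s₂).odepth_le
    exact ⟨hi.safeUnion (hsafe₁ s₁) k₂ (by omega),
      fun hB => hi.bounded hB (by rw [hi.odepth_union k₁]; omega)⟩
  · rw [eval_ite_neg f₁, eval_ite_pos (by omega)]
    rw [← hb₂, hadd] at hS₂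
    obtain ⟨C₁, he₁, hr₁, D₁, hD₁, hi₁⟩ := pairOn_spec (x := 36) (y := 37) (by decide) h a₂ b₂
      (hdom hS₂.1 hS₂.2)
    have e0 : C₁.reg 0 = C.reg 0 := hr₁ 0 (by simp)
    have hbag₁ := hi₁.bag_union a₂ b₂
    obtain ⟨C', he, -, D', hD', hi⟩ := pairOn_spec (D := D₁) (x := 0) (y := 32) (by decide) hD₁
      (by rw [e0]; exact hi₁.sub.nodes k₁) hi₁.mem
      (hdom (by rwa [e0, hi₁.sub.bag k₁]) (by rw [hbag₁, hadd]; exact hS₂))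
    rw [e0] at hi
    refine ⟨C', by simp [he₁, he], D', hD', hi₁.sub.trans hi.sub, hi.mem, ?_, fun s₁ s₂ => ?_⟩
    · rw [hi.bag_union (hi₁.sub.nodes k₁) hi₁.mem, hi₁.sub.bag k₁, hbag₁, hb₂]
    · have d₁ := (hsafe₁ s₁).odepth_le
      have d₂ := (hsafe₂ s₂).1.odepth_le
      have d₃ := hi₁.odepth_union a₂
      exact ⟨hi.safeUnion (hi₁.sub.safeOutput (hsafe₁ s₁)) hi₁.mem (by omega),
        fun hB => hi.bounded (hi₁.bounded hB (by omega))
          (by rw [hi.odepth_union (hi₁.sub.nodes k₁), hi₁.sub.odepth k₁]; omega)⟩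
  -- Only the first node is split. The second one, a safe output-node, becomes the left child of the
  -- result, so the summands change places.
  · rw [eval_ite_pos (by omega), eval_ite_neg f₂]
    rw [← hb₁, hadd] at hS₁
    obtain ⟨C₁, he₁, hr₁, D₁, hD₁, hi₁⟩ := pairOn_spec (x := 46) (y := 47) (by decide) h a₁ b₁
      (hdom hS₁.1 hS₁.2)
    have e0 : C₁.reg 1 = C.reg 1 := hr₁ 1 (by simp)
    have hbag₁ := hi₁.bag_union a₁ b₁
    obtain ⟨C', he, -, D', hD', hi⟩ := pairOn_spec (D := D₁) (x := 1) (y := 32) (by decide) hD₁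
      (by rw [e0]; exact hi₁.sub.nodes k₂) hi₁.mem
      (hdom (by rwa [e0, hi₁.sub.bag k₂]) (by rw [hbag₁, hadd]; exact hS₁))
    rw [e0] at hi
    refine ⟨C', by simp [he₁, he], D', hD', hi₁.sub.trans hi.sub, hi.mem, ?_, fun s₁ s₂ => ?_⟩
    · rw [hi.bag_union (hi₁.sub.nodes k₂) hi₁.mem, hi₁.sub.bag k₂, hbag₁, hb₁, add_comm]
    · have d₁ := (hsafe₂ s₂).odepth_le
      have d₂ := (hsafe₁ s₁).1.odepth_le
      have d₃ := hi₁.odepth_union a₁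
      exact ⟨hi.safeUnion (hi₁.sub.safeOutput (hsafe₂ s₂)) hi₁.mem (by omega),
        fun hB => hi.bounded (hi₁.bounded hB (by omega))
          (by rw [hi.odepth_union (hi₁.sub.nodes k₂), hi₁.sub.odepth k₂]; omega)⟩
  -- Both nodes are split. The two rests of depth at most 3 are joined first, giving depth at most
  -- 4; as the output depth follows left children, the unions with the safe output-nodes `36` and
  -- `46` on the left have depth at most 2 again.
  · rw [eval_ite_pos (by omega), eval_ite_pos (by omega)]
    rw [← hb₁, hadd] at hS₁
    rw [← hb₂, hadd] at hS₂
    obtain ⟨C₁, he₁, hr₁, D₁, hD₁, hi₁⟩ := pairOn_spec (x := 47) (y := 37) (by decide) h b₁ b₂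
      (hdom hS₁.2 hS₂.2)
    have e36 : C₁.reg 36 = C.reg 36 := hr₁ 36 (by simp)
    have e46 : C₁.reg 46 = C.reg 46 := hr₁ 46 (by simp)
    have hbag₁ := hi₁.bag_union b₁ b₂
    have hS₃ : ∀ ν ∈ D₁.bag (C₁.reg 32), ν.dom = S := by
      rw [hbag₁, hadd]
      exact ⟨hS₁.2, hS₂.2⟩
    have a₂' := hi₁.sub.nodes a₂
    obtain ⟨C₂, he₂, hr₂, D₂, hD₂, hi₂⟩ := pairOn_spec (D := D₁) (x := 36) (y := 32) (by decide) hD₁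
      (by rwa [e36]) hi₁.mem (hdom (by rw [e36, hi₁.sub.bag a₂]; exact hS₂.1) hS₃)
    rw [e36] at hi₂
    have e46' : C₂.reg 46 = C.reg 46 := (hr₂ 46 (by simp)).trans e46
    have hbag₂ := hi₂.bag_union a₂' hi₁.mem
    have hS₄ : ∀ ν ∈ D₂.bag (C₂.reg 32), ν.dom = S := by
      rw [hbag₂, hadd, hi₁.sub.bag a₂]
      exact ⟨hS₂.1, hS₃⟩
    have a₁' := hi₂.sub.nodes (hi₁.sub.nodes a₁)
    have hb46 : D₂.bag (C.reg 46) = D.bag (C.reg 46) := (hi₁.sub.trans hi₂.sub).bag a₁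
    obtain ⟨C', he, -, D', hD', hi⟩ := pairOn_spec (D := D₂) (x := 46) (y := 32) (by decide) hD₂
      (by rwa [e46']) hi₂.mem (hdom (by rw [e46', hb46]; exact hS₁.1) hS₄)
    rw [e46'] at hi
    refine ⟨C', by simp [he₁, he₂, he], D', hD', (hi₁.sub.trans hi₂.sub).trans hi.sub, hi.mem, ?_,
      fun s₁ s₂ => ?_⟩
    · rw [hi.bag_union a₁' hi₂.mem, hb46, hbag₂, hi₁.sub.bag a₂, hbag₁, ← hb₁, ← hb₂]
      abel
    · obtain ⟨t₁, u₁⟩ := hsafe₁ s₁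
      obtain ⟨t₂, u₂⟩ := hsafe₂ s₂
      have d₁ := t₁.odepth_le
      have d₂ := t₂.odepth_le
      have d₃ := hi₁.odepth_union b₁
      have d₄ := hi₂.odepth_union a₂'
      rw [hi₁.sub.odepth a₂] at d₄
      have d₅ := hi.odepth_union a₁'
      rw [(hi₁.sub.trans hi₂.sub).odepth a₁] at d₅
      exact ⟨hi.safeUnion ((hi₁.sub.trans hi₂.sub).safeOutput t₁) hi₂.mem (by omega),
        fun hB => hi.bounded (hi₂.bounded (hi₁.bounded hB (by omega)) (by omega)) (by omega)⟩

theorem unionCmd_spec {s W : ℕ → ℕ} (h : Good ρ ω I W (W 0) D) (h₁ : s 0 ∈ D.nodes)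
    (h₂ : s 1 ∈ D.nodes) (hd : ∀ ν₁ ∈ D.bag (s 0), ∀ ν₂ ∈ D.bag (s 1), ν₁.dom = ν₂.dom) :
    ∃ C', eval I (unionCmd R) ⟨s, W, []⟩ = C' ∧ ∃ D',
      Good ρ ω I C'.mem (C'.mem 0) D' ∧ D.Sub D' ∧ C'.reg 0 ∈ D'.nodes ∧
      D'.bag (C'.reg 0) = D.bag (s 0) + D.bag (s 1) ∧
      (D.Safe (s 0) → D.Safe (s 1) → D'.Safe (C'.reg 0) ∧ (D.Bounded 4 → D'.Bounded 4)) := by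
  -- Bags are nonempty, so the pairwise condition on domains provides one common domain for both
  -- bags.
  obtain ⟨ν₀, hν₀⟩ := Multiset.exists_mem_of_ne_zero (ECSA.bag_ne_zero h₁)
  obtain ⟨ν₀', hν₀'⟩ := Multiset.exists_mem_of_ne_zero (ECSA.bag_ne_zero h₂)
  have hS₂ : ∀ ν ∈ D.bag (s 1), ν.dom = ν₀.dom := fun ν hν => (hd ν₀ hν₀ ν hν).symm
  have hS₁ : ∀ ν ∈ D.bag (s 0), ν.dom = ν₀.dom :=
    fun ν hν => (hd ν hν ν₀' hν₀').trans (hS₂ ν₀' hν₀')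
  obtain ⟨C₁, he₁, hr₁, D₁, hD₁, hsub₁, hc₁⟩ := splitCmd_spec (ρ := ρ) (ω := ω) (I := I) (D := D)
    (C := ⟨Function.update (Function.update (Function.update s 2 0) 12 (W 0)) 44 (s 0), W, []⟩)
    (by simpa [Function.update_apply] using h) (by simpa using h₁)
  simp only [Function.update_self] at hc₁
  have e0 : C₁.reg 0 = s 0 := by simpa using hr₁ 0 (by simp)
  have e1 : C₁.reg 1 = s 1 := by simpa using hr₁ 1 (by simp)
  obtain ⟨C₂, he₂, hr₂, D₂, hD₂, hsub₂, hc₂⟩ := splitCmd_spec (ρ := ρ) (ω := ω) (I := I) (D := D₁)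
    (C := ⟨Function.update (Function.update (Function.update (Function.update C₁.reg 45 (C₁.reg 35))
      46 (C₁.reg 36)) 47 (C₁.reg 37)) 44 (s 1), C₁.mem, C₁.out⟩)
    (by simpa [Function.update_apply] using hD₁) (by simpa using hsub₁.nodes h₂)
  simp only [Function.update_self] at hc₂
  have f0 : C₂.reg 0 = s 0 := by simpa [e0] using hr₂ 0 (by simp)
  have f1 : C₂.reg 1 = s 1 := by simpa [e1] using hr₂ 1 (by simp)
  have f45 : C₂.reg 45 = C₁.reg 35 := by simpa using hr₂ 45 (by simp)
  have f46 : C₂.reg 46 = C₁.reg 36 := by simpa using hr₂ 46 (by simp)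
  have f47 : C₂.reg 47 = C₁.reg 37 := by simpa using hr₂ 47 (by simp)
  have hsub := hsub₁.trans hsub₂
  have hbd₁ : D.Safe (s 0) → D.Bounded 4 → D₁.Bounded 4 := by
    intro hs hB
    rcases hc₁ with ⟨_, rfl, _⟩ | ⟨_, _, _, _, hc⟩
    · exact hB
    · exact (hc hs).2.2 hB
  have hbd₂ : D.Safe (s 1) → D₁.Bounded 4 → D₂.Bounded 4 := by
    intro hs hB
    rcases hc₂ with ⟨_, rfl, _⟩ | ⟨_, _, _, _, hc⟩
    · exact hB
    · exact (hc (hsub₁.safe hs)).2.2 hB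
  obtain ⟨C₃, he₃, D₃, hD₃, hsub₃, hmem, hbag, hsafe⟩ := combine_spec (D₀ := D) (S := ν₀.dom) hD₂
    hsub (by rwa [f0]) (by rwa [f1]) (by rwa [f0, hsub.bag h₁]) (by rwa [f1, hsub.bag h₂])
    (by
      rw [f0, f45, f46, f47, hsub.bag h₁]
      rcases hc₁ with ⟨c1, rfl, c3⟩ | ⟨c1, c2, c3, c4, c5⟩
      · exact .inl ⟨c1, fun hs => hsub₂.safeOutput (c3 hs)⟩
      · refine .inr ⟨c1, hsub₂.nodes c2, hsub₂.nodes c3, ?_, fun hs => ?_⟩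
        · rw [hsub₂.bag c2, hsub₂.bag c3, c4]
        · obtain ⟨k1, k2, _⟩ := c5 hs
          exact ⟨hsub₂.safeOutput k1, by rwa [hsub₂.odepth c3]⟩)
    (by
      rw [f1, hsub.bag h₂]
      rw [hsub₁.bag h₂] at hc₂
      rcases hc₂ with ⟨c1, rfl, c3⟩ | ⟨c1, c2, c3, c4, c5⟩
      · exact .inl ⟨c1, fun hs => c3 (hsub₁.safe hs)⟩
      · exact .inr ⟨c1, c2, c3, c4, fun hs =>
          ⟨(c5 (hsub₁.safe hs)).1, (c5 (hsub₁.safe hs)).2.1⟩⟩)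
  rw [f0, f1] at hbag hsafe
  have hC' : eval I (unionCmd R) ⟨s, W, []⟩ = ⟨Function.update (Function.update C₃.reg 0
      (C₃.reg 32)) 2 0, Function.update C₃.mem 0 (C₃.reg 12), C₃.out⟩ := by
    simp [unionCmd, he₁, e1, he₂, he₃]
  refine ⟨_, hC', D₃, ?_, hsub.trans hsub₃, by simpa using hmem, ?_, fun s₁ s₂ => ?_⟩
  · simp only [Function.update_self]
    exact hD₃.mono (fun a ha _ => Function.update_of_ne ha.ne' _ _) le_rfl
  · simpa [hsub.bag h₁, hsub.bag h₂] using hbag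
  · obtain ⟨k1, k2⟩ := hsafe s₁ s₂
    exact ⟨by simpa using .inr (.inl k1), fun hB => k2 (hbd₂ s₂ (hbd₁ s₁ hB))⟩

end Union

/-! ### Paths: the labels whose composition is an output -/

/-- A level of a path: an assignment `σ` at the address `p` of the input memory, and a skeleton to be
applied after it. -/
structure Level (R Ω : Type*) where
  τ : Skel R
  p : ℕ
  σ : Asg R Ω

namespace Level

variable {R Ω : Type*}

/-- The valuation represented by a path. -/
def val : List (Level R Ω) → Asg R Ω
  | [] => nowhere
  | e :: L => ((val L).comp e.σ).comp (e.τ.toAsg Ω)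

/-- The invariants of a path. -/
def PathOK : List (Level R Ω) → Prop
  | [] => True
  | e :: L => e.σ.Copyless ∧ (val L).Fits e.σ ∧ ((val L).comp e.σ).Fits (e.τ.toAsg Ω) ∧
      (L ≠ [] → e.σ.HasLetter) ∧ PathOK L

variable [Fintype R]

theorem size_val_cons {e : Level R Ω} {L : List (Level R Ω)} (h : PathOK (e :: L)) :
    (val (e :: L)).size = e.σ.letters + (val L).size := by
  obtain ⟨h1, h2, h3, _⟩ := h
  rw [val, h3.size_comp e.τ.copyless, Skel.letters_toAsg, zero_add, h2.size_comp h1]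

/-- All levels except the last, deepest one have a letter, and each letter contributes to the size
of the represented valuation by `size_val_cons`. -/
theorem length_le {L : List (Level R Ω)} (h : PathOK L) : L.length ≤ (val L).size + 1 := by
  induction L with
  | nil => simp
  | cons e L ih =>
    rw [size_val_cons h]
    by_cases hL : L = []
    · subst hL
      simp
    · have h1 := (h.2.2.2.1 hL).letters_pos
      have h2 := ih h.2.2.2.2
      simp only [List.length_cons]
      omega

/-- The number of rounds needed for printing a string, given those needed for the registers. -/
def rounds (f : R → ℕ) (w : List (R ⊕ Ω)) : ℕ :=
  1 + (w.length + (w.map (Sum.elim f fun _ => 0)).sum)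

/-- The number of rounds needed for printing the value of a register. -/
def work : List (Level R Ω) → R → ℕ
  | [], _ => 0
  | e :: L, X => (((e.τ.1 X).getD []).map fun Y => rounds (work L) (e.σ.str Y)).sum

/-- By copylessness every string of a level is expanded at most once over all registers printed, so
the work adds up level by level. The letters met in this way sum up to the size of the output. -/
theorem sum_work_le {L : List (Level R Ω)} (h : PathOK L) :
    ∑ X, work L X ≤ 2 * Fintype.card R * L.length + (val L).size := by
  induction L with
  | nil => simp [work]
  | cons e L ih =>
    have h1 : ∑ X, work (e :: L) X ≤ ∑ Y, rounds (work L) (e.σ.str Y) := by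
      refine le_trans (le_of_eq ?_) ((e.τ.copyless (Ω := Ω)).sum_regs_le _)
      refine Finset.sum_congr rfl fun X _ => ?_
      simp only [work, Asg.str, Skel.toAsg]
      cases e.τ.1 X with
      | none => rfl
      | some l => simp [Function.comp_def]
    -- The first |R| comes from the round that removes each exhausted string, the second from the at
    -- most |R| register symbols; both together give the factor 2.
    have h2 : ∑ Y, rounds (work L) (e.σ.str Y) ≤
        Fintype.card R + (Fintype.card R + e.σ.letters) + ∑ X, work L X := by
      simp only [rounds, Finset.sum_add_distrib]
      have := Asg.sum_length_le h.1
      have := h.1.sum_regs_le (work L)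
      simp only [Finset.sum_const, Finset.card_univ, smul_eq_mul, mul_one]
      omega
    have h3 := ih h.2.2.2.2
    rw [size_val_cons h, List.length_cons, Nat.mul_add]
    omega

end Level

/-! ### Printing -/

/-- The program step from `C` to `C'` changes only registers in `S`, and allocates memory. -/
structure Grow (S : List ℕ) (C C' : St) : Prop where
  reg : ∀ r, r ∉ S → C'.reg r = C.reg r
  mem : Keeps (C.reg 12) C.mem C'.mem
  le : C.reg 12 ≤ C'.reg 12

theorem Grow.refl (S : List ℕ) (C : St) : Grow S C C :=
  ⟨fun _ _ => rfl, .refl _ _, le_rfl⟩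

theorem Grow.trans {S : List ℕ} {C C' C'' : St} (h : Grow S C C') (h' : Grow S C' C'') :
    Grow S C C'' :=
  ⟨fun r hr => (h'.reg r hr).trans (h.reg r hr), h.mem.trans h'.mem h.le, h.le.trans h'.le⟩

theorem Grow.weaken {S S' : List ℕ} {C C' : St} (h : Grow S C C') (hS : S ⊆ S') : Grow S' C C' :=
  ⟨fun r hr => h.reg r fun h => hr (hS h), h.mem, h.le⟩

theorem hat_regs {R Ω : Type*} {ν : Asg R Ω} {l : List R} {v : List (R ⊕ Ω)}
    (h : ν.hat (l.map Sum.inl) = some v) : v = l.flatMap ν.str := by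
  induction l generalizing v with
  | nil => simpa [Asg.hat] using h.symm
  | cons X l ih =>
    simp only [List.map_cons, Asg.hat, Asg.onSymbol, Option.bind_eq_some_iff,
      Option.map_eq_some_iff] at h
    obtain ⟨a, ha, b, hb, rfl⟩ := h
    rw [ih hb]
    simp [Asg.str, ha]

/-- The output for a string of letters. -/
def letterCodes {R Ω : Type*} (ω : Ω ↪ ℕ) (w : List (R ⊕ Ω)) : List ℕ :=
  w.filterMap (Sum.elim (fun _ => none) fun a => some (ω a + 3))

theorem letterCodes_append {R Ω : Type*} (ω : Ω ↪ ℕ) (u v : List (R ⊕ Ω)) :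
    letterCodes ω (u ++ v) = letterCodes ω u ++ letterCodes ω v := List.filterMap_append

/-- The output for a string the registers of which are evaluated along a path. -/
def text {R Ω : Type*} (ω : Ω ↪ ℕ) (L : List (Level R Ω)) (w : List (R ⊕ Ω)) : List ℕ :=
  letterCodes ω (((Level.val L).hat w).getD [])

/-- How the value of a register along a path is composed of the strings of the first level. -/
theorem val_cons_some {R Ω : Type*} {ω : Ω ↪ ℕ} {L : List (Level R Ω)} {e : Level R Ω}
    {X : R} {v : List (R ⊕ Ω)} (h : Level.val (e :: L) X = some v) :
    (∀ Y ∈ (e.τ.1 X).getD [], e.σ Y ≠ none ∧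
      (Level.val L).hat (e.σ.str Y) ≠ none) ∧
      letterCodes ω v = ((e.τ.1 X).getD []).flatMap fun Y => text ω L (e.σ.str Y) := by
  simp only [Level.val, Asg.comp, Option.bind_eq_some_iff] at h
  obtain ⟨_, hl, hv⟩ := h
  obtain ⟨l, hl', rfl⟩ := Skel.toAsg_eq_some.1 hl
  rw [hl', Option.getD_some]
  have hne : ∀ Y ∈ l, ((Level.val L).comp e.σ) Y ≠ none := fun Y hY =>
    Asg.hat_ne_none.1 (hv ▸ Option.some_ne_none v :
      ((Level.val L).comp e.σ).hat (l.map Sum.inl) ≠ none) Y (List.mem_map_of_mem hY)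
  have hY : ∀ Y ∈ l, e.σ Y ≠ none ∧ (Level.val L).hat (e.σ.str Y) ≠ none := by
    intro Y hY
    have := hne Y hY
    simp only [Asg.comp] at this
    cases hσ : e.σ Y with
    | none => simp [hσ] at this
    | some w => simpa [Asg.str, hσ] using this
  refine ⟨hY, ?_⟩
  rw [hat_regs hv]
  clear hv hl hl' hne
  induction l with
  | nil => rfl
  | cons Y l ih =>
    rw [List.flatMap_cons, List.flatMap_cons, letterCodes_append,
      ih fun Y h => hY Y (by simp [h])]
    congr 1
    have := (hY Y (by simp)).1
    obtain ⟨w, hw⟩ := Option.ne_none_iff_exists'.1 this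
    simp [text, Asg.str, Asg.comp, hw]

section Print

variable {R Ω : Type*} [Fintype R] (ρ : R ≃ Fin (Fintype.card R)) (ω : Ω ↪ ℕ) (I : ℕ → ℕ)

/-- Push the string of the register `Y` in the assignment at the address in register `57`. -/
def pushString (Y : R) : Cmd :=
  blk [.const 11 (ρ Y), .add 11 57 11, .input 59 11, .input 60 59, .const 10 1, .add 59 59 10,
    .move 55 12, alloc [60, 59, 58, 50], .move 50 55]

/-- Push the strings of the given registers. -/
def pushStrings : List R → Cmd
  | [] => .skip
  | Y :: l => .seq (pushStrings l) (pushString ρ Y)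

/-- Push the strings making up the value of the register `X` at the level in register `53`. -/
noncomputable def pushReg (X : R) : Cmd :=
  blk [fetch 56 53 0, fetch 57 53 1, fetch 58 53 2, .const 10 1,
    switch 56 (Skel.num R) (fun i => pushStrings ρ (((Skel.dec R i).1 X).getD [])) .skip]

/-- One round of the printing loop: process the next symbol. -/
noncomputable def printStep : Cmd :=
  blk [fetch 51 50 0, fetch 52 50 1, fetch 53 50 2, fetch 50 50 3,
    .ite 51
      (blk [.input 54 52, .const 10 1, .sub 51 51 10, .add 52 52 10, .move 55 12,
        alloc [51, 52, 53, 50], .move 50 55,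
        switch 54 (Fintype.card R)
          (fun x => if h : x < Fintype.card R then pushReg ρ (ρ.symm ⟨x, h⟩) else .skip)
          (blk [.const 55 3, .add 54 54 55, .emit 54])])
      .skip]

open Classical in
/-- Print the mark for the value of the register `X` at the level in register `61`, and prepare the
printing of the string. -/
noncomputable def printInit (X : R) : Cmd :=
  blk [fetch 56 61 0, .const 10 1,
    switch 56 (Skel.num R)
      (fun i => .const 54 (if (Skel.dec R i).1 X = none then 0 else 1)) .skip,
    .emit 54, .const 50 0, .move 53 61, pushReg ρ X]

/-- Print the value of the register `X` at the level in register `61`. -/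
noncomputable def printReg (X : R) : Cmd := .seq (printInit ρ X) (.loop 50 (printStep ρ))

/-- Print the valuation of the path in register `61`. -/
noncomputable def printCmd : Cmd :=
  .seq (blk ((List.finRange (Fintype.card R)).map fun i => printReg ρ (ρ.symm i)))
    (blk [.const 54 2, .emit 54])

theorem loopFree_pushStrings (l : List R) : (pushStrings ρ l).LoopFree := by
  induction l with
  | nil => trivial
  | cons Y l ih => exact ⟨ih, by simp [pushString, blk, LoopFree, loopFree_alloc]⟩

theorem loopFree_pushReg (X : R) : (pushReg ρ X).LoopFree := by
  simp only [pushReg, loopFree_blk, List.mem_cons, List.not_mem_nil, or_false]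
  rintro a (rfl | rfl | rfl | rfl | rfl)
  · exact loopFree_fetch _ _ _
  · exact loopFree_fetch _ _ _
  · exact loopFree_fetch _ _ _
  · trivial
  · exact loopFree_switch (fun _ _ => loopFree_pushStrings ρ _) trivial

theorem loopFree_printStep : (printStep ρ).LoopFree := by
  have : (switch 54 (Fintype.card R)
          (fun x => if h : x < Fintype.card R then pushReg ρ (ρ.symm ⟨x, h⟩) else .skip)
          (blk [.const 55 3, .add 54 54 55, .emit 54])).LoopFree := by
    refine loopFree_switch (fun k hk => ?_) (by simp [blk, LoopFree])
    simp only [hk, dite_true]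
    exact loopFree_pushReg ρ _
  have h : (printStep ρ).LoopFree ↔ True := by
    simp only [printStep, loopFree_blk, List.forall_mem_cons, LoopFree, loopFree_fetch,
      loopFree_alloc, this, List.not_mem_nil, false_imp_iff, implies_true, and_true]
  exact h.2 trivial

/-- A path is stored in the memory. -/
def LevelsIn (W : ℕ → ℕ) (f : ℕ) : List (Level R Ω) → ℕ → Prop
  | [], q => q = 0
  | e :: L, q => 0 < q ∧ q + 3 ≤ f ∧ W q = e.τ.code ∧ W (q + 1) = e.p ∧ HoldsAsg ρ ω I e.p e.σ ∧
      LevelsIn W f L (W (q + 2))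

/-- The stack of the printing loop, consisting of strings and the paths for their registers, is
stored in the memory. -/
def PrintStackIn (W : ℕ → ℕ) (f : ℕ) : List (List (R ⊕ Ω) × List (Level R Ω)) → ℕ → Prop
  | [], q => q = 0
  | (w, L) :: S, q => 0 < q ∧ q + 4 ≤ f ∧ W q = w.length ∧
      (∀ (i : ℕ) (h : i < w.length), I (W (q + 1) + i) = symbolCode ρ ω w[i]) ∧
      LevelsIn ρ ω I W f L (W (q + 2)) ∧ PrintStackIn W f S (W (q + 3))

variable {ρ ω I} {W W' : ℕ → ℕ} {f f' q : ℕ} {L : List (Level R Ω)}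
  {S : List (List (R ⊕ Ω) × List (Level R Ω))}

theorem LevelsIn.mono (h : LevelsIn ρ ω I W f L q) (hW : Keeps f W W') (hf : f ≤ f') :
    LevelsIn ρ ω I W' f' L q := by
  induction L generalizing q with
  | nil => exact h
  | cons e L ih =>
    obtain ⟨h0, h1, h2, h3, h4, h5⟩ := h
    refine ⟨h0, by omega, ?_, ?_, h4, ?_⟩
    · rw [hW _ (by omega) (by omega), h2]
    · rw [hW _ (by omega) (by omega), h3]
    · rw [hW _ (by omega) (by omega)]
      exact ih h5

theorem PrintStackIn.mono (h : PrintStackIn ρ ω I W f S q) (hW : Keeps f W W') (hf : f ≤ f') :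
    PrintStackIn ρ ω I W' f' S q := by
  induction S generalizing q with
  | nil => exact h
  | cons e S ih =>
    obtain ⟨h0, h1, h2, h3, h4, h5⟩ := h
    refine ⟨h0, by omega, ?_, ?_, ?_, ?_⟩
    · rw [hW _ (by omega) (by omega), h2]
    · rw [hW _ (by omega) (by omega)]
      exact h3
    · rw [hW _ (by omega) (by omega)]
      exact h4.mono hW hf
    · rw [hW _ (by omega) (by omega)]
      exact ih h5

theorem printStackIn_writeAt {w : List (R ⊕ Ω)} {k a ql : ℕ} (hf : 0 < f) (hk : k = w.length)
    (ha : ∀ (i : ℕ) (h : i < w.length), I (a + i) = symbolCode ρ ω w[i])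
    (hL : LevelsIn ρ ω I W f L ql) (hS : PrintStackIn ρ ω I W f S q) :
    PrintStackIn ρ ω I (writeAt W f [k, a, ql, q]) (f + 4) ((w, L) :: S) f := by
  have hW := keeps_writeAt f W [k, a, ql, q]
  refine ⟨hf, le_rfl, ?_, ?_, ?_, ?_⟩
  · rw [← hk]
    exact writeAt_get (i := 0) rfl
  · rw [writeAt_get (i := 1) rfl]
    exact ha
  · rw [writeAt_get (i := 2) rfl]
    exact hL.mono hW (by omega)
  · rw [writeAt_get (i := 3) rfl]
    exact hS.mono hW (by omega)

/-- The registers used for printing. -/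
abbrev printRegs : List ℕ := [10, 11, 12, 50, 51, 52, 53, 54, 55, 56, 57, 58, 59, 60]

/-- The tail of the list is pushed before its head, so the strings are taken from the stack in their
proper order. -/
theorem eval_pushStrings {σ : Asg R Ω} {l : List R} {C : St} (hf : 0 < C.reg 12)
    (hp : HoldsAsg ρ ω I (C.reg 57) σ) (hL : LevelsIn ρ ω I C.mem (C.reg 12) L (C.reg 58))
    (hS : PrintStackIn ρ ω I C.mem (C.reg 12) S (C.reg 50)) (hl : ∀ Y ∈ l, σ Y ≠ none) :
    ∃ C', eval I (pushStrings ρ l) C = C' ∧ Grow [10, 11, 12, 50, 55, 59, 60] C C' ∧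
      C'.out = C.out ∧ PrintStackIn ρ ω I C'.mem (C'.reg 12)
        (l.map (fun Y => (σ.str Y, L)) ++ S) (C'.reg 50) := by
  induction l with
  | nil => exact ⟨C, rfl, .refl _ _, rfl, hS⟩
  | cons Y l ih =>
    obtain ⟨C', he, hg, ho, hS'⟩ := ih fun Y hY => hl Y (by simp [hY])
    obtain ⟨w, hw⟩ := Option.ne_none_iff_exists'.1 (hl Y (by simp))
    have h57 := hg.reg 57 (by simp)
    have h58 := hg.reg 58 (by simp)
    have hY := hp Y
    rw [hw] at hY
    obtain ⟨_, hlen, hsym⟩ := hY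
    have hle := hg.le
    refine ⟨_, rfl, hg.trans ⟨?_, ?_, ?_⟩, ?_, ?_⟩
    · intro r hr
      simp only [List.mem_cons, List.not_mem_nil, or_false, not_or] at hr
      simp [pushStrings, he, pushString, hr]
    · simp [pushStrings, he, pushString, keeps_writeAt]
    · simp [pushStrings, he, pushString]
    · simp [pushStrings, he, pushString, ho]
    · have := printStackIn_writeAt (w := w) (k := I (I (C.reg 57 + ρ Y)))
        (a := I (C.reg 57 + ρ Y) + 1) (by omega) hlen (fun i hi => hsym i hi)
        (hL.mono hg.mem hg.le) hS'
      simpa [he, pushStrings, pushString, Function.update_apply, h57, h58, Asg.str, hw] using this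

theorem eval_pushReg {e : Level R Ω} {X : R} {C : St} (hf : 0 < C.reg 12)
    (hL : LevelsIn ρ ω I C.mem (C.reg 12) (e :: L) (C.reg 53))
    (hS : PrintStackIn ρ ω I C.mem (C.reg 12) S (C.reg 50))
    (hl : ∀ Y ∈ (e.τ.1 X).getD [], e.σ Y ≠ none) :
    ∃ C', eval I (pushReg ρ X) C = C' ∧ Grow [10, 11, 12, 50, 55, 56, 57, 58, 59, 60] C C' ∧
      C'.out = C.out ∧ PrintStackIn ρ ω I C'.mem (C'.reg 12)
        (((e.τ.1 X).getD []).map (fun Y => (e.σ.str Y, L)) ++ S) (C'.reg 50) := by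
  obtain ⟨h0, h1, h2, h3, h4, h5⟩ := hL
  obtain ⟨C₁, hC₁, hreg, hmem, hout, e12, e50, e57, e58⟩ : ∃ C₁ : St, eval I (pushReg ρ X) C =
      eval I (pushStrings ρ ((e.τ.1 X).getD [])) C₁ ∧
      (∀ r, r ∉ [10, 11, 12, 50, 55, 56, 57, 58, 59, 60] → C₁.reg r = C.reg r) ∧
      C₁.mem = C.mem ∧ C₁.out = C.out ∧ C₁.reg 12 = C.reg 12 ∧ C₁.reg 50 = C.reg 50 ∧
      C₁.reg 57 = e.p ∧ C₁.reg 58 = C.mem (C.reg 53 + 2) := by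
    apply Exists.intro
    apply And.intro
    · simp only [pushReg, eval_blk_cons, eval_blk_nil,
        eval_fetch _ _ _ (by decide : (53 : ℕ) ≠ 11), eval_const]
      rw [eval_switch (by decide) (by simp)]
      simp only [ne_eq, Nat.reduceEqDiff, not_false_eq_true, Function.update_of_ne,
        Function.update_self, add_zero, h2, Skel.code_lt, if_true, Skel.dec_code]
      rfl
    · refine ⟨fun r hr => ?_, rfl, rfl, ?_, ?_, ?_, ?_⟩
      · simp only [List.mem_cons, List.not_mem_nil, or_false, not_or] at hr
        simp [hr]
      · simp
      · simp
      · simp [h3]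
      · simp
  obtain ⟨C', he, hg, ho, hS'⟩ := eval_pushStrings (C := C₁) (l := (e.τ.1 X).getD []) (σ := e.σ)
    (by rwa [e12]) (by rwa [e57]) (L := L) (by rwa [hmem, e12, e58]) (by rwa [hmem, e12, e50]) hl
  refine ⟨C', hC₁.trans he, ⟨fun r hr => ?_, ?_, ?_⟩, ho.trans hout, hS'⟩
  · rw [hg.reg r (fun h => hr (by simp at h ⊢; tauto)), hreg r hr]
  · have := hg.mem
    rwa [e12, hmem] at this
  · have := hg.le
    rwa [e12] at this

/-- The loop processing the print stack. -/
theorem runs_printLoop (n : ℕ) {C : St} (hf : 0 < C.reg 12)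
    (hS : PrintStackIn ρ ω I C.mem (C.reg 12) S (C.reg 50))
    (hok : ∀ e ∈ S, (Level.val e.2).hat e.1 ≠ none)
    (hn : (S.map fun e => Level.rounds (Level.work e.2) e.1).sum = n) :
    ∃ C', Runs I (.loop 50 (printStep ρ)) C (n * ((printStep ρ).cost + 1) + 1) C' ∧
      Grow printRegs C C' ∧ C'.out = C.out ++ S.flatMap fun e => text ω e.2 e.1 := by
  induction n generalizing C S with
  | zero =>
    cases S with
    | nil =>
      exact ⟨C, (Runs.loop_done hS).mono (by omega), .refl _ _, by simp⟩
    | cons e S =>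
      simp [Level.rounds] at hn
  | succ n ih =>
    cases S with
    | nil => simp at hn
    | cons e S =>
      obtain ⟨w, L⟩ := e
      obtain ⟨h0, h1, h2, h3, h4, h5⟩ := hS
      -- One round lowers the number of outstanding rounds by exactly one, and what it prints
      -- followed by what the new stack stands for is what the old stack stood for.
      suffices hstep : ∃ (C₁ : St) (S' : List (List (R ⊕ Ω) × List (Level R Ω))) (u : List ℕ),
          eval I (printStep ρ) C = C₁ ∧ Grow printRegs C C₁ ∧
          PrintStackIn ρ ω I C₁.mem (C₁.reg 12) S' (C₁.reg 50) ∧ C₁.out = C.out ++ u ∧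
          (∀ e ∈ S', (Level.val e.2).hat e.1 ≠ none) ∧
          (S'.map fun e => Level.rounds (Level.work e.2) e.1).sum = n ∧
          u ++ (S'.flatMap fun e => text ω e.2 e.1) =
            text ω L w ++ S.flatMap fun e => text ω e.2 e.1 by
        obtain ⟨C₁, S', u, he, hg, hS', ho, hok', hn', hu⟩ := hstep
        have hle := hg.le
        obtain ⟨C', hr, hg', ho'⟩ := ih (C := C₁) (by omega) hS' hok' hn'
        refine ⟨C', ?_, hg.trans hg', ?_⟩
        · have hrun := Runs.of_loopFree (I := I) (loopFree_printStep ρ) C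
          rw [he] at hrun
          refine (Runs.loop_step h0.ne' hrun hr).mono ?_
          rw [Nat.succ_mul]
          omega
        · rw [ho', ho, List.append_assoc, hu, List.flatMap_cons]
      have hokS : ∀ e ∈ S, (Level.val e.2).hat e.1 ≠ none := fun e he => hok e (by simp [he])
      have hokw : (Level.val L).hat w ≠ none := hok (w, L) (by simp)
      cases w with
      | nil =>
        simp only [List.length_nil] at h2
        refine ⟨_, S, [], rfl, ⟨fun r hr => ?_, ?_, ?_⟩, ?_, ?_, hokS, ?_, ?_⟩
        · simp only [printRegs, List.mem_cons, List.not_mem_nil, or_false, not_or] at hr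
          simp [printStep, eval_ite, h2, hr]
        · simp [printStep, eval_ite, h2, Keeps.refl]
        · simp [printStep, eval_ite, h2]
        · simpa [printStep, eval_ite, h2] using h5
        · simp [printStep, eval_ite, h2]
        · simp only [List.map_cons, List.sum_cons] at hn
          simp only [Level.rounds, List.length_nil, List.map_nil, List.sum_nil] at hn ⊢
          omega
        · simp [text, Asg.hat, letterCodes]
      | cons s w =>
        have hs : I (C.mem (C.reg 50 + 1)) = symbolCode ρ ω s := h3 0 (by simp)
        have hpush := printStackIn_writeAt (w := w) (k := w.length) (a := C.mem (C.reg 50 + 1) + 1)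
          hf rfl (fun i hi => by
            have := h3 (i + 1) (by simpa using hi)
            rw [List.getElem_cons_succ] at this
            rw [← this]
            congr 1
            omega) h4 h5
        have hokw' : (Level.val L).onSymbol s ≠ none ∧ (Level.val L).hat w ≠ none := by
          simp only [Asg.hat] at hokw
          constructor
          · intro h
            simp [h] at hokw
          · intro h
            simp [h] at hokw
        obtain ⟨a, ha⟩ := Option.ne_none_iff_exists'.1 hokw'.1
        obtain ⟨b, hb⟩ := Option.ne_none_iff_exists'.1 hokw'.2
        have htext : text ω L (s :: w) = letterCodes ω a ++ text ω L w := by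
          simp [text, Asg.hat, ha, hb, letterCodes_append]
        obtain ⟨C₁, hC₁, hg₁, ho₁, e50, e12, e53, e54, e10, em⟩ : ∃ C₁ : St,
            eval I (printStep ρ) C = eval I (switch 54 (Fintype.card R)
              (fun x => if h : x < Fintype.card R then pushReg ρ (ρ.symm ⟨x, h⟩) else .skip)
              (blk [.const 55 3, .add 54 54 55, .emit 54])) C₁ ∧ Grow printRegs C C₁ ∧
            C₁.out = C.out ∧ C₁.reg 50 = C.reg 12 ∧ C₁.reg 12 = C.reg 12 + 4 ∧
            C₁.reg 53 = C.mem (C.reg 50 + 2) ∧ C₁.reg 54 = symbolCode ρ ω s ∧ C₁.reg 10 = 1 ∧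
            C₁.mem = writeAt C.mem (C.reg 12) [w.length, C.mem (C.reg 50 + 1) + 1,
              C.mem (C.reg 50 + 2), C.mem (C.reg 50 + 3)] := by
          apply Exists.intro
          apply And.intro
          · simp only [printStep, eval_blk_cons, eval_blk_nil,
              eval_fetch _ _ _ (by decide : (50 : ℕ) ≠ 11)]
            rw [eval_ite_pos (by simp [h2])]
            simp only [eval_blk_cons, eval_blk_nil]
            rfl
          · refine ⟨⟨fun r hr => ?_, ?_, ?_⟩, ?_, ?_, ?_, ?_, ?_, ?_, ?_⟩
            · simp only [printRegs, List.mem_cons, List.not_mem_nil, or_false, not_or] at hr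
              simp [hr]
            · simp [keeps_writeAt]
            · simp
            all_goals simp [h2, hs]
        rw [← em] at hpush
        rw [eval_switch (by decide) e10, e54] at hC₁
        cases s with
        | inr c =>
          -- The codes of letters start at |R|. The switch has subtracted |R|, which leaves `ω c`;
          -- the output format adds 3.
          simp only [symbolCode, add_lt_iff_neg_left, not_lt_zero, if_false,
            Nat.add_sub_cancel_left] at hC₁
          simp only [eval_blk_cons, eval_blk_nil, eval_const, eval_add, eval_emit] at hC₁
          refine ⟨_, (w, L) :: S, [ω c + 3], hC₁, hg₁.trans ⟨fun r hr => ?_, ?_, ?_⟩, ?_, ?_, ?_, ?_,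
            ?_⟩
          · simp only [printRegs, List.mem_cons, List.not_mem_nil, or_false, not_or] at hr
            simp [hr]
          · simp [Keeps.refl]
          · simp
          · simpa [e12, e50] using hpush
          · simp [ho₁]
          · intro e he
            rcases List.mem_cons.1 he with rfl | he
            · exact hokw'.2
            · exact hokS e he
          · simp only [List.map_cons, List.sum_cons, Level.rounds, List.length_cons,
              Sum.elim_inr] at hn ⊢
            omega
          · rw [htext]
            simp only [Asg.onSymbol, Option.some.injEq] at ha
            simp [← ha, letterCodes]
        | inl X =>
          simp only [symbolCode, Fin.is_lt, if_true, dite_true, Fin.eta,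
            Equiv.symm_apply_apply] at hC₁
          cases L with
          -- Below the deepest level every register is undefined, so no register can occur there.
          | nil => simp [Asg.onSymbol, Level.val, nowhere] at ha
          | cons e L =>
            simp only [Asg.onSymbol] at ha
            obtain ⟨hY, hlet⟩ := val_cons_some (ω := ω) ha
            obtain ⟨C₂, he₂, hg₂, ho₂, hS₂⟩ := eval_pushReg (ρ := ρ) (ω := ω) (I := I) (L := L)
              (e := e) (X := X) (S := (w, e :: L) :: S)
              (C := ⟨Function.update C₁.reg 54 (ρ X - Fintype.card R), C₁.mem, C₁.out⟩)
              (by simp [e12]) (by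
                have := h4.mono hg₁.mem hg₁.le
                simpa [e53] using this)
              (by simpa [e12, e50] using hpush) (fun Y h => (hY Y h).1)
            refine ⟨C₂, _, [], hC₁.trans he₂, hg₁.trans ⟨fun r hr => ?_, ?_, ?_⟩, hS₂, ?_, ?_, ?_, ?_⟩
            · have hr' := hr
              simp only [printRegs, List.mem_cons, List.not_mem_nil, or_false, not_or] at hr'
              rw [hg₂.reg r (fun h => hr (by simp at h ⊢; tauto))]
              simp [hr']
            · simpa using hg₂.mem
            · simpa using hg₂.le
            · simp [ho₂, ho₁]
            · intro e' he'
              rcases List.mem_append.1 he' with he' | he'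
              · obtain ⟨Y, hYl, rfl⟩ := List.mem_map.1 he'
                exact (hY Y hYl).2
              · rcases List.mem_cons.1 he' with rfl | he'
                · exact hokw'.2
                · exact hokS e' he'
            · simp only [List.map_cons, List.sum_cons, Level.rounds, List.length_cons,
                Sum.elim_inl, List.map_append, List.sum_append, List.map_map] at hn ⊢
              -- The strings pushed for `X` need exactly the rounds that were reserved for the
              -- symbol `X`.
              have : ((List.map ((fun e => Level.rounds (Level.work e.2) e.1) ∘
                  fun Y => (e.σ.str Y, L)) ((e.τ.1 X).getD [])).sum) = Level.work (e :: L) X := rfl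
              simp only [Level.rounds] at this
              rw [this]
              omega
            · rw [htext, hlet]
              simp [List.flatMap_map]

end Print

/-! ### Printing a whole valuation in linear time -/

section PrintAll

variable {R Ω : Type*} [Fintype R] (ρ : R ≃ Fin (Fintype.card R)) (ω : Ω ↪ ℕ) (I : ℕ → ℕ)

theorem loopFree_printInit (X : R) : (printInit ρ X).LoopFree := by
  have h : (printInit ρ X).LoopFree ↔ True := by
    simp only [printInit, loopFree_blk, List.forall_mem_cons, LoopFree, loopFree_fetch,
      loopFree_pushReg, List.not_mem_nil, false_imp_iff, implies_true, and_true, true_and, iff_true]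
    exact loopFree_switch (fun _ _ => trivial) trivial
  exact h.2 trivial

/-- How the value of a register is printed. -/
def printedVal : Option (List (R ⊕ Ω)) → List ℕ
  | none => [0]
  | some w => 1 :: letterCodes ω w

theorem printed_eq (ν : Asg R Ω) : printed ρ ω ν =
    (((List.finRange (Fintype.card R)).map ρ.symm).flatMap fun X => printedVal ω (ν X)) ++ [2] := by
  rw [printed, List.flatMap_map]
  refine congrArg (· ++ [2]) (congrArg (List.flatMap · _) (funext fun i => ?_))
  cases ν (ρ.symm i) <;> rfl

/-- A bound for the time for printing a valuation, per symbol. -/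
noncomputable def printCost : ℕ :=
  ((List.finRange (Fintype.card R)).map fun i => (printInit ρ (ρ.symm i)).cost + 3).sum + 7 +
    ((printStep ρ).cost + 1) * (2 * Fintype.card R + 1)

variable {ρ ω I} {L : List (Level R Ω)} {e : Level R Ω}

theorem runs_printReg {C : St} (hf : 0 < C.reg 12)
    (hL : LevelsIn ρ ω I C.mem (C.reg 12) (e :: L) (C.reg 61)) (hp : Level.PathOK (e :: L)) (X : R) :
    ∃ C', Runs I (printReg ρ X) C ((printInit ρ X).cost + 2 +
        Level.work (e :: L) X * ((printStep ρ).cost + 1)) C' ∧ Grow printRegs C C' ∧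
      C'.out = C.out ++ printedVal ω (Level.val (e :: L) X) := by
  obtain ⟨h0, h1, h2, h3, h4, h5⟩ := id hL
  classical
  obtain ⟨C₁, hC₁, hreg, hmem, hout, e12, e50, e53⟩ : ∃ C₁ : St, eval I (printInit ρ X) C =
      eval I (pushReg ρ X) C₁ ∧ (∀ r, r ∉ printRegs → C₁.reg r = C.reg r) ∧
      C₁.mem = C.mem ∧ C₁.out = C.out ++ [if e.τ.1 X = none then 0 else 1] ∧
      C₁.reg 12 = C.reg 12 ∧ C₁.reg 50 = 0 ∧ C₁.reg 53 = C.reg 61 := by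
    apply Exists.intro
    apply And.intro
    · simp only [printInit, eval_blk_cons, eval_blk_nil,
        eval_fetch _ _ _ (by decide : (61 : ℕ) ≠ 11), eval_const]
      rw [eval_switch (by decide) (by simp)]
    · refine ⟨fun r hr => ?_, ?_, ?_, ?_, ?_, ?_⟩
      · simp only [printRegs, List.mem_cons, List.not_mem_nil, or_false, not_or] at hr
        simp [h2, Skel.code_lt, hr]
      all_goals simp [h2, Skel.code_lt]
  have hg₁ : Grow printRegs C C₁ := ⟨hreg, hmem ▸ Keeps.refl _ _, e12.ge⟩
  -- As the levels below fit, the topmost skeleton alone decides whether a register is defined. So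
  -- the mark can be printed before the string is explored.
  have hdom : e.τ.1 X = none ↔ Level.val (e :: L) X = none := by
    have := hp.2.2.1.dom_comp
    rw [Skel.dom_toAsg] at this
    have := Set.ext_iff.1 this X
    simp only [Asg.dom, Set.mem_ofPred_eq] at this
    exact not_iff_not.1 this.symm
  have hval : (∀ Y ∈ (e.τ.1 X).getD [], e.σ Y ≠ none ∧
      (Level.val L).hat (e.σ.str Y) ≠ none) ∧
      printedVal ω (Level.val (e :: L) X) = (if e.τ.1 X = none then 0 else 1) ::
        ((e.τ.1 X).getD []).flatMap fun Y => text ω L (e.σ.str Y) := by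
    cases hv : Level.val (e :: L) X with
    | none =>
      rw [hdom.2 hv]
      simp [printedVal]
    | some v =>
      obtain ⟨ha, hb⟩ := val_cons_some (ω := ω) hv
      refine ⟨ha, ?_⟩
      rw [if_neg (fun h => by rw [hdom.1 h] at hv; cases hv), printedVal, hb]
  obtain ⟨C₂, he₂, hg₂, ho₂, hS₂⟩ := eval_pushReg (ρ := ρ) (ω := ω) (I := I) (L := L)
    (e := e) (X := X) (S := []) (C := C₁) (by omega) (by rwa [e53, e12, hmem]) e50
    (fun Y h => (hval.1 Y h).1)
  have hg₂' := hg₂.weaken (S' := printRegs) (fun r h => by simp at h ⊢; tauto)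
  have hle := (hg₁.trans hg₂').le
  obtain ⟨C', hr, hg', ho'⟩ := runs_printLoop (I := I) (Level.work (e :: L) X) (C := C₂) (by omega) hS₂
    (by
      intro e' he'
      rw [List.append_nil] at he'
      obtain ⟨Y, hY, rfl⟩ := List.mem_map.1 he'
      exact (hval.1 Y hY).2)
    (by
      rw [List.append_nil, List.map_map]
      rfl)
  refine ⟨C', ?_, (hg₁.trans hg₂').trans hg', ?_⟩
  · rw [← he₂, ← hC₁] at hr
    exact (Runs.eval_then (loopFree_printInit ρ X) hr).mono (by omega)
  · rw [ho', ho₂, hout, hval.2]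
    simp [List.flatMap_map]

theorem runs_printRegs {C : St} (hf : 0 < C.reg 12)
    (hL : LevelsIn ρ ω I C.mem (C.reg 12) (e :: L) (C.reg 61)) (hp : Level.PathOK (e :: L))
    (l : List R) : ∃ C', Runs I (blk (l.map (printReg ρ))) C
      ((l.map fun X => (printInit ρ X).cost + 3).sum +
        (l.map (Level.work (e :: L))).sum * ((printStep ρ).cost + 1) + 1) C' ∧
      Grow printRegs C C' ∧
      C'.out = C.out ++ l.flatMap fun X => printedVal ω (Level.val (e :: L) X) := by
  induction l generalizing C with
  | nil => exact ⟨C, (Runs.of_loopFree (P := .skip) trivial C).mono (by simp [cost]), .refl _ _, by simp⟩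
  | cons X l ih =>
    obtain ⟨C₁, h1, g1, o1⟩ := runs_printReg hf hL hp X
    have hle := g1.le
    have h61 := g1.reg 61 (by decide)
    obtain ⟨C₂, h2, g2, o2⟩ := ih (C := C₁) (by omega) (by rw [h61]; exact hL.mono g1.mem g1.le)
    refine ⟨C₂, (h1.seq h2).mono ?_, g1.trans g2, ?_⟩
    · simp only [List.map_cons, List.sum_cons, add_mul]
      omega
    · rw [o2, o1, List.flatMap_cons, List.append_assoc]

/-- Linear time follows from bounding the rounds by the length of the path and the size
(`sum_work_le`), and the length by the size (`length_le`). -/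
theorem runs_printCmd {C : St} (hf : 0 < C.reg 12)
    (hL : LevelsIn ρ ω I C.mem (C.reg 12) (e :: L) (C.reg 61)) (hp : Level.PathOK (e :: L)) :
    ∃ C', Runs I (printCmd ρ) C (printCost ρ * ((Level.val (e :: L)).size + 1)) C' ∧
      Grow printRegs C C' ∧ C'.out = C.out ++ printed ρ ω (Level.val (e :: L)) := by
  obtain ⟨C₁, h1, g1, o1⟩ := runs_printRegs hf hL hp ((List.finRange (Fintype.card R)).map ρ.symm)
  rw [List.map_map] at h1
  have h2 := Runs.of_loopFree (I := I) (P := blk [.const 54 2, .emit 54]) (by simp [blk, LoopFree]) C₁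
  refine ⟨_, (h1.seq h2).mono ?_, g1.trans ⟨fun r hr => ?_, ?_, ?_⟩, ?_⟩
  · have hw := Level.sum_work_le hp
    have hl := Level.length_le hp
    have hsum : (((List.finRange (Fintype.card R)).map ρ.symm).map (Level.work (e :: L))).sum =
        ∑ X, Level.work (e :: L) X := by
      rw [List.map_map, ← Equiv.sum_comp ρ.symm, Fin.sum_univ_def]
      rfl
    have hc : (blk [const 54 2, emit 54]).cost = 5 := by simp [blk, cost]
    rw [hsum, hc, List.map_map, printCost]
    set A := ((List.finRange (Fintype.card R)).map fun i => (printInit ρ (ρ.symm i)).cost + 3).sum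
    have hA : (List.map ((fun X => (printInit ρ X).cost + 3) ∘ ρ.symm)
      (List.finRange (Fintype.card R))).sum = A := rfl
    rw [hA]
    set s := (Level.val (e :: L)).size
    -- Here the length of the path is replaced by its bound, the size plus one.
    have hw' : ∑ X, Level.work (e :: L) X ≤ (2 * Fintype.card R + 1) * (s + 1) := by
      have := Nat.mul_le_mul_left (2 * Fintype.card R) hl
      rw [add_mul, one_mul]
      omega
    have h3 := Nat.mul_le_mul_right ((printStep ρ).cost + 1) hw'
    have h4 : A + 7 ≤ (A + 7) * (s + 1) := Nat.le_mul_of_pos_right _ (by omega)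
    have h5 : (A + 7 + ((printStep ρ).cost + 1) * (2 * Fintype.card R + 1)) * (s + 1) =
      (A + 7) * (s + 1) + (2 * Fintype.card R + 1) * (s + 1) * ((printStep ρ).cost + 1) := by ring
    rw [h5]
    omega
  · simp only [printRegs, List.mem_cons, List.not_mem_nil, or_false, not_or] at hr
    simp [hr]
  · simp [Keeps.refl]
  · simp
  · simp [o1, printed_eq]

end PrintAll

/-! ### Contexts: paths from the bottom up -/

namespace Level

variable {R Ω : Type*}

/-- Apply the levels of a context, the first one at first. -/
def applyCtx : List (Level R Ω) → Asg R Ω → Asg R Ω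
  | [], ν => ν
  | e :: K, ν => applyCtx K ((ν.comp e.σ).comp (e.τ.toAsg Ω))

/-- The valuation fits to the context. -/
def CtxFits : List (Level R Ω) → Asg R Ω → Prop
  | [], _ => True
  | e :: K, ν => ν.Fits e.σ ∧ (ν.comp e.σ).Fits (e.τ.toAsg Ω) ∧
      CtxFits K ((ν.comp e.σ).comp (e.τ.toAsg Ω))

/-- A descent adds new levels at the front, so a context has its deepest level first, whereas
printing works from the top down. Reversal translates one into the other. -/
theorem val_reverse_append (K L : List (Level R Ω)) :
    val (K.reverse ++ L) = applyCtx K (val L) := by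
  induction K generalizing L with
  | nil => rfl
  | cons e K ih =>
    rw [List.reverse_cons, List.append_assoc, List.singleton_append, ih]
    rfl

/-- The first level of a context is the deepest; when nothing lies below, it alone may be without
letters. -/
theorem pathOK_reverse_append {K L : List (Level R Ω)} (hL : PathOK L) (hK : CtxFits K (val L))
    (hc : ∀ e ∈ K, e.σ.Copyless) (hl : ∀ e ∈ K.tail, e.σ.HasLetter)
    (hne : L ≠ [] → ∀ e ∈ K, e.σ.HasLetter) : PathOK (K.reverse ++ L) := by
  induction K generalizing L with
  | nil => exact hL
  | cons e K ih =>
    rw [List.reverse_cons, List.append_assoc, List.singleton_append]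
    exact ih (L := e :: L) ⟨hc e (by simp), hK.1, hK.2.1, fun h => hne h e (by simp), hL⟩ hK.2.2
      (fun e he => hc e (by simp [he])) (fun e he => hl e (List.mem_of_mem_tail he))
      (fun _ e he => hl e he)

/-- All levels of the context are copyless and have letters, and all elements of the bag fit. -/
def CtxOK (K : List (Level R Ω)) (M : Multiset (Asg R Ω)) : Prop :=
  (∀ e ∈ K, e.σ.Copyless ∧ e.σ.HasLetter) ∧ ∀ ν ∈ M, CtxFits K ν

end Level

/-! ### Enumeration -/

section Logic

variable {R Ω : Type*}

open Level SST.Tree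

/-- The outputs for a bag, with a skeleton and a context to be applied. -/
def outs (M : Multiset (Asg R Ω)) (τ : Skel R) (K : List (Level R Ω)) : Multiset (Asg R Ω) :=
  (compAll M (τ.toAsg Ω)).map (applyCtx K)

theorem outs_add (M N : Multiset (Asg R Ω)) (τ : Skel R) (K : List (Level R Ω)) :
    outs (M + N) τ K = outs M τ K + outs N τ K := by
  simp [outs]

theorem outs_comp (M : Multiset (Asg R Ω)) (r τ : Skel R) (K : List (Level R Ω)) :
    outs (compAll M (r.toAsg Ω)) τ K = outs M (r.comp τ) K := by
  rw [outs, compAll_compAll, outs, Skel.toAsg_comp]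

/-- Going down to the child adds a single level, in which the skeleton of the item and the one still
pending are already composed. -/
theorem outs_item (M : Multiset (Asg R Ω)) (σ : Asg R Ω) (a τ : Skel R) (p : ℕ)
    (K : List (Level R Ω)) : outs (compAll (compAll M σ) (a.toAsg Ω)) τ K =
      M.map (applyCtx (⟨a.comp τ, p, σ⟩ :: K)) := by
  rw [outs_comp, outs, compAll, compAll, Multiset.map_map, Multiset.map_map]
  rfl

/-- Being ready to enumerate a bag. -/
def Fit (M : Multiset (Asg R Ω)) (τ : Skel R) (K : List (Level R Ω)) : Prop :=
  AllFit M (τ.toAsg Ω) ∧ CtxOK K (compAll M (τ.toAsg Ω))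

theorem fit_add {M N : Multiset (Asg R Ω)} {τ : Skel R} {K : List (Level R Ω)} :
    Fit (M + N) τ K ↔ Fit M τ K ∧ Fit N τ K := by
  simp only [Fit, CtxOK, allFit_add, compAll_add, Multiset.mem_add, or_imp, forall_and]
  tauto

theorem Fit.comp {M : Multiset (Asg R Ω)} {r τ : Skel R} {K : List (Level R Ω)}
    (h : Fit (compAll M (r.toAsg Ω)) τ K) (hr : AllFit M (r.toAsg Ω)) : Fit M (r.comp τ) K := by
  refine ⟨?_, h.2.1, ?_⟩
  · rw [Skel.toAsg_comp]
    exact hr.comp h.1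
  · rw [Skel.toAsg_comp, ← compAll_compAll]
    exact h.2.2

theorem Fit.item {M : Multiset (Asg R Ω)} {σ : Asg R Ω} {a τ : Skel R} {K : List (Level R Ω)}
    (h : Fit (compAll (compAll M σ) (a.toAsg Ω)) τ K) (ha : AllFit (compAll M σ) (a.toAsg Ω))
    (hσ : AllFit M σ) (p : ℕ) : ∀ ν ∈ M, CtxFits (⟨a.comp τ, p, σ⟩ :: K) ν := by
  intro ν hν
  have h' := h.comp ha
  have hm := Multiset.mem_map_of_mem (fun ν => ν.comp σ) hν
  exact ⟨hσ ν hν, h'.1 _ hm, h'.2.2 _ (Multiset.mem_map_of_mem _ hm)⟩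

/-- An entry of the stack: the list of a tree is to be enumerated, with a skeleton and a context to be
applied. -/
structure Entry (R Ω : Type*) where
  T : Tree R Ω
  τ : Skel R
  ctx : List (Level R Ω)

/-- The invariant of an entry. -/
def Entry.OK (x : Entry R Ω) : Prop := x.T.WF ∧ x.T.HasList ∧ Fit x.T.list x.τ x.ctx

/-- The outputs for the entries of a stack. -/
def stackOuts (S : List (Entry R Ω)) : Multiset (Asg R Ω) :=
  (S.map fun x => outs x.T.list x.τ x.ctx).sum

theorem stackOuts_cons (x : Entry R Ω) (S : List (Entry R Ω)) :
    stackOuts (x :: S) = outs x.T.list x.τ x.ctx + stackOuts S := by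
  simp [stackOuts]

end Logic

section Enumerate

variable {R Ω : Type*} [Fintype R] (ρ : R ≃ Fin (Fintype.card R)) (ω : Ω ↪ ℕ) (I : ℕ → ℕ)

open Level SST.Tree

/-- Push the current tree on the stack if it has a nonempty list. -/
def saveCmd : Cmd :=
  blk [fetch 66 62 4, .ite 66 (blk [.move 67 12, alloc [62, 63, 64, 65], .move 65 67]) .skip]

variable (R) in
/-- Go to the child of the current tree. -/
noncomputable def enterCmd : Cmd :=
  blk [fetch 66 62 0, compCmd R 66 66 63, fetch 67 62 1, .move 68 12, alloc [66, 67, 64],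
    .move 64 68, fetch 63 62 3, fetch 62 62 2]

variable (R) in
/-- One step down. -/
noncomputable def descendStep : Cmd := .seq saveCmd (enterCmd R)

/-- Move one level of the context to the path. -/
def reverseStep : Cmd :=
  blk [fetch 66 64 0, fetch 67 64 1, fetch 64 64 2, .move 68 12, alloc [66, 67, 61], .move 61 68]

variable (R) in
/-- Continue with the entry on the top of the stack. -/
noncomputable def popCmd : Cmd :=
  .ite 65
    (blk [fetch 62 65 0, fetch 63 65 1, fetch 64 65 2, fetch 65 65 3, fetch 66 62 6,
      .ite 66
        (blk [fetch 67 62 7, compCmd R 67 67 63, .move 68 12, alloc [66, 67, 64, 65],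
          .move 65 68])
        .skip,
      fetch 66 62 5, compCmd R 63 66 63, fetch 62 62 4])
    .skip

/-- Print one valuation and go to the next one. -/
noncomputable def enumBody : Cmd :=
  .seq (.loop 62 (descendStep R)) (.seq (.const 61 0) (.seq (.loop 64 reverseStep)
    (.seq (printCmd ρ) (popCmd R))))

/-- The loading of the arguments of the enumeration program. -/
def enumInit : Cmd :=
  blk [.const 2 0, .load 12 2, fetch 63 0 5, fetch 62 0 6, .const 64 0, .const 65 0]

/-- The enumeration program. -/
noncomputable def enumCmd : Cmd :=
  .seq enumInit (.seq (.loop 62 (enumBody ρ)) (blk [.const 2 0, .store 2 12]))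

theorem loopFree_descendStep : (descendStep R).LoopFree := by
  simp [descendStep, saveCmd, enterCmd, blk, LoopFree, loopFree_fetch, loopFree_alloc,
    loopFree_compCmd]

theorem loopFree_reverseStep : reverseStep.LoopFree := by
  simp [reverseStep, blk, LoopFree, loopFree_fetch, loopFree_alloc]

theorem loopFree_popCmd : (popCmd R).LoopFree := by
  simp [popCmd, blk, LoopFree, loopFree_fetch, loopFree_alloc, loopFree_compCmd]

/-- A stack is stored in the memory. -/
def StackIn (W : ℕ → ℕ) (f : ℕ) : List (Entry R Ω) → ℕ → Prop
  | [], q => q = 0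
  | x :: S, q => 0 < q ∧ q + 4 ≤ f ∧ x.T.Holds ρ ω I W f (W q) ∧ W (q + 1) = x.τ.code ∧
      LevelsIn ρ ω I W f x.ctx (W (q + 2)) ∧ StackIn W f S (W (q + 3))

variable {ρ ω I} {W W' : ℕ → ℕ} {f f' q : ℕ} {S : List (Entry R Ω)} {K L : List (Level R Ω)}
  {x : Entry R Ω}

theorem StackIn.mono (h : StackIn ρ ω I W f S q) (hW : Keeps f W W') (hf : f ≤ f') :
    StackIn ρ ω I W' f' S q := by
  induction S generalizing q with
  | nil => exact h
  | cons x S ih =>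
    obtain ⟨h0, h1, h2, h3, h4, h5⟩ := h
    refine ⟨h0, by omega, ?_, ?_, ?_, ?_⟩
    · rw [hW _ (by omega) (by omega)]
      exact h2.mono hW hf
    · rw [hW _ (by omega) (by omega), h3]
    · rw [hW _ (by omega) (by omega)]
      exact h4.mono hW hf
    · rw [hW _ (by omega) (by omega)]
      exact ih h5

theorem stackIn_writeAt {qT k qK : ℕ} (hf : 0 < f) (hT : x.T.Holds ρ ω I W f qT)
    (hk : k = x.τ.code) (hK : LevelsIn ρ ω I W f x.ctx qK) (hS : StackIn ρ ω I W f S q) :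
    StackIn ρ ω I (writeAt W f [qT, k, qK, q]) (f + 4) (x :: S) f := by
  have hW := keeps_writeAt f W [qT, k, qK, q]
  refine ⟨hf, le_rfl, ?_, ?_, ?_, ?_⟩
  · rw [show writeAt W f [qT, k, qK, q] f = qT from writeAt_get (i := 0) rfl]
    exact hT.mono hW (by omega)
  · rw [← hk]
    exact writeAt_get (i := 1) rfl
  · rw [writeAt_get (i := 2) rfl]
    exact hK.mono hW (by omega)
  · rw [writeAt_get (i := 3) rfl]
    exact hS.mono hW (by omega)

theorem levelsIn_writeAt {e : Level R Ω} {k : ℕ} (hf : 0 < f) (hk : k = e.τ.code)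
    (he : HoldsAsg ρ ω I e.p e.σ) (hL : LevelsIn ρ ω I W f L q) :
    LevelsIn ρ ω I (writeAt W f [k, e.p, q]) (f + 3) (e :: L) f := by
  have hW := keeps_writeAt f W [k, e.p, q]
  refine ⟨hf, le_rfl, ?_, ?_, he, ?_⟩
  · rw [← hk]
    exact writeAt_get (i := 0) rfl
  · exact writeAt_get (i := 1) rfl
  · rw [writeAt_get (i := 2) rfl]
    exact hL.mono hW (by omega)

/-- The registers used for the enumeration. -/
abbrev enumRegs : List ℕ := [61, 62, 63, 64, 65, 66, 67, 68] ++ printRegs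

variable {a c r l τ : Skel R} {p : ℕ} {σ : Asg R Ω} {child right left : Tree R Ω} {C : St}

/-- Only nonempty lists are pushed, so every entry of the stack promises an output. Testing the
right subtree suffices, since the invariant allows no left subtree without a right one. -/
theorem eval_saveCmd (hf : 0 < C.reg 12)
    (hT : (node a p σ c child r right l left).Holds ρ ω I C.mem (C.reg 12) (C.reg 62))
    (hw : (node a p σ c child r right l left).WF)
    (hτ : C.reg 63 = τ.code) (hK : LevelsIn ρ ω I C.mem (C.reg 12) K (C.reg 64))
    (hS : StackIn ρ ω I C.mem (C.reg 12) S (C.reg 65)) (hok : ∀ x ∈ S, x.OK)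
    (hfit : Fit (node a p σ c child r right l left).list τ K) :
    ∃ C' S', eval I saveCmd C = C' ∧ Grow [10, 11, 12, 65, 66, 67] C C' ∧ C'.out = C.out ∧
      StackIn ρ ω I C'.mem (C'.reg 12) S' (C'.reg 65) ∧ (∀ x ∈ S', x.OK) ∧
      stackOuts S' = outs (node a p σ c child r right l left).list τ K + stackOuts S := by
  obtain ⟨h0, h1, h2, h3, h4, h5, h6, h7, h8, h9, h10⟩ := id hT
  by_cases hr : right = nil
  · have hl : left = nil := by
      by_contra hl
      exact (hw.2.2.2.2.2.2.2.2.2 hl).1 hr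
    have hz : C.mem (C.reg 62 + 4) = 0 := by
      subst hr
      exact h7
    have hlist : (node a p σ c child r right l left).list = 0 := by
      subst hr hl
      simp [list_node]
    refine ⟨_, S, rfl, ⟨fun r hr => ?_, ?_, ?_⟩, ?_, ?_, hok, ?_⟩
    · simp only [List.mem_cons, List.not_mem_nil, or_false, not_or] at hr
      simp [saveCmd, eval_ite, hz, hr]
    · simp [saveCmd, eval_ite, hz, Keeps.refl]
    · simp [saveCmd, eval_ite, hz]
    · simp [saveCmd, eval_ite, hz]
    · simpa [saveCmd, eval_ite, hz] using hS
    · rw [hlist]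
      simp [outs]
  · have hz : C.mem (C.reg 62 + 4) ≠ 0 := h7.ne_zero.2 hr
    have hpush := stackIn_writeAt (x := ⟨node a p σ c child r right l left, τ, K⟩) hf hT hτ hK hS
    refine ⟨_, ⟨node a p σ c child r right l left, τ, K⟩ :: S, rfl, ⟨fun r hr => ?_, ?_, ?_⟩, ?_, ?_,
      ?_, stackOuts_cons _ _⟩
    · simp only [List.mem_cons, List.not_mem_nil, or_false, not_or] at hr
      simp [saveCmd, eval_ite, hz, hr]
    · simp [saveCmd, eval_ite, hz, keeps_writeAt]
    · simp [saveCmd, eval_ite, hz]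
    · simp [saveCmd, eval_ite, hz]
    · simpa [saveCmd, eval_ite, hz] using hpush
    · intro x hx
      rcases List.mem_cons.1 hx with rfl | hx
      · exact ⟨hw, hr, hfit⟩
      · exact hok x hx

theorem eval_enterCmd (hf : 0 < C.reg 12)
    (hT : (node a p σ c child r right l left).Holds ρ ω I C.mem (C.reg 12) (C.reg 62))
    (hτ : C.reg 63 = τ.code) (hK : LevelsIn ρ ω I C.mem (C.reg 12) K (C.reg 64)) :
    ∃ C', eval I (enterCmd R) C = C' ∧ Grow [10, 11, 12, 62, 63, 64, 66, 67, 68] C C' ∧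
      C'.out = C.out ∧ child.Holds ρ ω I C'.mem (C'.reg 12) (C'.reg 62) ∧ C'.reg 63 = c.code ∧
      LevelsIn ρ ω I C'.mem (C'.reg 12) (⟨a.comp τ, p, σ⟩ :: K) (C'.reg 64) := by
  obtain ⟨h0, h1, h2, h3, h4, h5, h6, h7, h8, h9, h10⟩ := id hT
  have hpush := levelsIn_writeAt (e := ⟨a.comp τ, p, σ⟩) hf rfl h4 hK
  have hk := keeps_writeAt (C.reg 12) C.mem [(a.comp τ).code, p, C.reg 64]
  have e2 := hk (C.reg 62 + 2) (by omega) (by omega)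
  have e3 := hk (C.reg 62 + 3) (by omega) (by omega)
  refine ⟨_, rfl, ⟨fun r hr => ?_, ?_, ?_⟩, ?_, ?_, ?_, ?_⟩
  · simp only [List.mem_cons, List.not_mem_nil, or_false, not_or] at hr
    simp [enterCmd, hr]
  · simp [enterCmd, keeps_writeAt]
  · simp [enterCmd]
  · simp [enterCmd]
  · simpa [enterCmd, h2, h3, hτ, e2] using h5.mono hk (show C.reg 12 ≤ C.reg 12 + 3 by omega)
  · simp [enterCmd, h2, h3, hτ, e3, h6]
  · simpa [enterCmd, h2, h3, hτ] using hpush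

end Enumerate

/-! ### The loops of the enumeration -/

section EnumerateLoops

variable {R Ω : Type*} [Fintype R] {ρ : R ≃ Fin (Fintype.card R)} {ω : Ω ↪ ℕ} {I : ℕ → ℕ}
  {S : List (Entry R Ω)} {K L : List (Level R Ω)} {τ : Skel R} {T : Tree R Ω} {C : St}

open Level SST.Tree

/-- The descent turns the bag of the current tree into one valuation, described by the context, and
the lists left on the stack. Each of its `k` rounds adds one level, so the length of the context
accounts for the time. -/
theorem runs_descend (hne : T ≠ nil) (hf : 0 < C.reg 12)
    (hT : T.Holds ρ ω I C.mem (C.reg 12) (C.reg 62)) (hw : T.WF)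
    (hτ : C.reg 63 = τ.code) (hK : LevelsIn ρ ω I C.mem (C.reg 12) K (C.reg 64))
    (hS : StackIn ρ ω I C.mem (C.reg 12) S (C.reg 65)) (hok : ∀ x ∈ S, x.OK)
    (hfit : Fit T.bag τ K) :
    ∃ C' K' S' k, Runs I (.loop 62 (descendStep R)) C (k * ((descendStep R).cost + 1) + 1) C' ∧
      Grow enumRegs C C' ∧ C'.out = C.out ∧ C'.reg 62 = 0 ∧
      LevelsIn ρ ω I C'.mem (C'.reg 12) K' (C'.reg 64) ∧
      StackIn ρ ω I C'.mem (C'.reg 12) S' (C'.reg 65) ∧ (∀ x ∈ S', x.OK) ∧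
      0 < k ∧ K'.length = K.length + k ∧
      ((∀ e ∈ K', e.σ.Copyless) ∧ (∀ e ∈ K'.tail, e.σ.HasLetter) ∧ CtxFits K' nowhere) ∧
      applyCtx K' nowhere ::ₘ stackOuts S' = outs T.bag τ K + stackOuts S := by
  induction T generalizing C K S τ with
  | nil => exact (hne rfl).elim
  | node a p σ c child r right l left ih _ _ =>
    rw [bag_node, fit_add] at hfit
    obtain ⟨C₁, S₁, he₁, hg₁, ho₁, hS₁, hok₁, hs₁⟩ := eval_saveCmd hf hT hw hτ hK hS hok hfit.2
    have hle₁ := hg₁.le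
    have hT₁ := hT.mono hg₁.mem hg₁.le
    have hK₁ := hK.mono hg₁.mem hg₁.le
    rw [← hg₁.reg 62 (by decide)] at hT₁
    rw [← hg₁.reg 64 (by decide)] at hK₁
    obtain ⟨C₂, he₂, hg₂, ho₂, hT₂, hτ₂, hK₂⟩ := eval_enterCmd (C := C₁) (by omega) hT₁
      (hτ ▸ hg₁.reg 63 (by decide)) hK₁
    have hle₂ := hg₂.le
    have hstep : eval I (descendStep R) C = C₂ := by rw [descendStep, eval_seq, he₁, he₂]
    have hrun := Runs.of_loopFree (I := I) (loopFree_descendStep (R := R)) C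
    rw [hstep] at hrun
    have hg : Grow enumRegs C C₂ :=
      (hg₁.weaken (by decide)).trans (hg₂.weaken (by decide))
    have ho : C₂.out = C.out := ho₂.trans ho₁
    have hS₂ : StackIn ρ ω I C₂.mem (C₂.reg 12) S₁ (C₂.reg 65) := by
      rw [hg₂.reg 65 (by decide)]
      exact hS₁.mono hg₂.mem hg₂.le
    have h62 : C.reg 62 ≠ 0 := hT.ne_zero.2 hne
    have hfits := hfit.1.item hw.2.2.2.2.1 hw.2.2.2.1 p
    have houts := outs_item (source child c) σ a τ p K
    -- Without a child the item is a valuation: its source is `nowhere`, and the context describes a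
    -- complete output.
    by_cases hc : child = nil
    · subst hc
      have hsource : source (nil : Tree R Ω) c = {nowhere} := rfl
      rw [hsource] at hfits houts
      refine ⟨C₂, _, S₁, 1, (Runs.loop_step h62 hrun (Runs.loop_done hT₂)).mono (by omega), hg, ho,
        hT₂, hK₂, hS₂, hok₁, one_pos, rfl, ⟨?_, ?_, hfits _ (by simp)⟩, ?_⟩
      · intro e he
        rcases List.mem_cons.1 he with rfl | he
        · exact hw.1
        · exact (hfit.2.2.1 e he).1
      · exact fun e he => (hfit.2.2.1 e he).2
      · rw [bag_node, outs_add, hs₁, hsource, houts, Multiset.map_singleton, add_assoc,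
          Multiset.singleton_add]
    · have hsource : source child c = compAll child.bag (c.toAsg Ω) := by
        rw [source, isNil_iff_not.2 hc]
        rfl
      rw [hsource] at hfits houts
      obtain ⟨C', K', S', k, hr, hg', ho', h0, hK', hS', hok', hk, hlen, hctx, hsum⟩ :=
        ih (C := C₂) hc (by omega) hT₂ hw.2.1 hτ₂ hK₂ hS₂ hok₁
          ⟨(hw.2.2.1 hc).2, fun e he => by
            rcases List.mem_cons.1 he with rfl | he
            · exact ⟨hw.1, (hw.2.2.1 hc).1⟩
            · exact hfit.2.2.1 e he, hfits⟩
      refine ⟨C', K', S', k + 1, (Runs.loop_step h62 hrun hr).mono ?_, hg.trans hg', ho'.trans ho, h0,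
        hK', hS', hok', by omega, ?_, hctx, ?_⟩
      · rw [add_mul]
        omega
      · rw [hlen, List.length_cons]
        omega
      · rw [hsum, hs₁, bag_node, outs_add, hsource, houts, outs, add_assoc]

theorem runs_reverse (hf : 0 < C.reg 12) (hK : LevelsIn ρ ω I C.mem (C.reg 12) K (C.reg 64))
    (hL : LevelsIn ρ ω I C.mem (C.reg 12) L (C.reg 61)) :
    ∃ C', Runs I (.loop 64 reverseStep) C (K.length * (reverseStep.cost + 1) + 1) C' ∧
      Grow [10, 11, 12, 61, 64, 66, 67, 68] C C' ∧ C'.out = C.out ∧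
      LevelsIn ρ ω I C'.mem (C'.reg 12) (K.reverse ++ L) (C'.reg 61) := by
  induction K generalizing C L with
  | nil => exact ⟨C, (Runs.loop_done hK).mono (by omega), .refl _ _, rfl, hL⟩
  | cons e K ih =>
    obtain ⟨h0, h1, h2, h3, h4, h5⟩ := hK
    have hpush := levelsIn_writeAt (e := e) hf h2 h4 hL
    have hrun := Runs.of_loopFree (I := I) loopFree_reverseStep C
    obtain ⟨C₁, he, hg, ho, hK₁, hL₁⟩ : ∃ C₁, eval I reverseStep C = C₁ ∧
        Grow [10, 11, 12, 61, 64, 66, 67, 68] C C₁ ∧ C₁.out = C.out ∧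
        LevelsIn ρ ω I C₁.mem (C₁.reg 12) K (C₁.reg 64) ∧
        LevelsIn ρ ω I C₁.mem (C₁.reg 12) (e :: L) (C₁.reg 61) := by
      refine ⟨_, rfl, ⟨fun r hr => ?_, ?_, ?_⟩, ?_, ?_, ?_⟩
      · simp only [List.mem_cons, List.not_mem_nil, or_false, not_or] at hr
        simp [reverseStep, hr]
      · simp [reverseStep, keeps_writeAt]
      · simp [reverseStep]
      · simp [reverseStep]
      · simpa [reverseStep] using h5.mono (keeps_writeAt (C.reg 12) C.mem
          [C.mem (C.reg 64), C.mem (C.reg 64 + 1), C.reg 61])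
          (show C.reg 12 ≤ C.reg 12 + 3 by omega)
      · simpa [reverseStep, h3] using hpush
    have hle := hg.le
    obtain ⟨C', hr, hg', ho', hL'⟩ := ih (C := C₁) (by omega) hK₁ hL₁
    refine ⟨C', ?_, hg.trans hg', ho'.trans ho, by simpa using hL'⟩
    rw [he] at hrun
    refine (Runs.loop_step h0.ne' hrun hr).mono ?_
    rw [List.length_cons, add_mul]
    omega

variable (ρ ω I) in
/-- The bag `M` is still to be enumerated. -/
def EnumIn (C : St) (M : Multiset (Asg R Ω)) : Prop :=
  (C.reg 62 = 0 ∧ M = 0) ∨ ∃ (T : Tree R Ω) (τ : Skel R) (K : List (Level R Ω))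
    (S : List (Entry R Ω)), T ≠ nil ∧ T.Holds ρ ω I C.mem (C.reg 12) (C.reg 62) ∧ T.WF ∧
      C.reg 63 = τ.code ∧ LevelsIn ρ ω I C.mem (C.reg 12) K (C.reg 64) ∧
      StackIn ρ ω I C.mem (C.reg 12) S (C.reg 65) ∧ (∀ x ∈ S, x.OK) ∧ Fit T.bag τ K ∧
      M = outs T.bag τ K + stackOuts S

/-- An entry on the stack has a nonempty list, so its right subtree is nonempty and becomes the
current tree without any search. What remains is the list of the left subtree, pushed only if there
is one. -/
theorem eval_popCmd (hf : 0 < C.reg 12) (h0 : C.reg 62 = 0)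
    (hS : StackIn ρ ω I C.mem (C.reg 12) S (C.reg 65)) (hok : ∀ x ∈ S, x.OK) :
    ∃ C', eval I (popCmd R) C = C' ∧ Grow enumRegs C C' ∧ C'.out = C.out ∧
      EnumIn ρ ω I C' (stackOuts S) := by
  cases S with
  | nil =>
    refine ⟨C, eval_ite_neg hS, .refl _ _, rfl, .inl ⟨h0, rfl⟩⟩
  | cons x S =>
    obtain ⟨T, τ, K⟩ := x
    obtain ⟨k0, k1, k2, k3, k4, k5⟩ := hS
    obtain ⟨hw, hl, hfit⟩ := hok _ (List.mem_cons_self ..)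
    have hokS : ∀ x ∈ S, x.OK := fun x hx => hok x (by simp [hx])
    simp only at k2 k3 k4 hw hl hfit
    cases T with
    | nil => exact hl.elim
    | node a p σ c child r right l left =>
      obtain ⟨h0, h1, h2, h3, h4, h5, h6, h7, h8, h9, h10⟩ := k2
      obtain ⟨w1, w2, w3, w4, w5, w6, w7, w8, w9, w10⟩ := hw
      rw [list_node, fit_add] at hfit
      have hfr := hfit.1.comp w7
      have hfl := hfit.2.comp w9
      have hsum : stackOuts (⟨node a p σ c child r right l left, τ, K⟩ :: S) =
          outs right.bag (r.comp τ) K + (outs left.list (l.comp τ) K + stackOuts S) := by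
        rw [stackOuts_cons, list_node, outs_add, outs_comp, outs_comp, add_assoc]
      rw [hsum]
      by_cases hleft : left = nil
      · subst hleft
        have hz : C.mem (C.mem (C.reg 65) + 6) = 0 := h9
        refine ⟨_, rfl, ⟨fun r hr => ?_, ?_, ?_⟩, ?_, .inr ⟨right, r.comp τ, K, S, hl, ?_, w6, ?_, ?_,
          ?_, hokS, hfr, ?_⟩⟩
        · simp only [enumRegs, printRegs, List.mem_append, List.mem_cons, List.not_mem_nil, or_false,
            not_or] at hr
          simp [popCmd, eval_ite, k0.ne', hz, hr]
        · simp [popCmd, eval_ite, k0.ne', hz, Keeps.refl]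
        · simp [popCmd, eval_ite, k0.ne', hz]
        · simp [popCmd, eval_ite, k0.ne', hz]
        · simpa [popCmd, eval_ite, k0.ne', hz] using h7
        · simp [popCmd, eval_ite, k0.ne', hz, h8, k3]
        · simpa [popCmd, eval_ite, k0.ne', hz] using k4
        · simpa [popCmd, eval_ite, k0.ne', hz] using k5
        · simp [outs]
      · have hz : C.mem (C.mem (C.reg 65) + 6) ≠ 0 := h9.ne_zero.2 hleft
        -- The remaining list is nonempty by the invariant of trees, and it shares the context of
        -- the removed entry.
        have hpush := stackIn_writeAt (x := ⟨left, l.comp τ, K⟩) hf h9 rfl k4 k5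
        have hk := keeps_writeAt (C.reg 12) C.mem [C.mem (C.mem (C.reg 65) + 6), (l.comp τ).code,
          C.mem (C.reg 65 + 2), C.mem (C.reg 65 + 3)]
        have e4 := hk (C.mem (C.reg 65) + 4) (by omega) (by omega)
        have e5 := hk (C.mem (C.reg 65) + 5) (by omega) (by omega)
        have hle : C.reg 12 ≤ C.reg 12 + 4 := by omega
        refine ⟨_, rfl, ⟨fun r hr => ?_, ?_, ?_⟩, ?_, .inr ⟨right, r.comp τ, K,
          ⟨left, l.comp τ, K⟩ :: S, hl, ?_, w6, ?_, ?_, ?_, ?_, hfr, ?_⟩⟩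
        · simp only [enumRegs, printRegs, List.mem_append, List.mem_cons, List.not_mem_nil, or_false,
            not_or] at hr
          simp [popCmd, eval_ite, k0.ne', hz, hr]
        · simp [popCmd, eval_ite, k0.ne', hz, keeps_writeAt]
        · simp [popCmd, eval_ite, k0.ne', hz]
        · simp [popCmd, eval_ite, k0.ne', hz]
        · simpa [popCmd, eval_ite, k0.ne', hz, h10, k3, e4] using h7.mono hk hle
        · simp [popCmd, eval_ite, k0.ne', hz, h10, k3, e5, h8]
        · simpa [popCmd, eval_ite, k0.ne', hz, h10, k3] using k4.mono hk hle
        · simpa [popCmd, eval_ite, k0.ne', hz, h10, k3] using hpush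
        · intro x hx
          rcases List.mem_cons.1 hx with rfl | hx
          · exact ⟨w8, (w10 hleft).2, hfl⟩
          · exact hokS x hx
        · rw [stackOuts_cons]

variable (ρ) in
/-- A bound for the time between two outputs, per symbol of the output. -/
noncomputable def bodyCost : ℕ :=
  (descendStep R).cost + reverseStep.cost + printCost ρ + (popCmd R).cost + 10

/-- Descent and reversal take time proportional to the length of the path, which is at most the size
of the output plus one; printing is linear, and popping takes constant time. -/
theorem runs_enumBody {M : Multiset (Asg R Ω)} (hf : 0 < C.reg 12) (h : EnumIn ρ ω I C M)
    (h62 : C.reg 62 ≠ 0) :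
    ∃ C' v M', Runs I (enumBody ρ) C (bodyCost ρ * (v.size + 1)) C' ∧ Grow enumRegs C C' ∧
      C'.out = C.out ++ printed ρ ω v ∧ EnumIn ρ ω I C' M' ∧ M = v ::ₘ M' := by
  rcases h with ⟨h, _⟩ | ⟨T, τ, K, S, hne, hT, hw, hτ, hK, hS, hok, hfit, rfl⟩
  · exact (h62 h).elim
  obtain ⟨C₁, K', S', k, hr₁, hg₁, ho₁, h0, hK', hS', hok', hk, hlen, hctx, hsum⟩ :=
    runs_descend hne hf hT hw hτ hK hS hok hfit
  have hle₁ := hg₁.le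
  have hr₂ := Runs.of_loopFree (I := I) (P := .const 61 0) trivial C₁
  obtain ⟨C₃, hr₃, hg₃, ho₃, hL⟩ := runs_reverse (ρ := ρ) (ω := ω) (I := I) (K := K') (L := [])
    (C := eval I (.const 61 0) C₁) (by simpa using (by omega : 0 < C₁.reg 12)) (by simpa using hK')
    (by simp [LevelsIn])
  have hg₂ : Grow enumRegs C₁ (eval I (.const 61 0) C₁) := by
    refine ⟨fun r hr => ?_, ?_, ?_⟩
    · have : r ≠ 61 := by
        rintro rfl
        exact hr (by decide)
      simp [this]
    · simp [Keeps.refl]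
    · simp
  have hg₂₃ := hg₂.trans (hg₃.weaken (by decide))
  have hle₃ := hg₂₃.le
  have hval := val_reverse_append K' ([] : List (Level R Ω))
  have hpath := pathOK_reverse_append (K := K') (L := []) trivial hctx.2.2 hctx.1 hctx.2.1
    (fun h => (h rfl).elim)
  rw [List.append_nil] at hval hpath hL
  have hlen' := length_le hpath
  rw [List.length_reverse] at hlen'
  have hval' : val K'.reverse = applyCtx K' nowhere := hval
  -- The descent makes at least one round, so the path is not empty.
  cases hrev : K'.reverse with
  | nil =>
    rw [List.reverse_eq_nil_iff.1 hrev] at hlen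
    simp only [List.length_nil] at hlen
    omega
  | cons e L =>
    rw [hrev] at hL hpath hlen' hval'
    obtain ⟨C₄, hr₄, hg₄, ho₄⟩ := runs_printCmd (C := C₃) (by omega) hL hpath
    have hle₄ := hg₄.le
    obtain ⟨C₅, he₅, hg₅, ho₅, hE⟩ := eval_popCmd (ρ := ρ) (ω := ω) (I := I) (S := S') (C := C₄)
      (by omega)
      (by
        rw [hg₄.reg 62 (by decide), hg₃.reg 62 (by decide)]
        simpa using h0)
      (by
        rw [hg₄.reg 65 (by decide), hg₃.reg 65 (by decide)]
        have := hS'.mono (hg₂₃.mem.trans hg₄.mem hle₃) (hle₃.trans hle₄)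
        simpa using this) hok'
    have hr₅ := Runs.of_loopFree (I := I) (loopFree_popCmd (R := R)) C₄
    rw [he₅] at hr₅
    refine ⟨C₅, val (e :: L), stackOuts S', (hr₁.seq (hr₂.seq (hr₃.seq (hr₄.seq hr₅)))).mono ?_,
      ((hg₁.trans hg₂₃).trans (hg₄.weaken (by decide))).trans hg₅, ?_, hE, ?_⟩
    · set z := (val (e :: L)).size + 1
      -- The descent from the old context makes at most as many rounds as the final context has
      -- levels.
      have a1 : k * ((descendStep R).cost + 1) ≤ ((descendStep R).cost + 1) * z := by
        rw [mul_comm]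
        exact Nat.mul_le_mul_left _ (by omega)
      have a2 : K'.length * (reverseStep.cost + 1) ≤ (reverseStep.cost + 1) * z := by
        rw [mul_comm]
        exact Nat.mul_le_mul_left _ (by omega)
      have a3 : (popCmd R).cost + 8 ≤ ((popCmd R).cost + 8) * z := Nat.le_mul_of_pos_right _ (by omega)
      have a4 : bodyCost ρ * z = ((descendStep R).cost + 1) * z + (reverseStep.cost + 1) * z +
          printCost ρ * z + ((popCmd R).cost + 8) * z := by
        rw [bodyCost]
        ring
      rw [a4]
      simp only [cost]
      omega
    · rw [ho₅, ho₄, ho₃]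
      simp [ho₁]
    · rw [← hsum, hval']

end EnumerateLoops

/-! ### Timing of the whole enumeration -/

section EnumerationSpec

variable {R Ω : Type*} [Fintype R] {ρ : R ≃ Fin (Fintype.card R)} {ω : Ω ↪ ℕ} {I : ℕ → ℕ}

theorem iterate_add_of_eq {α : Type*} {f : α → α} {x y z : α} {m n : ℕ} (h : f^[m] x = y)
    (h' : f^[n] y = z) : f^[m + n] x = z := by
  rw [Nat.add_comm, Function.iterate_add_apply, h, h']

/-- The main loop of the enumeration. -/
theorem enumLoop_spec (n : ℕ) {C : St} {M : Multiset (Asg R Ω)} (hn : M.card = n)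
    (hf : 0 < C.reg 12) (h : EnumIn ρ ω I C M) (Q : List Cmd) :
    ∃ (vs : List (Asg R Ω)) (t : ℕ → ℕ) (C' : St), (vs : Multiset (Asg R Ω)) = M ∧ t 0 = 0 ∧
      (∀ (i : ℕ) (h : i < vs.length), t i ≤ t (i + 1) ∧
        t (i + 1) ≤ t i + (bodyCost ρ + 1) * ((vs[i]).size + 1) ∧
        ((step I)^[t (i + 1)] ⟨.loop 62 (enumBody ρ) :: Q, C.reg, C.mem, C.out⟩).out =
          C.out ++ (vs.take (i + 1)).flatMap (printed ρ ω)) ∧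
      (step I)^[t vs.length + 1] ⟨.loop 62 (enumBody ρ) :: Q, C.reg, C.mem, C.out⟩ =
        ⟨Q, C'.reg, C'.mem, C'.out⟩ ∧
      Grow enumRegs C C' ∧ C'.out = C.out ++ vs.flatMap (printed ρ ω) := by
  induction n generalizing C M with
  | zero =>
    have hM := Multiset.card_eq_zero.1 hn
    by_cases h62 : C.reg 62 = 0
    · refine ⟨[], fun _ => 0, C, hM.symm, rfl, by simp, ?_, .refl _ _, by simp⟩
      simp [step, h62]
    -- A further round would produce an element of the empty bag.
    · obtain ⟨_, v, M', _, _, _, _, hv⟩ := runs_enumBody hf h h62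
      rw [hM] at hv
      exact (Multiset.zero_ne_cons hv).elim
  | succ n ih =>
    have h62 : C.reg 62 ≠ 0 := by
      intro h62
      rcases h with ⟨_, rfl⟩ | ⟨T, τ, K, S, hne, hT, _⟩
      · simp at hn
      · exact hT.ne_zero.2 hne h62
    obtain ⟨C₁, v, M', ⟨u, hu, hr⟩, hg, ho, hE, rfl⟩ := runs_enumBody hf h h62
    have hle := hg.le
    obtain ⟨vs, t, C', hvs, h0, hi, hend, hg', ho'⟩ := ih (C := C₁) (by simpa using hn) (by omega) hE
    -- One step for the test of the loop and `u` for its body; all later output times are shifted by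
    -- `1 + u`.
    have hfirst : (step I)^[1 + u] ⟨.loop 62 (enumBody ρ) :: Q, C.reg, C.mem, C.out⟩ =
        ⟨.loop 62 (enumBody ρ) :: Q, C₁.reg, C₁.mem, C₁.out⟩ :=
      iterate_add_of_eq (y := ⟨enumBody ρ :: .loop 62 (enumBody ρ) :: Q, C.reg, C.mem, C.out⟩)
        (by simp [step, h62]) (hr _)
    refine ⟨v :: vs, fun i => if i = 0 then 0 else 1 + u + t (i - 1), C', ?_, rfl, ?_, ?_, hg.trans hg',
      ?_⟩
    · rw [← hvs, Multiset.cons_coe]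
    · intro i hi'
      simp only [Nat.add_eq_zero_iff, one_ne_zero, and_false, if_false, Nat.add_sub_cancel]
      cases i with
      | zero =>
        simp only [if_true, h0, List.getElem_cons_zero, Nat.zero_le, true_and, add_zero, zero_add]
        constructor
        · rw [add_mul]
          omega
        · rw [hfirst, ho]
          simp
      | succ i =>
        obtain ⟨a1, a2, a3⟩ := hi i (by simpa using hi')
        simp only [Nat.add_eq_zero_iff, one_ne_zero, and_false, if_false, Nat.add_sub_cancel,
          List.getElem_cons_succ]
        refine ⟨by omega, by omega, ?_⟩
        rw [iterate_add_of_eq hfirst rfl, a3, ho]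
        simp
    · simp only [List.length_cons, Nat.add_eq_zero_iff, one_ne_zero, and_false, if_false,
        Nat.add_sub_cancel]
      rw [add_assoc]
      exact iterate_add_of_eq hfirst hend
    · rw [ho', ho]
      simp

variable (ρ) in
/-- The constant for the delay of the enumeration. -/
noncomputable def delay : ℕ := bodyCost ρ + enumInit.cost + 20

/-- The handle of the node is loaded directly, so no preprocessing is needed. Records made during
the enumeration lie above the old free pointer, which is why the structure survives. -/
theorem enumCmd_spec {D : ECSA R Ω} {s W : ℕ → ℕ} (h : Good ρ ω I W (W 0) D) (hn : s 0 ∈ D.nodes) :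
    ∃ W', EnumeratesWithOutputLinearDelay ρ ω I (delay ρ) (enumCmd ρ) s W (D.bag (s 0)) W' ∧
      Good ρ ω I W' (W' 0) D := by
  obtain ⟨τ, T, h5, hT, hne, hw, hfit, hM⟩ := (h.node _ hn).handle
  obtain ⟨C, hC, hmem, hout, h12, hE⟩ : ∃ C, eval I enumInit ⟨s, W, []⟩ = C ∧ C.mem = W ∧
      C.out = [] ∧ C.reg 12 = W 0 ∧ EnumIn ρ ω I C (D.bag (s 0)) := by
    refine ⟨_, rfl, ?_, ?_, ?_, .inr ⟨T, τ, [], [], hne, ?_, hw, ?_, ?_, ?_, by simp,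
      ⟨hfit, by simp, fun _ _ => trivial⟩, ?_⟩⟩
    · simp [enumInit]
    · simp [enumInit]
    · simp [enumInit]
    · simpa [enumInit] using hT
    · simp [enumInit, h5]
    · simp [enumInit, LevelsIn]
    · simp [enumInit, StackIn]
    · rw [outs, hM]
      simp [stackOuts, Level.applyCtx]
  have hfree : enumInit.LoopFree := by simp [enumInit, blk, LoopFree, loopFree_fetch]
  obtain ⟨u, hu, hinit⟩ := Runs.of_loopFree (I := I) hfree ⟨s, W, []⟩
  rw [hC] at hinit
  obtain ⟨vs, t, C', hvs, h0, hi, hend, hg, ho⟩ := enumLoop_spec _ rfl (by rw [h12]; exact h.pos) hE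
    [blk [.const 2 0, .store 2 12]]
  -- The two steps besides `u` unfold the two sequential compositions around the initialization.
  have hstart : (step I)^[u + 2] ⟨[enumCmd ρ], s, W, []⟩ =
      ⟨.loop 62 (enumBody ρ) :: [blk [.const 2 0, .store 2 12]], C.reg, C.mem, C.out⟩ := by
    have h1 := iterate_add_of_eq (f := step I) (m := 1) (x := ⟨[enumCmd ρ], s, W, []⟩) rfl
      (hinit [.seq (.loop 62 (enumBody ρ)) (blk [.const 2 0, .store 2 12])])
    rw [show u + 2 = (1 + u) + 1 by omega]
    exact iterate_add_of_eq h1 rfl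
  have hfin : (step I)^[5] ⟨[blk [.const 2 0, .store 2 12]], C'.reg, C'.mem, C'.out⟩ =
      ⟨[], Function.update C'.reg 2 0, Function.update C'.mem 0 (C'.reg 12), C'.out⟩ := by
    simp [step, blk]
  have hall := iterate_add_of_eq (iterate_add_of_eq hstart hend) hfin
  have hle := hg.le
  have hk := hg.mem
  rw [h12] at hle
  rw [hmem, h12] at hk
  -- The steps before the main loop are charged to the first output, whose allowance is at least the
  -- constant.
  have hlen : ∀ z, bodyCost ρ + 1 + (enumInit.cost + 19) ≤ delay ρ ∧ (u + 2 ≤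
      (enumInit.cost + 19) * (z + 1)) := fun z => ⟨by rw [delay]; omega, by
    have : enumInit.cost + 19 ≤ (enumInit.cost + 19) * (z + 1) :=
      Nat.le_mul_of_pos_right _ (by omega)
    omega⟩
  refine ⟨Function.update C'.mem 0 (C'.reg 12), ⟨vs, fun i => if i = 0 then 0 else u + 2 + t i,
    u + 2 + (t vs.length + 1) + 5, hvs, rfl, ?_, ?_, ?_, ?_, ?_, ?_⟩, ?_⟩
  · intro i hi'
    obtain ⟨a1, a2, a3⟩ := hi i hi'
    obtain ⟨b1, b2⟩ := hlen (vs[i]).size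
    have b3 := Nat.mul_le_mul_right ((vs[i]).size + 1) b1
    rw [add_mul (bodyCost ρ + 1)] at b3
    simp only [Nat.add_eq_zero_iff, one_ne_zero, and_false, if_false]
    refine ⟨?_, ?_, ?_⟩
    · split_ifs <;> omega
    · split_ifs with hi0
      · subst hi0
        omega
      · omega
    · rw [runFor, iterate_add_of_eq hstart rfl, a3, hout, List.nil_append]
  · dsimp only
    split_ifs <;> omega
  · rw [delay]
    dsimp only
    -- With no output at all, the initial steps are not covered by an output time and must fit into
    -- the final constant.
    split_ifs with hl
    · rw [hl, h0]
      omega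
    · omega
  · rw [runFor, hall]
  · rw [runFor, hall, ho, hout, List.nil_append]
  · rw [runFor, hall]
  · rw [Function.update_self]
    refine h.mono (fun a ha hlt => ?_) hle
    rw [Function.update_of_ne ha.ne', hk a ha hlt]

theorem HaltsWithin.mono {c c' res : ℕ} {P : Cmd} {s W W' : ℕ → ℕ}
    (h : HaltsWithin I c P s W res W') (hc : c ≤ c') : HaltsWithin I c' P s W res W' := by
  obtain ⟨t, ht, h⟩ := h
  exact ⟨t, ht.trans hc, h⟩

theorem EnumeratesWithOutputLinearDelay.mono {c c' : ℕ} {P : Cmd} {s W W' : ℕ → ℕ}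
    {M : Multiset (Asg R Ω)} (h : EnumeratesWithOutputLinearDelay ρ ω I c P s W M W')
    (hc : c ≤ c') : EnumeratesWithOutputLinearDelay ρ ω I c' P s W M W' := by
  obtain ⟨vs, t, T, h1, h2, h3, h4, h5, h6⟩ := h
  refine ⟨vs, t, T, h1, h2, fun i hi => ?_, h4, by omega, h6⟩
  obtain ⟨a1, a2, a3⟩ := h3 i hi
  exact ⟨a1, a2.trans (Nat.add_le_add_left (Nat.mul_le_mul_right _ hc) _), a3⟩

end EnumerationSpec

end SST

/-! ### The theorem -/

theorem mainTheorem9 {R : Type*} [Fintype R] (ρ : R ≃ Fin (Fintype.card R)) :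
    -- the programs and the constant depend on nothing but the set of registers
    ∃ (P : SST.Implementation) (c : ℕ), ∀ {Ω : Type*} (ω : Ω ↪ ℕ) (I : ℕ → ℕ),
    -- `Inv W D`: `D` is the structure currently kept in the work memory `W`
    ∃ Inv : (ℕ → ℕ) → SST.ECSA R Ω → Prop,
      -- initialization with the empty structure
      (∀ s W : ℕ → ℕ, ∃ res W', SST.HaltsWithin I c P.init s W res W' ∧ Inv W' SST.ECSA.empty) ∧
      -- what is kept in memory is an ECSA, and it is garbage-free
      (∀ W D, Inv W D → D.StoredIn ρ ω I W ∧ D.GarbageFree) ∧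
      -- add
      (∀ W D, Inv W D → ∀ (ν : SST.Asg R Ω) (s : ℕ → ℕ), ν.IsValuation →
        SST.HoldsAsg ρ ω I (s 0) ν →
        ∃ n' W' D', SST.HaltsWithin I c P.add s W n' W' ∧ Inv W' D' ∧ D.Extends D' ∧
          n' ∈ D'.nodes ∧ D'.bag n' = {ν} ∧
          D'.Safe n' ∧ (D.Bounded 4 → D'.Bounded 4)) ∧
      -- extend
      (∀ W D, Inv W D → ∀ (σ : SST.Asg R Ω) (s : ℕ → ℕ), s 0 ∈ D.nodes →
        σ.Copyless → ¬ σ.IsValuation → SST.HoldsAsg ρ ω I (s 1) σ →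
        (∀ ν ∈ D.bag (s 0), ν.dom = σ.reg) →
        ∃ n' W' D', SST.HaltsWithin I c P.extend s W n' W' ∧ Inv W' D' ∧ D.Extends D' ∧
          n' ∈ D'.nodes ∧ D'.bag n' = (D.bag (s 0)).map (fun ν => ν.comp σ) ∧
          (D.Safe (s 0) → D'.Safe n' ∧ (D.Bounded 4 → D'.Bounded 4))) ∧
      -- union
      (∀ W D, Inv W D → ∀ s : ℕ → ℕ, s 0 ∈ D.nodes → s 1 ∈ D.nodes →
        (∀ ν₁ ∈ D.bag (s 0), ∀ ν₂ ∈ D.bag (s 1), ν₁.dom = ν₂.dom) →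
        ∃ n' W' D', SST.HaltsWithin I c P.union s W n' W' ∧ Inv W' D' ∧ D.Extends D' ∧
          n' ∈ D'.nodes ∧ D'.bag n' = D.bag (s 0) + D.bag (s 1) ∧
          (D.Safe (s 0) → D.Safe (s 1) → D'.Safe n' ∧ (D.Bounded 4 → D'.Bounded 4))) ∧
      -- enumeration, after which the structure is still available
      (∀ W D, Inv W D → D.Bounded 4 → ∀ s : ℕ → ℕ, s 0 ∈ D.nodes →
        ∃ W', SST.EnumeratesWithOutputLinearDelay ρ ω I c P.enumerate s W (D.bag (s 0)) W' ∧
          Inv W' D) := by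
  refine ⟨⟨SST.initCmd ρ, SST.addCmd ρ, SST.extendCmd ρ, SST.unionCmd R, SST.enumCmd ρ⟩,
    (SST.initCmd ρ).cost + (SST.addCmd ρ).cost + (SST.extendCmd ρ).cost + (SST.unionCmd R).cost +
      SST.delay ρ, ?_⟩
  intro Ω ω I
  -- The free pointer that bounds the used memory is kept in cell `0` between operations.
  refine ⟨fun W D => SST.Good ρ ω I W (W 0) D, ?_, ?_, ?_, ?_, ?_, ?_⟩
  · intro s W
    refine ⟨_, _, SST.Cmd.haltsWithin_of_loopFree (SST.loopFree_initCmd ρ) (by omega) s W, ?_⟩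
    have h {a : ℕ} := SST.eval_initCmd (ρ := ρ) (I := I) ⟨s, W, []⟩ (a := a)
    have h0 : 0 < SST.staticEnd R := by simp only [SST.staticEnd, SST.tableAddr]; omega
    refine ⟨fun a _ ha => h ha, ?_, by simp [SST.ECSA.empty], SST.ECSA.garbageFree_empty⟩
    rw [h h0]
    simp [SST.staticMem]
  · exact fun W D h => ⟨h.storedIn, h.garbageFree⟩
  · intro W D h ν s hν hs
    obtain ⟨C', he, D', hD', hins⟩ := SST.addCmd_spec h hν hs
    have hh := SST.Cmd.haltsWithin_of_loopFree (I := I) (SST.loopFree_addCmd ρ) le_rfl s W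
    rw [he] at hh
    obtain ⟨hod, hso⟩ := hins.odepth_asg_eq_zero (.inl hν)
    exact ⟨_, _, D', hh.mono (by omega), hD', hins.sub.extends, hins.mem, hins.bag_nu, .inl hso,
      fun hb => hins.bounded hb (by omega)⟩
  · intro W D h σ s hn hσ hv hs hfit
    obtain ⟨C', he, D', hD', hsub, hn', hbag, hsafe⟩ := SST.extendCmd_spec h hn hσ hv hs hfit
    have hh := SST.Cmd.haltsWithin_of_loopFree (I := I) (SST.loopFree_extendCmd ρ) le_rfl s W
    rw [he] at hh
    exact ⟨_, _, D', hh.mono (by omega), hD', hsub.extends, hn', hbag, hsafe⟩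
  · intro W D h s h₁ h₂ hd
    obtain ⟨C', he, D', hD', hsub, hn', hbag, hsafe⟩ := SST.unionCmd_spec h h₁ h₂ hd
    have hh := SST.Cmd.haltsWithin_of_loopFree (I := I) (SST.loopFree_unionCmd R) le_rfl s W
    rw [he] at hh
    exact ⟨_, _, D', hh.mono (by omega), hD', hsub.extends, hn', hbag, hsafe⟩
  · intro W D h _ s hn
    obtain ⟨W', he, hW'⟩ := SST.enumCmd_spec h hn
    exact ⟨W', he.mono (by omega), hW'⟩
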